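/- **Definitions.** For $m\ge 3$ let $P_m$ be the boundary complex of an $m$-gon. For a simplicial complex $K$ and a vertex $v$ of $K$, the simplicial wedge $\operatorname{wed}_v K$ is the complex obtained by replacing $v$ by two vertices $v_1,v_2$, with $$\operatorname{wed}_vK=\bigl(\{v_1,v_2\}*\operatorname{lk}_K(v)\bigr)\cup\bigl(\{\{v_1\},\{v_2\}\}*(K\setminus v)\bigr),$$ where in the first term $\{v_1,v_2\}$ is a full edge and $K\setminus v$ is the deletion of $v$. For $J=(j_1,\dots,j_m)\in\mathbb Z_{+}^m$ (positive integers) let $P_m(J)$ be the complex obtained from $P_m$ by iterated simplicial wedges in which the vertex $i$ is replaced by $j_i$ vertices; explicitly, its minimal non-faces are the sets $\{(i,k): i\in\tau,\ 1\le k\le j_i\}$ with $\tau$ a minimal non-face of $P_m$. A toric manifold over a simplicial complex $K$ is the complex toric variety $X_\Sigma$ of a complete non-singular fan $\Sigma$ in some $\mathbb R^n$ (with lattice $\mathbb Z^n$) whose underlying simplicial complex (vertices: the rays of $\Sigma$; faces: the sets of rays of cones of $\Sigma$) is isomorphic to $K$. It is projective if it embeds over $\mathbb C$ as a closed subscheme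 of some $\mathbb P^N_{\mathbb C}$. A simplicial fan $\Sigma$ is strongly polytopal if there is a simplicial polytope $P$ with $0\in\operatorname{relint}P$ such that the cones of $\Sigma$ are exactly the cones spanned by the proper faces of $P$ (the empty face spanning $\{0\}$). A simplicial complex $K$ is strongly combinatorially Delzant if it is polytopal (the boundary complex of a simplicial polytope), there is a projective toric manifold over $K$, and every toric manifold over $K$ is projective. **Theorem.** Let $m\ge 3$ and $J\in\mathbb Z_{+}^m$. Then every toric manifold $X_\Sigma$ over $P_m(J)$ is projective, and its fan $\Sigma$ is strongly polytopal. Moreover, $P_m(J)$ is strongly combinatorially Delzant. -/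

import Mathlib

open CategoryTheory CategoryTheory.Limits AlgebraicGeometry

noncomputable section

namespace ToricWedge

/-! ### Simplicial complexes: polygons and simplicial wedges -/

section Complexes

variable {V W : Type*}

/-- The boundary complex `P_m` of an `m`-gon, for `m ≥ 3`: the vertices are `0, …, m - 1` and the
edges are the pairs of cyclically consecutive vertices. -/
def polygon (m : ℕ) : AbstractSimplicialComplex (Fin m) where
  faces := {s | s.Nonempty ∧ ∃ i, s ⊆ {i, finRotate m i}}
  isRelLowerSet_faces := fun _ ⟨hs, i, hi⟩ => ⟨hs, fun _ ht hne => ⟨hne, i, ht.trans hi⟩⟩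
  singleton_mem v := ⟨Finset.singleton_nonempty v, v, by simp⟩

/-- The faces of the simplicial wedge of `K` at the vertex `v`. Its vertices are those of `K`
together with one new vertex `none`, the twin of `some v`. It is the union of the join of the edge
`{some v, none}` with the link of `v`, and the join of the two points `some v`, `none` with the
deletion of `v`; here `s.eraseNone.erase v` is the set of the elements of `s` other than the twins.
-/
def wedgeFaces (K : AbstractSimplicialComplex V) (v : V) [DecidableEq V] :
    Set (Finset (Option V)) :=
  {s | s.Nonempty ∧
    (insert v (s.eraseNone.erase v) ∈ K.faces ∨
      ((s.eraseNone.erase v = ∅ ∨ s.eraseNone.erase v ∈ K.faces) ∧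
        ¬ (some v ∈ s ∧ none ∈ s)))}

/-- Given a surjection `π : W → V` onto the vertices of `K`, the complex on `W` in which a set is
a nonface if and only if it contains the full preimage of a nonface of `K`. -/
def inflate (K : AbstractSimplicialComplex V) (π : W → V) (hπ : Function.Surjective π) :
    AbstractSimplicialComplex W where
  faces := {s | s.Nonempty ∧
    ∀ t : Finset V, t.Nonempty → (∀ w, π w ∈ t → w ∈ s) → t ∈ K.faces}
  isRelLowerSet_faces := fun _ ⟨hs, h⟩ =>
    ⟨hs, fun _ hu hne => ⟨hne, fun t ht htu => h t ht fun w hw => hu (htu w hw)⟩⟩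
  singleton_mem w := by
    refine ⟨Finset.singleton_nonempty w, fun t ht h => ?_⟩
    have : t = {π w} := by
      refine Finset.eq_singleton_iff_nonempty_unique_mem.2 ⟨ht, fun x hx => ?_⟩
      obtain ⟨y, rfl⟩ := hπ x
      rw [Finset.mem_singleton.1 (h y hx)]
    exact this ▸ K.singleton_mem _

/-- The complex `K(J)`: every vertex `i` of `K` is replaced by `J i` copies, and the minimal
nonfaces of `K(J)` are the full preimages of the minimal nonfaces of `K`. By `inflate_id` and
`inflate_wedge` below, this is the complex obtained from `K` by iterated simplicial wedges,
`J i - 1` of them at (copies of) the vertex `i`. -/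
def multiWedge (K : AbstractSimplicialComplex V) (J : V → ℕ+) :
    AbstractSimplicialComplex (Σ i, Fin (J i)) :=
  inflate K Sigma.fst fun i => ⟨⟨i, ⟨0, (J i).pos⟩⟩, rfl⟩

theorem inflate_id (K : AbstractSimplicialComplex V) :
    inflate K id Function.surjective_id = K := by
  ext s
  constructor
  · rintro ⟨hs, h⟩
    exact h s hs fun _ h => h
  · intro hs
    exact ⟨(K.isRelLowerSet_faces hs).1, fun t ht h => (K.isRelLowerSet_faces hs).2 h ht⟩

/-- Doubling one element `w` of a fibre of `π` is the simplicial wedge at `w`. -/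
theorem inflate_wedge [DecidableEq W] (K : AbstractSimplicialComplex V)
    (π : W → V) (hπ : Function.Surjective π) (w : W)
    (hπ' : Function.Surjective fun o : Option W => π (o.getD w)) :
    (inflate K (fun o : Option W => π (o.getD w)) hπ').faces
      = wedgeFaces (inflate K π hπ) w := by
  ext s
  have key : ∀ u : Finset W, u.Nonempty → (u ∈ (inflate K π hπ).faces ↔
      ∀ t : Finset V, t.Nonempty → (∀ x, π x ∈ t → x ∈ u) → t ∈ K.faces) :=
    fun u hu => ⟨fun h => h.2, fun h => ⟨hu, h⟩⟩
  have hins : (insert w (s.eraseNone.erase w)).Nonempty := Finset.insert_nonempty _ _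
  refine and_congr_right fun hs => ?_
  rw [key _ hins]
  by_cases hab : some w ∈ s ∧ none ∈ s
  · simp only [hab, and_self, not_true, and_false, or_false]
    refine forall₂_congr fun t ht => imp_congr_left ⟨fun h x hx => ?_, fun h o ho => ?_⟩
    · have hx' := h (some x) hx
      simp only [Finset.mem_insert, Finset.mem_erase, Finset.mem_eraseNone]
      tauto
    · cases o with
      | none => exact hab.2
      | some x =>
        have := h x ho
        simp only [Finset.mem_insert, Finset.mem_erase, Finset.mem_eraseNone] at this
        rcases this with rfl | h
        · exact hab.1
        · exact h.2
  · have hA : (∀ t : Finset V, t.Nonempty →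
        (∀ o : Option W, π (o.getD w) ∈ t → o ∈ s) → t ∈ K.faces) ↔
        (∀ t : Finset V, t.Nonempty →
          (∀ x, π x ∈ t → x ∈ s.eraseNone.erase w) → t ∈ K.faces) := by
      refine forall₂_congr fun t ht => imp_congr_left ⟨fun h x hx => ?_, fun h o ho => ?_⟩
      · have hx' := h (some x) hx
        simp only [Finset.mem_erase, Finset.mem_eraseNone]
        refine ⟨?_, hx'⟩
        rintro rfl
        exact hab ⟨hx', h none hx⟩
      · cases o with
        | none => exact absurd (h w ho) (by simp)
        | some x => exact Finset.mem_eraseNone.1 (Finset.mem_of_mem_erase (h x ho))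
    simp only [hab, not_false_eq_true, and_true]
    rw [hA]
    constructor
    · intro h
      rcases Finset.eq_empty_or_nonempty (s.eraseNone.erase w) with he | hne
      · exact Or.inr (Or.inl he)
      · exact Or.inr (Or.inr ((key _ hne).2 h))
    · rintro (h | h | h)
      · exact fun t ht htr => h t ht fun x hx => Finset.mem_insert_of_mem (htr x hx)
      · intro t ht htr
        obtain ⟨y, hy⟩ := ht
        obtain ⟨x, rfl⟩ := hπ y
        exact absurd (htr x hy) (by simp [h])
      · exact h.2

end Complexes

/-! ### Fans -/

/-- The pairing of a character `u ∈ ℤⁿ` with a vector of `ℝⁿ`. -/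
def pairing {n : ℕ} (u : Fin n → ℤ) (x : Fin n → ℝ) : ℝ := ∑ i, (u i : ℝ) * x i

/-- A lattice vector as a real vector. -/
def toReal {n : ℕ} (v : Fin n → ℤ) : Fin n → ℝ := fun i => (v i : ℝ)

/-- `τ` is a face of the rational polyhedral cone `σ`: it is cut out of `σ` by a supporting
hyperplane. (A face of a rational polyhedral cone is cut out by a rational hyperplane, so the normal
vector may be taken in the lattice.) -/
def IsConeFace {n : ℕ} (τ σ : PointedCone ℝ (Fin n → ℝ)) : Prop :=
  ∃ u : Fin n → ℤ, (∀ x ∈ σ, 0 ≤ pairing u x) ∧ ∀ x, x ∈ τ ↔ x ∈ σ ∧ pairing u x = 0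

/-- A fan in `ℝⁿ`, with respect to the lattice `ℤⁿ`: a finite set of strongly convex rational
polyhedral cones that contains every face of each of its cones, and in which any two cones
intersect in a face of each (the second face condition follows by exchanging `σ` and `τ`). -/
structure Fan (n : ℕ) where
  cones : Set (PointedCone ℝ (Fin n → ℝ))
  finite : cones.Finite
  rational : ∀ σ ∈ cones, ∃ S : Finset (Fin n → ℤ), σ = PointedCone.hull ℝ (toReal '' (S : Set _))
  stronglyConvex : ∀ σ ∈ cones, ∀ x ∈ σ, -x ∈ σ → x = 0
  face_mem : ∀ σ ∈ cones, ∀ τ, IsConeFace τ σ → τ ∈ cones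
  inf_isFace : ∀ σ ∈ cones, ∀ τ ∈ cones, IsConeFace (σ ⊓ τ) σ

namespace Fan

variable {n : ℕ} (Δ : Fan n)

/-- The cones cover `ℝⁿ`. -/
def IsComplete : Prop := ∀ x, ∃ σ ∈ Δ.cones, x ∈ σ

/-- Every cone is generated by a part of a `ℤ`-basis of the lattice. -/
def IsNonsingular : Prop :=
  ∀ σ ∈ Δ.cones, ∃ (b : Module.Basis (Fin n) ℤ (Fin n → ℤ)) (s : Set (Fin n)),
    σ = PointedCone.hull ℝ ((fun i => toReal (b i)) '' s)

/-- The rays of the fan. -/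
def rays : Set (PointedCone ℝ (Fin n → ℝ)) :=
  {ρ | ρ ∈ Δ.cones ∧ ∃ v ≠ 0, ρ = PointedCone.hull ℝ {v}}

/-- The underlying simplicial complex of the (simplicial) fan is `K`: for some identification of
the vertices of `K` with the rays, the nonempty faces of `K` are the nonempty sets of rays of the
form "all the rays of `σ`", with `σ` a cone of the fan. -/
def IsOver {V : Type*} (K : AbstractSimplicialComplex V) : Prop :=
  ∃ e : V ≃ Δ.rays, ∀ s : Finset V, s.Nonempty →
    (s ∈ K.faces ↔ ∃ σ ∈ Δ.cones, ∀ v, v ∈ s ↔ (e v : PointedCone ℝ (Fin n → ℝ)) ≤ σ)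

end Fan

/-! ### Polytopes and polytopality -/

section Polytopes

variable {E : Type*} [AddCommGroup E] [Module ℝ E] [TopologicalSpace E]

/-- A proper face of a polytope `P`; the empty face is allowed. -/
def IsProperFace (P F : Set E) : Prop := IsExposed ℝ P F ∧ F ≠ P

/-- A simplicial polytope: the convex hull of finitely many points, all of whose proper faces are
simplices. -/
def IsSimplicialPolytope (P : Set E) : Prop :=
  (∃ S : Finset E, P = convexHull ℝ (S : Set E)) ∧
    ∀ F, IsProperFace P F →
      ∃ T : Finset E, AffineIndependent ℝ ((↑) : T → E) ∧ F = convexHull ℝ (T : Set E)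

end Polytopes

/-- There is a simplicial polytope `P` with `0` in its relative interior such that the cones of the
fan are exactly the cones spanned by the proper faces of `P` (the empty face spans `{0}`). -/
def Fan.IsStronglyPolytopal {n : ℕ} (Δ : Fan n) : Prop :=
  ∃ P : Set (Fin n → ℝ), IsSimplicialPolytope P ∧ 0 ∈ intrinsicInterior ℝ P ∧
    Δ.cones = {σ | ∃ F, IsProperFace P F ∧ σ = PointedCone.hull ℝ F}

/-- `K` is the boundary complex of a simplicial polytope. -/
def IsPolytopal {V : Type*} (K : AbstractSimplicialComplex V) : Prop :=
  ∃ (d : ℕ) (P : Set (Fin d → ℝ)), IsSimplicialPolytope P ∧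
    ∃ e : V ≃ P.extremePoints ℝ, ∀ s : Finset V, s.Nonempty →
      (s ∈ K.faces ↔ ∃ F, IsProperFace P F ∧ ∀ v, v ∈ s ↔ (e v : Fin d → ℝ) ∈ F)

/-! ### The toric variety of a fan -/

section Charts

variable {n : ℕ}

/-- The monoid `σ^∨ ∩ ℤⁿ`. -/
def dualMonoid (σ : PointedCone ℝ (Fin n → ℝ)) : AddSubmonoid (Fin n → ℤ) where
  carrier := {u | ∀ x ∈ σ, 0 ≤ pairing u x}
  zero_mem' := fun x _ => by simp [pairing]
  add_mem' := fun {a b} ha hb x hx => by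
    have := add_nonneg (ha x hx) (hb x hx)
    simpa [pairing, add_mul, Finset.sum_add_distrib] using this

theorem dualMonoid_anti {τ σ : PointedCone ℝ (Fin n → ℝ)} (h : τ ≤ σ) :
    dualMonoid σ ≤ dualMonoid τ := fun _ hu x hx => hu x (h hx)

/-- The coordinate ring `ℂ[σ^∨ ∩ ℤⁿ]` of the affine toric variety `U_σ`. -/
abbrev coordRing (σ : PointedCone ℝ (Fin n → ℝ)) : Type := AddMonoidAlgebra ℂ (dualMonoid σ)

/-- The inclusion `ℂ[σ^∨ ∩ ℤⁿ] → ℂ[τ^∨ ∩ ℤⁿ]` for `τ ≤ σ`. -/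
def coordRingMap {τ σ : PointedCone ℝ (Fin n → ℝ)} (h : τ ≤ σ) : coordRing σ →+* coordRing τ :=
  AddMonoidAlgebra.mapDomainRingHom ℂ (AddSubmonoid.inclusion (dualMonoid_anti h))

theorem coordRingMap_single {τ σ : PointedCone ℝ (Fin n → ℝ)} (h : τ ≤ σ) (u : dualMonoid σ)
    (c : ℂ) : coordRingMap h (AddMonoidAlgebra.single u c) =
      AddMonoidAlgebra.single (AddSubmonoid.inclusion (dualMonoid_anti h) u) c := by
  simp [coordRingMap]

theorem coordRingMap_injective {τ σ : PointedCone ℝ (Fin n → ℝ)} (h : τ ≤ σ) :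
    Function.Injective (coordRingMap h) :=
  AddMonoidAlgebra.mapDomain_injective (AddSubmonoid.inclusion_injective _)

/-- If `τ` is the face of `σ` cut out by `u`, then `ℂ[τ^∨ ∩ ℤⁿ]` is the localization of
`ℂ[σ^∨ ∩ ℤⁿ]` at the character of `u`. -/
theorem isLocalization_coordRingMap {τ σ : PointedCone ℝ (Fin n → ℝ)} (h : τ ≤ σ)
    (hσ : ∃ S : Finset (Fin n → ℤ), σ = PointedCone.hull ℝ (toReal '' (S : Set _)))
    (u : dualMonoid σ) (hu : ∀ x, x ∈ τ ↔ x ∈ σ ∧ pairing (u : Fin n → ℤ) x = 0) :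
    letI := (coordRingMap h).toAlgebra
    IsLocalization.Away (AddMonoidAlgebra.single u 1 : coordRing σ) (coordRing τ) := by
  let := (coordRingMap h).toAlgebra
  have halg : ∀ a, algebraMap (coordRing σ) (coordRing τ) a = coordRingMap h a := fun _ => rfl
  have hpow : ∀ N : ℕ, (AddMonoidAlgebra.single u 1 : coordRing σ) ^ N =
      AddMonoidAlgebra.single (N • u) 1 := fun N => by simp [AddMonoidAlgebra.single_pow]
  obtain ⟨S, hS⟩ := hσ
  have hgen : ∀ w : Fin n → ℤ, (∀ v ∈ S, 0 ≤ pairing w (toReal v)) → w ∈ dualMonoid σ := by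
    intro w hw x hx
    rw [hS] at hx
    induction hx using Submodule.span_induction with
    | mem x hx => obtain ⟨v, hv, rfl⟩ := hx; exact hw v hv
    | zero => simp [pairing]
    | add x y _ _ hx hy =>
      have : pairing w (x + y) = pairing w x + pairing w y := by
        simp [pairing, mul_add, Finset.sum_add_distrib]
      rw [this]; exact add_nonneg hx hy
    | smul a x _ hx =>
      have : pairing w (a • x) = (a : ℝ) * pairing w x := by
        simp only [pairing, Finset.mul_sum]
        refine Finset.sum_congr rfl fun i _ => ?_
        change (w i : ℝ) * ((a : ℝ) * x i) = _
        ring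
      rw [this]; exact mul_nonneg a.2 hx
  have hint : ∀ w v : Fin n → ℤ, pairing w (toReal v) = ((∑ i, w i * v i : ℤ) : ℝ) := by
    intro w v; simp [pairing, toReal]
  have hpadd : ∀ (w w' : Fin n → ℤ) (N : ℕ) (x : Fin n → ℝ),
      pairing (w + N • w') x = pairing w x + N * pairing w' x := by
    intro w w' N x
    simp [pairing, add_mul, Finset.sum_add_distrib, Finset.mul_sum, mul_assoc]
  have hshift : ∀ w : dualMonoid τ, ∃ N : ℕ, ∀ M : ℕ, N ≤ M →
      (w : Fin n → ℤ) + M • (u : Fin n → ℤ) ∈ dualMonoid σ := by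
    intro w
    refine ⟨∑ v ∈ S, (∑ i, (w : Fin n → ℤ) i * v i).natAbs, fun M hM => hgen _ fun v hv => ?_⟩
    have hvσ : toReal v ∈ σ := by
      rw [hS]; exact PointedCone.subset_hull ⟨v, hv, rfl⟩
    have hu0 : 0 ≤ pairing (u : Fin n → ℤ) (toReal v) := u.2 _ hvσ
    rw [hpadd]
    rcases hu0.eq_or_lt with h0 | h0
    · rw [← h0, mul_zero, add_zero]
      exact w.2 _ ((hu _).2 ⟨hvσ, h0.symm⟩)
    · rw [hint] at h0
      rw [hint, hint]
      have h1 : 1 ≤ ∑ i, (u : Fin n → ℤ) i * v i := by exact_mod_cast h0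
      have h2 : (∑ i, (w : Fin n → ℤ) i * v i).natAbs ≤ M :=
        (Finset.single_le_sum (f := fun v : Fin n → ℤ => (∑ i, (w : Fin n → ℤ) i * v i).natAbs)
          (fun _ _ => Nat.zero_le _) hv).trans hM
      have h3 : 0 ≤ (∑ i, (w : Fin n → ℤ) i * v i) + (M : ℤ) * ∑ i, (u : Fin n → ℤ) i * v i := by
        have : (M : ℤ) * 1 ≤ (M : ℤ) * ∑ i, (u : Fin n → ℤ) i * v i :=
          mul_le_mul_of_nonneg_left h1 (Int.natCast_nonneg M)
        omega
      exact_mod_cast h3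
  have hneg : -(u : Fin n → ℤ) ∈ dualMonoid τ := fun x hx => by
    have : pairing (-(u : Fin n → ℤ)) x = - pairing (u : Fin n → ℤ) x := by simp [pairing]
    rw [this, ((hu x).1 hx).2, neg_zero]
  have hunit : IsUnit (coordRingMap h (AddMonoidAlgebra.single u 1)) := by
    refine IsUnit.of_mul_eq_one (AddMonoidAlgebra.single ⟨_, hneg⟩ 1) ?_
    rw [coordRingMap_single, AddMonoidAlgebra.single_mul_single, AddMonoidAlgebra.one_def]
    congr 1
    · ext i; simp
    · simp
  have hsurj : ∀ f : coordRing τ, ∃ N : ℕ, ∀ M : ℕ, N ≤ M → ∃ g : coordRing σ,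
      f * coordRingMap h ((AddMonoidAlgebra.single u 1) ^ M) = coordRingMap h g := by
    intro f
    induction f using AddMonoidAlgebra.induction_linear with
    | zero => exact ⟨0, fun M _ => ⟨0, by simp⟩⟩
    | add f f' hf hf' =>
      obtain ⟨N, hN⟩ := hf
      obtain ⟨N', hN'⟩ := hf'
      refine ⟨max N N', fun M hM => ?_⟩
      obtain ⟨g, hg⟩ := hN M ((le_max_left _ _).trans hM)
      obtain ⟨g', hg'⟩ := hN' M ((le_max_right _ _).trans hM)
      exact ⟨g + g', by rw [add_mul, hg, hg', map_add]⟩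
    | single w c =>
      obtain ⟨N, hN⟩ := hshift w
      refine ⟨N, fun M hM => ⟨AddMonoidAlgebra.single ⟨_, hN M hM⟩ c, ?_⟩⟩
      rw [hpow, coordRingMap_single, coordRingMap_single, AddMonoidAlgebra.single_mul_single]
      congr 1
      simp
  refine (isLocalization_iff _ _).2 ⟨?_, ?_, ?_⟩
  · rintro ⟨_, N, rfl⟩
    simp only [halg, map_pow]
    exact hunit.pow N
  · intro f
    obtain ⟨N, hN⟩ := hsurj f
    obtain ⟨g, hg⟩ := hN N le_rfl
    exact ⟨(g, ⟨_, N, rfl⟩), hg⟩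
  · intro a b hab
    exact ⟨1, by rw [coordRingMap_injective h hab]⟩

theorem coordRingMap_refl (σ : PointedCone ℝ (Fin n → ℝ)) :
    coordRingMap (le_refl σ) = RingHom.id _ :=
  AddMonoidAlgebra.mapDomainRingHom_id

theorem coordRingMap_comp {ρ τ σ : PointedCone ℝ (Fin n → ℝ)} (h : ρ ≤ τ) (h' : τ ≤ σ) :
    (coordRingMap h).comp (coordRingMap h') = coordRingMap (h.trans h') :=
  (AddMonoidAlgebra.mapDomainRingHom_comp _ _).symm

end Charts

namespace Fan

variable {n : ℕ} (Δ : Fan n)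

/-- The diagram of the affine toric varieties `U_σ = Spec ℂ[σ^∨ ∩ ℤⁿ]`, indexed by the cones of the
fan ordered by inclusion. -/
def chart : Δ.cones ⥤ Scheme.{0} where
  obj σ := Spec (CommRingCat.of (coordRing σ.1))
  map f := Spec.map (CommRingCat.ofHom (coordRingMap (leOfHom f)))
  map_id σ := by
    rw [← Spec.map_id, coordRingMap_refl]
    rfl
  map_comp f g := by
    rw [← Spec.map_comp, ← CommRingCat.ofHom_comp, coordRingMap_comp]

instance {σ τ : Δ.cones} (f : τ ⟶ σ) : IsOpenImmersion (Δ.chart.map f) := by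
  obtain ⟨u, hu, hτ⟩ := Δ.inf_isFace σ σ.2 τ τ.2
  rw [inf_eq_right.2 (leOfHom f)] at hτ
  let := (coordRingMap (leOfHom f)).toAlgebra
  have := isLocalization_coordRingMap (leOfHom f) (Δ.rational σ σ.2) ⟨u, hu⟩ hτ
  exact IsOpenImmersion.of_isLocalization
    (AddMonoidAlgebra.single (⟨u, hu⟩ : dualMonoid σ.1) 1 : coordRing σ.1)

/-- The points of `U_σ` that lie in `U_τ`, where `τ` is the face of `σ` cut out by `u`. -/
theorem range_chart_map {σ τ : Δ.cones} (f : τ ⟶ σ) (u : dualMonoid σ.1)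
    (hu : ∀ x, x ∈ τ.1 ↔ x ∈ σ.1 ∧ pairing (u : Fin n → ℤ) x = 0) :
    Set.range (Δ.chart.map f) =
      {p | (AddMonoidAlgebra.single u 1 : coordRing σ.1) ∉
        PrimeSpectrum.asIdeal (R := coordRing σ.1) p} := by
  let := (coordRingMap (leOfHom f)).toAlgebra
  have := isLocalization_coordRingMap (leOfHom f) (Δ.rational σ σ.2) u hu
  exact PrimeSpectrum.localization_away_comap_range (coordRing τ.1)
    (AddMonoidAlgebra.single u 1 : coordRing σ.1)

instance : (Δ.chart ⋙ Scheme.forget).IsLocallyDirected := by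
  constructor
  intro i j k fi fj xi xj hx
  replace hx : Δ.chart.map fi xi = Δ.chart.map fj xj := hx
  obtain ⟨u, hu, hj⟩ := Δ.inf_isFace k k.2 j j.2
  rw [inf_eq_right.2 (leOfHom fj)] at hj
  have hui : u ∈ dualMonoid i.1 := fun x hx => hu x (leOfHom fi hx)
  have hface : ∀ x, x ∈ i.1 ⊓ j.1 ↔ x ∈ i.1 ∧ pairing u x = 0 := fun x => by
    rw [Submodule.mem_inf, hj]
    exact ⟨fun h => ⟨h.1, h.2.2⟩, fun h => ⟨h.1, leOfHom fi h.1, h.2⟩⟩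
  let l : Δ.cones := ⟨i.1 ⊓ j.1, Δ.face_mem i i.2 _ ⟨u, hui, hface⟩⟩
  let fli : l ⟶ i := homOfLE (show i.1 ⊓ j.1 ≤ i.1 from inf_le_left)
  let flj : l ⟶ j := homOfLE (show i.1 ⊓ j.1 ≤ j.1 from inf_le_right)
  have h1 : Δ.chart.map fi xi ∈ Set.range (Δ.chart.map fj) := ⟨xj, hx.symm⟩
  rw [Δ.range_chart_map fj ⟨u, hu⟩ hj] at h1
  have h2 : xi ∈ Set.range (Δ.chart.map fli) := by
    rw [Δ.range_chart_map fli ⟨u, hui⟩ hface]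
    intro h
    apply h1
    change coordRingMap (leOfHom fi) _ ∈ PrimeSpectrum.asIdeal (R := coordRing i.1) xi
    rw [coordRingMap_single]
    exact h
  obtain ⟨z, hz⟩ := h2
  refine ⟨l, fli, flj, z, hz, ?_⟩
  change Δ.chart.map flj z = xj
  apply (Δ.chart.map fj).isOpenEmbedding.injective
  rw [← hx, ← hz, ← Scheme.Hom.comp_apply, ← Scheme.Hom.comp_apply, ← Functor.map_comp,
    ← Functor.map_comp]
  rfl

/-- The toric variety `X_Δ`, glued from the affine charts: `U_σ` and `U_τ` are
glued along `U_{σ ∩ τ}`. -/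
def toricVariety : Scheme.{0} := colimit Δ.chart

/-- The structure morphism of the toric variety. -/
def structureMap : Δ.toricVariety ⟶ Spec (CommRingCat.of ℂ) :=
  colimit.desc Δ.chart
    { pt := Spec (CommRingCat.of ℂ)
      ι :=
        { app := fun σ => Spec.map (CommRingCat.ofHom (algebraMap ℂ (coordRing σ.1)))
          naturality := fun τ σ f => by
            change Spec.map _ ≫ Spec.map _ = Spec.map _ ≫ 𝟙 _
            rw [Category.comp_id, ← Spec.map_comp, ← CommRingCat.ofHom_comp]
            congr 2
            ext c
            simp [coordRingMap] } }

end Fan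

/-! ### Projectivity -/

attribute [local instance] MvPolynomial.gradedAlgebra

/-- Complex projective space of dimension `N`. -/
def projectiveSpace (N : ℕ) : Scheme.{0} :=
  Proj (MvPolynomial.homogeneousSubmodule (Fin (N + 1)) ℂ)

/-- The structure morphism of projective space. -/
def projectiveSpaceMap (N : ℕ) : projectiveSpace N ⟶ Spec (CommRingCat.of ℂ) :=
  Proj.toSpecZero (MvPolynomial.homogeneousSubmodule (Fin (N + 1)) ℂ) ≫
    Spec.map (CommRingCat.ofHom
      (algebraMap ℂ (MvPolynomial.homogeneousSubmodule (Fin (N + 1)) ℂ 0)))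

/-- A complex scheme is projective if it is isomorphic, over `ℂ`, to a closed subscheme of some
projective space. -/
def IsProjective {X : Scheme.{0}} (f : X ⟶ Spec (CommRingCat.of ℂ)) : Prop :=
  ∃ (N : ℕ) (i : X ⟶ projectiveSpace N), IsClosedImmersion i ∧ i ≫ projectiveSpaceMap N = f

/-- `X_Δ` is a toric manifold over `K`: the fan is complete (`X_Δ` is a complete variety),
non-singular (`X_Δ` is smooth), and has underlying simplicial complex `K`. -/
def Fan.IsToricManifoldOver {n : ℕ} (Δ : Fan n) {V : Type*} (K : AbstractSimplicialComplex V) :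
    Prop :=
  Δ.IsComplete ∧ Δ.IsNonsingular ∧ Δ.IsOver K

/-- `K` is weakly combinatorially Delzant: it is polytopal and there is a projective toric manifold
over `K`. -/
def IsWeaklyCombinatoriallyDelzant {V : Type*} (K : AbstractSimplicialComplex V) : Prop :=
  IsPolytopal K ∧
    ∃ (n : ℕ) (Δ : Fan n), Δ.IsToricManifoldOver K ∧ IsProjective Δ.structureMap

/-- `K` is strongly combinatorially Delzant: it is weakly combinatorially Delzant and every toric
manifold over `K` is projective. -/
def IsStronglyCombinatoriallyDelzant {V : Type*} (K : AbstractSimplicialComplex V) : Prop :=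
  IsWeaklyCombinatoriallyDelzant K ∧
    ∀ (n : ℕ) (Δ : Fan n), Δ.IsToricManifoldOver K → IsProjective Δ.structureMap

end ToricWedge

end

/-!
By the combinatorics of `P_m(J)`, its facets are the pairs `(a, k)` of an edge `{a, a + 1}` of the
`m`-gon and a transversal `k`, that is, a choice of one copy of every vertex. In a smooth complete
fan over `P_m(J)`, projecting along the rays off a transversal yields a smooth complete fan in the
plane, whose rays are the vertices of the polygon. Two transversals that differ at the vertex `i`
give planar fans with the same projection along the `i`-th ray, so they differ by a shear of a half
plane. If they differ at all, the line of the `i`-th ray carries an opposite ray, and shears along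
two different lines do not commute; hence all nontrivial shears happen along a single line `L`. The
norm of the ray generators, in the coordinates of one of the planar fans, plus a large multiple of
the distance to `L`, is then a strictly convex function on all the planar fans at once. It gives an
ample divisor on the toric manifold, that is, a projective embedding of the variety and a polytope
that spans the fan. A toric manifold over `P_m(J)` is obtained by a canonical extension of a planar
fan with `m` rays.
-/

noncomputable section

namespace ToricWedge

/-! ### Unimodular and ample systems -/

section Pairing

variable {n : ℕ}

theorem pairing_add_right (u : Fin n → ℤ) (x y : Fin n → ℝ) :
    pairing u (x + y) = pairing u x + pairing u y := dotProduct_add (toReal u) x y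

theorem pairing_smul_right (u : Fin n → ℤ) (a : ℝ) (x : Fin n → ℝ) :
    pairing u (a • x) = a * pairing u x := dotProduct_smul a (toReal u) x

/-- The pairing with a character, as a continuous linear functional. -/
def pairingCLM (u : Fin n → ℤ) : (Fin n → ℝ) →L[ℝ] ℝ where
  toFun := pairing u
  map_add' := pairing_add_right u
  map_smul' := pairing_smul_right u
  cont := by unfold pairing; fun_prop

theorem pairingCLM_apply (u : Fin n → ℤ) (x : Fin n → ℝ) : pairingCLM u x = pairing u x := rfl

theorem pairing_zero_right (u : Fin n → ℤ) : pairing u 0 = 0 := map_zero (pairingCLM u)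

theorem pairing_neg_right (u : Fin n → ℤ) (x : Fin n → ℝ) : pairing u (-x) = -pairing u x :=
  map_neg (pairingCLM u) x

theorem pairing_sum_right {ι : Type*} (u : Fin n → ℤ) (s : Finset ι) (x : ι → Fin n → ℝ) :
    pairing u (∑ i ∈ s, x i) = ∑ i ∈ s, pairing u (x i) := map_sum (pairingCLM u) x s

theorem pairing_add_left (u w : Fin n → ℤ) (x : Fin n → ℝ) :
    pairing (u + w) x = pairing u x + pairing w x := by
  simp [pairing, add_mul, Finset.sum_add_distrib]

theorem pairing_sub_left (u w : Fin n → ℤ) (x : Fin n → ℝ) :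
    pairing (u - w) x = pairing u x - pairing w x := by
  simp [pairing, sub_mul, Finset.sum_sub_distrib]

theorem pairing_neg_left (u : Fin n → ℤ) (x : Fin n → ℝ) : pairing (-u) x = -pairing u x := by
  simp [pairing]

theorem pairing_smul_left (a : ℤ) (u : Fin n → ℤ) (x : Fin n → ℝ) :
    pairing (a • u) x = a * pairing u x := by
  simp [pairing, Finset.mul_sum, mul_assoc]

theorem pairing_sum_left {ι : Type*} (s : Finset ι) (u : ι → Fin n → ℤ) (x : Fin n → ℝ) :
    pairing (∑ i ∈ s, u i) x = ∑ i ∈ s, pairing (u i) x := by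
  simp only [pairing, Finset.sum_apply, Int.cast_sum, Finset.sum_mul]
  exact Finset.sum_comm

theorem pairing_toReal (u v : Fin n → ℤ) : pairing u (toReal v) = ((∑ i, u i * v i : ℤ) : ℝ) := by
  simp [pairing, toReal]

theorem pairing_injective : Function.Injective (pairing (n := n)) := fun u w h => by
  funext i
  simpa [pairing, Pi.single_apply] using congrFun h (Pi.single i 1)

end Pairing

theorem hull_induction {E : Type*} [AddCommGroup E] [Module ℝ E] {s : Set E} {p : E → Prop} {x : E}
    (hx : x ∈ PointedCone.hull ℝ s) (mem : ∀ x ∈ s, p x) (zero : p 0)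
    (add : ∀ x y, p x → p y → p (x + y)) (smul : ∀ (a : ℝ) x, 0 ≤ a → p x → p (a • x)) : p x := by
  induction hx using Submodule.span_induction with
  | mem x hx => exact mem x hx
  | zero => exact zero
  | add x y _ _ hx hy => exact add x y hx hy
  | smul a x _ hx => exact smul a x a.2 hx

/-- Finitely many lattice vectors `vec x`, together with finitely many sets `facet f` of them that
are bases of the lattice; `dual f` is the dual basis of `facet f`. Only the values of `dual f` on
`facet f` are meaningful. -/
structure UnimodularSystem (n : ℕ) (V ι : Type*) [DecidableEq V] where
  vec : V → Fin n → ℤ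
  facet : ι → Finset V
  dual : ι → V → Fin n → ℤ
  pairing_dual : ∀ f, ∀ x ∈ facet f, ∀ y ∈ facet f,
    pairing (dual f x) (toReal (vec y)) = if x = y then 1 else 0
  sum_dual : ∀ f z, ∑ x ∈ facet f, pairing (dual f x) z • toReal (vec x) = z

namespace UnimodularSystem

variable {n : ℕ} {V ι : Type*} [DecidableEq V] (S : UnimodularSystem n V ι)

/-- The vectors of the system, as real vectors. -/
def rvec (x : V) : Fin n → ℝ := toReal (S.vec x)

/-- The cone spanned by a set of vectors of the system. -/
def cone (s : Finset V) : PointedCone ℝ (Fin n → ℝ) := PointedCone.hull ℝ (S.rvec '' s)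

theorem pairing_dual_rvec {f : ι} {x y : V} (hx : x ∈ S.facet f) (hy : y ∈ S.facet f) :
    pairing (S.dual f x) (S.rvec y) = if x = y then 1 else 0 := S.pairing_dual f x hx y hy

theorem sum_dual_rvec (f : ι) (z : Fin n → ℝ) :
    ∑ x ∈ S.facet f, pairing (S.dual f x) z • S.rvec x = z := S.sum_dual f z

theorem pairing_eq_sum (f : ι) (u : Fin n → ℤ) (z : Fin n → ℝ) :
    pairing u z = ∑ x ∈ S.facet f, pairing (S.dual f x) z * pairing u (S.rvec x) := by
  conv_lhs => rw [← S.sum_dual_rvec f z]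
  simp only [pairing_sum_right, pairing_smul_right]

theorem rvec_mem_cone {s : Finset V} {x : V} (hx : x ∈ s) : S.rvec x ∈ S.cone s :=
  PointedCone.subset_hull ⟨x, hx, rfl⟩

theorem cone_mono {s t : Finset V} (h : s ⊆ t) : S.cone s ≤ S.cone t :=
  Submodule.span_mono (Set.image_mono (by exact_mod_cast h))

theorem sum_mem_cone {s : Finset V} {a : V → ℝ} (ha : ∀ x ∈ s, 0 ≤ a x) :
    ∑ x ∈ s, a x • S.rvec x ∈ S.cone s :=
  Submodule.sum_mem _ fun x hx => PointedCone.smul_mem _ (ha x hx) (S.rvec_mem_cone hx)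

theorem pairing_nonneg_of_mem_cone {s : Finset V} {u : Fin n → ℤ}
    (hu : ∀ x ∈ s, 0 ≤ pairing u (S.rvec x)) {z : Fin n → ℝ} (hz : z ∈ S.cone s) :
    0 ≤ pairing u z := by
  refine hull_induction (p := fun z => 0 ≤ pairing u z) hz ?_ (pairing_zero_right u).ge ?_ ?_
  · rintro _ ⟨x, hx, rfl⟩
    exact hu x hx
  · intro x y hx hy
    rw [pairing_add_right]
    exact add_nonneg hx hy
  · intro a x ha hx
    rw [pairing_smul_right]
    exact mul_nonneg ha hx

theorem pairing_eq_zero_of_mem_cone {s : Finset V} {u : Fin n → ℤ}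
    (hu : ∀ x ∈ s, pairing u (S.rvec x) = 0) {z : Fin n → ℝ} (hz : z ∈ S.cone s) :
    pairing u z = 0 := by
  refine le_antisymm ?_ (S.pairing_nonneg_of_mem_cone (fun x hx => (hu x hx).ge) hz)
  have := S.pairing_nonneg_of_mem_cone (u := -u) (fun x hx => by
    rw [pairing_neg_left, hu x hx, neg_zero]) hz
  rwa [pairing_neg_left, neg_nonneg] at this

theorem mem_cone_iff {f : ι} {s : Finset V} (hs : s ⊆ S.facet f) {z : Fin n → ℝ} :
    z ∈ S.cone s ↔ ∀ x ∈ S.facet f, 0 ≤ pairing (S.dual f x) z ∧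
      (x ∉ s → pairing (S.dual f x) z = 0) := by
  refine ⟨fun hz x hx => ⟨?_, fun hxs => ?_⟩, fun h => ?_⟩
  · refine S.pairing_nonneg_of_mem_cone (fun y hy => ?_) hz
    rw [S.pairing_dual_rvec hx (hs hy)]
    split_ifs <;> norm_num
  · refine S.pairing_eq_zero_of_mem_cone (fun y hy => ?_) hz
    rw [S.pairing_dual_rvec hx (hs hy), if_neg (ne_of_mem_of_not_mem hy hxs).symm]
  · have hz : z = ∑ x ∈ s, pairing (S.dual f x) z • S.rvec x := by
      conv_lhs => rw [← S.sum_dual_rvec f z]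
      exact (Finset.sum_subset hs fun x hx hxs => by rw [(h x hx).2 hxs, zero_smul]).symm
    rw [hz]
    exact S.sum_mem_cone fun x hx => (h x (hs hx)).1

theorem mem_cone_facet_iff {f : ι} {z : Fin n → ℝ} :
    z ∈ S.cone (S.facet f) ↔ ∀ x ∈ S.facet f, 0 ≤ pairing (S.dual f x) z := by
  rw [S.mem_cone_iff subset_rfl]
  exact forall₂_congr fun x hx => by simp [hx]

theorem mem_cone_face_iff {f : ι} {s t : Finset V} (hs : s ⊆ S.facet f) {u : Fin n → ℤ}
    (hu : ∀ x ∈ s, 0 ≤ pairing u (S.rvec x))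
    (ht : ∀ x, x ∈ t ↔ x ∈ s ∧ pairing u (S.rvec x) = 0) (z : Fin n → ℝ) :
    z ∈ S.cone t ↔ z ∈ S.cone s ∧ pairing u z = 0 := by
  have hts : t ⊆ s := fun x hx => ((ht x).1 hx).1
  refine ⟨fun hz => ⟨S.cone_mono hts hz,
    S.pairing_eq_zero_of_mem_cone (fun x hx => ((ht x).1 hx).2) hz⟩, fun ⟨hz, h0⟩ => ?_⟩
  rw [S.mem_cone_iff hs] at hz
  have hterm : ∀ x ∈ S.facet f, 0 ≤ pairing (S.dual f x) z * pairing u (S.rvec x) := by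
    intro x hx
    by_cases hxs : x ∈ s
    · exact mul_nonneg (hz x hx).1 (hu x hxs)
    · rw [(hz x hx).2 hxs, zero_mul]
  rw [S.pairing_eq_sum f, Finset.sum_eq_zero_iff_of_nonneg hterm] at h0
  refine (S.mem_cone_iff (hts.trans hs)).2 fun x hx => ⟨(hz x hx).1, fun hxt => ?_⟩
  by_cases hxs : x ∈ s
  · exact (mul_eq_zero.1 (h0 x hx)).resolve_right fun h => hxt ((ht x).2 ⟨hxs, h⟩)
  · exact (hz x hx).2 hxs

theorem rvec_ne_zero {f : ι} {x : V} (hx : x ∈ S.facet f) : S.rvec x ≠ 0 := fun h => by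
  simpa [h, pairing_zero_right] using S.pairing_dual_rvec hx hx

theorem linearIndepOn_rvec (f : ι) : LinearIndepOn ℝ S.rvec (S.facet f : Set V) := by
  rw [linearIndepOn_finset_iff]
  intro a h x hx
  have := congrArg (pairing (S.dual f x)) h
  rw [pairing_sum_right, pairing_zero_right, Finset.sum_eq_single_of_mem x hx] at this
  · simpa [pairing_smul_right, S.pairing_dual_rvec hx hx] using this
  · intro y hy hne
    rw [pairing_smul_right, S.pairing_dual_rvec hx hy, if_neg hne.symm, mul_zero]

end UnimodularSystem

/-- A unimodular system with an ample divisor `D = ∑ coeff x · D_x`: its Cartier data are the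
characters `cartier f`, and the support function `-coeff` is strictly convex. Moreover every element
of a facet can be exchanged. -/
structure AmpleSystem (n : ℕ) (V ι : Type*) [DecidableEq V] extends UnimodularSystem n V ι where
  cartier : ι → Fin n → ℤ
  coeff : V → ℤ
  cartier_nonneg : ∀ f x, 0 ≤ pairing (cartier f) (toReal (vec x)) + coeff x
  cartier_eq_zero_iff : ∀ f x,
    pairing (cartier f) (toReal (vec x)) + coeff x = 0 ↔ x ∈ facet f
  exists_adj : ∀ f, ∀ x ∈ facet f, ∃ g, facet f \ {x} ⊆ facet g ∧ x ∉ facet g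
  exists_mem_facet : ∀ x, ∃ f, x ∈ facet f

namespace AmpleSystem

variable {n : ℕ} {V ι : Type*} [DecidableEq V] (S : AmpleSystem n V ι)

theorem neg_coeff_le (f : ι) (x : V) : -(S.coeff x : ℝ) ≤ pairing (S.cartier f) (S.rvec x) :=
  neg_le_iff_add_nonneg.2 (S.cartier_nonneg f x)

theorem pairing_cartier_eq_iff {f : ι} {x : V} :
    pairing (S.cartier f) (S.rvec x) = -S.coeff x ↔ x ∈ S.facet f :=
  eq_neg_iff_add_eq_zero.trans (S.cartier_eq_zero_iff f x)

theorem pairing_cartier {f : ι} {x : V} (hx : x ∈ S.facet f) :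
    pairing (S.cartier f) (S.rvec x) = -S.coeff x := S.pairing_cartier_eq_iff.2 hx

theorem mem_facet_of_le {f : ι} {x : V} (h : pairing (S.cartier f) (S.rvec x) ≤ -S.coeff x) :
    x ∈ S.facet f := S.pairing_cartier_eq_iff.1 (h.antisymm (S.neg_coeff_le f x))

theorem pairing_cartier_le {f : ι} {z : Fin n → ℝ} (hz : z ∈ S.cone (S.facet f)) (g : ι) :
    pairing (S.cartier f) z ≤ pairing (S.cartier g) z := by
  have := S.pairing_nonneg_of_mem_cone (u := S.cartier g - S.cartier f) (fun x hx => by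
    rw [pairing_sub_left, S.pairing_cartier hx]
    linarith [S.neg_coeff_le g x]) hz
  rwa [pairing_sub_left, sub_nonneg] at this

theorem mem_facet_of_rvec_mem_cone {f : ι} {x : V} (h : S.rvec x ∈ S.cone (S.facet f)) :
    x ∈ S.facet f := by
  obtain ⟨g, hg⟩ := S.exists_mem_facet x
  refine S.mem_facet_of_le ?_
  rw [← S.pairing_cartier hg]
  exact S.pairing_cartier_le h g

theorem mem_of_rvec_mem_cone {f : ι} {s : Finset V} (hs : s ⊆ S.facet f) {x : V}
    (h : S.rvec x ∈ S.cone s) : x ∈ s := by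
  have hx := S.mem_facet_of_rvec_mem_cone (S.cone_mono hs h)
  by_contra hxs
  have := ((S.mem_cone_iff hs).1 h x hx).2 hxs
  rw [S.pairing_dual_rvec hx hx, if_pos rfl] at this
  exact one_ne_zero this

theorem subset_of_cone_le {f : ι} {s t : Finset V} (ht : t ⊆ S.facet f)
    (h : S.cone s ≤ S.cone t) : s ⊆ t := fun _ hx =>
  S.mem_of_rvec_mem_cone ht (h (S.rvec_mem_cone hx))

/-- `l + 1` is the intersection number of the divisor with the curve of the common wall. -/
theorem exists_cartier_sub_eq {f : ι} {x : V} (hx : x ∈ S.facet f) :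
    ∃ (g : ι) (l : ℕ), S.cartier g - S.cartier f = ((l : ℤ) + 1) • S.dual f x := by
  obtain ⟨g, hg, hxg⟩ := S.exists_adj f x hx
  obtain ⟨a, ha⟩ : ∃ a : ℤ, pairing (S.cartier g - S.cartier f) (S.rvec x) = a :=
    ⟨_, pairing_toReal _ _⟩
  have hpos : 0 < a := by
    have hlt : -(S.coeff x : ℝ) < pairing (S.cartier g) (S.rvec x) :=
      not_le.1 fun h => hxg (S.mem_facet_of_le h)
    rw [pairing_sub_left, S.pairing_cartier hx] at ha
    exact_mod_cast (by linarith : (0 : ℝ) < a)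
  refine ⟨g, (a - 1).toNat, pairing_injective (funext fun z => ?_)⟩
  rw [Int.toNat_of_nonneg (by lia), sub_add_cancel, S.pairing_eq_sum f,
    Finset.sum_eq_single_of_mem x hx, ha, pairing_smul_left, mul_comm]
  intro y hy hne
  have hyg : y ∈ S.facet g := hg (by simp [hy, hne])
  rw [pairing_sub_left, S.pairing_cartier hy, S.pairing_cartier hyg, sub_self, mul_zero]

theorem exists_facet_of_notMem {f : ι} {s : Finset V} (hs : s ⊆ S.facet f) {x : V} (hx : x ∉ s) :
    ∃ g, s ⊆ S.facet g ∧ x ∉ S.facet g := by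
  by_cases hxf : x ∈ S.facet f
  · obtain ⟨g, hg, hxg⟩ := S.exists_adj f x hxf
    refine ⟨g, fun y hy => hg ?_, hxg⟩
    exact Finset.mem_sdiff.2 ⟨hs hy, Finset.notMem_singleton.2 (ne_of_mem_of_not_mem hy hx)⟩
  · exact ⟨f, hs, hxf⟩

/-- The simplex algorithm: `z` lies in the cone of the facet whose character is smallest at `z`. -/
theorem exists_mem_cone_facet [Finite ι] [Nonempty ι] (z : Fin n → ℝ) :
    ∃ f, z ∈ S.cone (S.facet f) := by
  obtain ⟨f, hf⟩ := Finite.exists_min fun f => pairing (S.cartier f) z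
  refine ⟨f, S.mem_cone_facet_iff.2 fun x hx => ?_⟩
  obtain ⟨g, l, hg⟩ := S.exists_cartier_sub_eq hx
  have hdiff : pairing (S.cartier g) z - pairing (S.cartier f) z =
      (l + 1) * pairing (S.dual f x) z := by
    rw [← pairing_sub_left, hg, pairing_smul_left]
    push_cast
    rfl
  exact nonneg_of_mul_nonneg_right (hdiff ▸ sub_nonneg.2 (hf g)) (by positivity)

/-- A set of vectors is a face if it lies in a facet. -/
def IsFace (s : Finset V) : Prop := ∃ f, s ⊆ S.facet f

theorem pairing_cartier_le_of_neg_coeff_le {f : ι} {z : Fin n → ℝ} (hz : z ∈ S.cone (S.facet f))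
    {l : (Fin n → ℝ) →ₗ[ℝ] ℝ} (hl : ∀ x, -(S.coeff x : ℝ) ≤ l (S.rvec x)) :
    pairing (S.cartier f) z ≤ l z := by
  have hlz : l z = ∑ x ∈ S.facet f, pairing (S.dual f x) z * l (S.rvec x) := by
    conv_lhs => rw [← S.sum_dual_rvec f z]
    simp only [map_sum, map_smul, smul_eq_mul]
  rw [S.pairing_eq_sum f, hlz]
  refine Finset.sum_le_sum fun x hx => ?_
  rw [S.pairing_cartier hx]
  exact mul_le_mul_of_nonneg_left (hl x) (S.mem_cone_facet_iff.1 hz x hx)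

theorem isFace_of_tight [Finite ι] [Nonempty ι] {s : Finset V} {l : (Fin n → ℝ) →ₗ[ℝ] ℝ}
    (hl : ∀ x, -(S.coeff x : ℝ) ≤ l (S.rvec x)) (hs : ∀ x ∈ s, l (S.rvec x) = -S.coeff x) :
    S.IsFace s := by
  obtain ⟨f, hf⟩ := S.exists_mem_cone_facet (∑ x ∈ s, S.rvec x)
  have hle := S.pairing_cartier_le_of_neg_coeff_le hf hl
  rw [pairing_sum_right, map_sum, Finset.sum_congr rfl hs] at hle
  have hf_le : ∀ x ∈ s, -(S.coeff x : ℝ) ≤ pairing (S.cartier f) (S.rvec x) :=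
    fun x _ => S.neg_coeff_le f x
  have htight := (Finset.sum_eq_sum_iff_of_le hf_le).1 ((Finset.sum_le_sum hf_le).antisymm hle)
  exact ⟨f, fun x hx => S.mem_facet_of_le (htight x hx).ge⟩

end AmpleSystem

/-! ### Morphisms from affine schemes to `Proj` -/

section ProjMorphism

open HomogeneousLocalization

universe u

variable {A R T : Type u} [CommRing A] [CommRing R] [CommRing T] {σ : Type*} [SetLike σ A]
  [AddSubgroupClass σ A] (𝒜 : ℕ → σ) [GradedRing 𝒜]

/-- The map `(A_t)₀ → R` induced by a map `A → R` that inverts `t`. -/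
def awayLift (φ : A →+* R) {t : A} (h : IsUnit (φ t)) : Away 𝒜 t →+* R :=
  (IsLocalization.Away.lift (S := Localization.Away t) t h).comp
    (algebraMap (Away 𝒜 t) (Localization.Away t))

theorem awayLift_mk (φ : A →+* R) {t : A} (h : IsUnit (φ t)) {d : ℕ} (ht : t ∈ 𝒜 d) (n : ℕ)
    (a : A) (ha : a ∈ 𝒜 (n • d)) : awayLift 𝒜 φ h (Away.mk 𝒜 ht n a ha) * φ t ^ n = φ a := by
  have key : (Away.mk 𝒜 ht n a ha).val * algebraMap A (Localization.Away t) (t ^ n)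
      = algebraMap A (Localization.Away t) a := by
    rw [Away.val_mk, Localization.mk_eq_mk']
    exact IsLocalization.mk'_spec _ a (⟨t ^ n, n, rfl⟩ : Submonoid.powers t)
  have := congrArg (IsLocalization.Away.lift (S := Localization.Away t) t h) key
  rw [map_mul, IsLocalization.Away.lift_eq, IsLocalization.Away.lift_eq, map_pow] at this
  exact this

theorem awayLift_comp (φ : A →+* R) (ψ : R →+* T) {t : A} (h : IsUnit (φ t))
    (h' : IsUnit (ψ.comp φ t)) {d : ℕ} (ht : t ∈ 𝒜 d) :
    ψ.comp (awayLift 𝒜 φ h) = awayLift 𝒜 (ψ.comp φ) h' := by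
  ext z
  obtain ⟨n, a, ha, rfl⟩ := Away.mk_surjective 𝒜 ht z
  apply (h'.pow n).mul_left_injective
  change _ * _ = _ * _
  rw [awayLift_mk, RingHom.comp_apply, RingHom.comp_apply, RingHom.comp_apply,
    ← awayLift_mk 𝒜 φ h ht n a ha, map_mul, map_pow]

theorem awayLift_eq_of_scale {φ φ' : A →+* R} {t : A} (h : IsUnit (φ t)) (h' : IsUnit (φ' t))
    {d : ℕ} (ht : t ∈ 𝒜 d) {u : R} (hu : ∀ e, ∀ a ∈ 𝒜 e, φ' a = u ^ e * φ a) :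
    awayLift 𝒜 φ h = awayLift 𝒜 φ' h' := by
  ext z
  obtain ⟨n, a, ha, rfl⟩ := Away.mk_surjective 𝒜 ht z
  apply (h'.pow n).mul_left_injective
  change _ * _ = _ * _
  rw [awayLift_mk, hu _ t ht, hu _ a ha, mul_pow, ← awayLift_mk 𝒜 φ h ht n a ha, ← pow_mul,
    smul_eq_mul, mul_comm d n]
  ring

theorem awayLift_surjective {φ : A →+* R} (hφ : Function.Surjective φ) {t : A} (ht : t ∈ 𝒜 1)
    (h : IsUnit (φ t)) (h1 : φ t = 1) : Function.Surjective (awayLift 𝒜 φ h) := by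
  intro r
  obtain ⟨a, rfl⟩ := hφ r
  classical
  rw [← RingHom.mem_range, ← DirectSum.sum_support_decompose 𝒜 a, map_sum]
  refine sum_mem fun e _ => ?_
  have he : (DirectSum.decompose 𝒜 a e : A) ∈ 𝒜 (e • 1) := by
    rw [smul_eq_mul, mul_one]
    exact SetLike.coe_mem _
  have := awayLift_mk 𝒜 φ h ht e _ he
  rw [h1, one_pow, mul_one] at this
  exact ⟨_, this⟩

/-- The morphism `Spec R → Proj A` induced by a map `A → R` that inverts `t`. -/
def specToProj (φ : A →+* R) {t : A} (h : IsUnit (φ t)) {d : ℕ} (ht : t ∈ 𝒜 d) (hd : 0 < d) :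
    Spec (CommRingCat.of R) ⟶ Proj 𝒜 :=
  Spec.map (CommRingCat.ofHom (awayLift 𝒜 φ h)) ≫ Proj.awayι 𝒜 t ht hd

theorem specMap_specToProj (φ : A →+* R) (ψ : R →+* T) {t : A} (h : IsUnit (φ t))
    (h' : IsUnit (ψ.comp φ t)) {d : ℕ} (ht : t ∈ 𝒜 d) (hd : 0 < d) :
    Spec.map (CommRingCat.ofHom ψ) ≫ specToProj 𝒜 φ h ht hd =
      specToProj 𝒜 (ψ.comp φ) h' ht hd := by
  rw [specToProj, specToProj, ← awayLift_comp 𝒜 φ ψ h h' ht, CommRingCat.ofHom_comp,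
    Spec.map_comp, Category.assoc]

theorem specToProj_eq_mul (φ : A →+* R) {t s : A} (h : IsUnit (φ t)) (hs' : IsUnit (φ (t * s)))
    {d e : ℕ} (ht : t ∈ 𝒜 d) (hd : 0 < d) (hs : s ∈ 𝒜 e) :
    specToProj 𝒜 φ h ht hd = specToProj 𝒜 φ hs' (SetLike.mul_mem_graded ht hs)
      (hd.trans_le (d.le_add_right e)) := by
  rw [specToProj, specToProj, ← Proj.SpecMap_awayMap_awayι 𝒜 ht hd hs rfl, ← Spec.map_comp_assoc,
    ← CommRingCat.ofHom_comp]
  congr 3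
  ext z
  obtain ⟨n, a, ha, rfl⟩ := Away.mk_surjective 𝒜 ht z
  apply (hs'.pow n).mul_left_injective
  change _ * _ = _ * _
  rw [RingHom.comp_apply, awayMap_mk, awayLift_mk, map_mul, mul_pow, ← mul_assoc, awayLift_mk,
    map_mul, map_pow]

theorem specToProj_congr (φ : A →+* R) {t s : A} (h : IsUnit (φ t)) (h' : IsUnit (φ s))
    {d e : ℕ} (ht : t ∈ 𝒜 d) (hd : 0 < d) (hs : s ∈ 𝒜 e) (he : 0 < e) :
    specToProj 𝒜 φ h ht hd = specToProj 𝒜 φ h' hs he := by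
  have hts : IsUnit (φ (t * s)) := by rw [map_mul]; exact h.mul h'
  have hst : IsUnit (φ (s * t)) := by rw [map_mul]; exact h'.mul h
  rw [specToProj_eq_mul 𝒜 φ h hts ht hd hs, specToProj_eq_mul 𝒜 φ h' hst hs he ht]
  congr 1
  · exact mul_comm _ _
  · exact add_comm _ _

theorem specToProj_eq_of_scale {φ φ' : A →+* R} {t s : A} (h : IsUnit (φ t)) (h' : IsUnit (φ' s))
    {d e : ℕ} (ht : t ∈ 𝒜 d) (hd : 0 < d) (hs : s ∈ 𝒜 e) (he : 0 < e) {u : R} (hu0 : IsUnit u)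
    (hu : ∀ e, ∀ a ∈ 𝒜 e, φ' a = u ^ e * φ a) :
    specToProj 𝒜 φ h ht hd = specToProj 𝒜 φ' h' hs he := by
  have ht' : IsUnit (φ' t) := by rw [hu d t ht]; exact (hu0.pow d).mul h
  rw [specToProj_congr 𝒜 φ' h' ht' hs he ht hd, specToProj, specToProj,
    awayLift_eq_of_scale 𝒜 h ht' ht hu]

theorem specToProj_mem_basicOpen (φ : A →+* R) {t : A} (h : IsUnit (φ t)) {d : ℕ} (ht : t ∈ 𝒜 d)
    (hd : 0 < d) {g : A} {e : ℕ} (hg : g ∈ 𝒜 e) (he : 0 < e) (p : PrimeSpectrum R) :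
    specToProj 𝒜 φ h ht hd p ∈ Proj.basicOpen 𝒜 g ↔ φ g ∉ p.asIdeal := by
  change (Spec.map (CommRingCat.ofHom (awayLift 𝒜 φ h))) p ∈
    Proj.awayι 𝒜 t ht hd ⁻¹ᵁ Proj.basicOpen 𝒜 g ↔ _
  rw [Proj.awayι_preimage_basicOpen 𝒜 ht hd hg he]
  change awayLift 𝒜 φ h _ ∉ p.asIdeal ↔ _
  have hmul : awayLift 𝒜 φ h (Away.isLocalizationElem ht hg) * φ t ^ e = φ g ^ d := by
    rw [← map_pow φ g d]
    exact awayLift_mk 𝒜 φ h ht e (g ^ d) (by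
      convert! SetLike.pow_mem_graded d hg using 2; exact mul_comm _ _)
  rw [not_iff_not, ← Ideal.mul_unit_mem_iff_mem p.asIdeal (h.pow e), hmul]
  exact ⟨fun H => p.2.mem_of_pow_mem d H, fun H => Ideal.pow_mem_of_mem _ H d hd⟩

theorem specToProj_toSpecZero (φ : A →+* R) {t : A} (h : IsUnit (φ t)) {d : ℕ} (ht : t ∈ 𝒜 d)
    (hd : 0 < d) {B : Type u} [CommRing B] (i : B →+* 𝒜 0) :
    specToProj 𝒜 φ h ht hd ≫ Proj.toSpecZero 𝒜 ≫ Spec.map (CommRingCat.ofHom i) =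
      Spec.map (CommRingCat.ofHom (φ.comp ((algebraMap (𝒜 0) A).comp i))) := by
  rw [specToProj, Category.assoc, Proj.awayι_toSpecZero_assoc, ← Spec.map_comp, ← Spec.map_comp,
    ← CommRingCat.ofHom_comp, ← CommRingCat.ofHom_comp]
  congr 2
  ext b
  rw [RingHom.comp_apply, RingHom.comp_apply]
  have hmul := awayLift_mk 𝒜 φ h ht 0 (i b : A) (by rw [zero_smul]; exact (i b).2)
  rw [pow_zero, mul_one] at hmul
  refine Eq.trans ?_ hmul
  congr 1
  ext
  rw [Away.val_mk]
  change Localization.mk _ _ = _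
  congr 1
  exact Subtype.ext (pow_zero t).symm

theorem isClosedImmersion_restrict_basicOpen {X : Scheme.{u}} (i : X ⟶ Proj 𝒜) (φ : A →+* R)
    {t : A} (h : IsUnit (φ t)) {d : ℕ} (ht : t ∈ 𝒜 d) (hd : 0 < d)
    (j : Spec (CommRingCat.of R) ⟶ X) [IsOpenImmersion j] (hj : j ≫ i = specToProj 𝒜 φ h ht hd)
    (hrange : Set.range j = i ⁻¹' (Proj.basicOpen 𝒜 t : Set (Proj 𝒜)))
    (hsurj : Function.Surjective (awayLift 𝒜 φ h)) :
    IsClosedImmersion (i ∣_ Proj.basicOpen 𝒜 t) := by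
  let U := Proj.basicOpen 𝒜 t
  let ε : Spec (CommRingCat.of R) ≅ (i ⁻¹ᵁ U).toScheme :=
    IsOpenImmersion.isoOfRangeEq j (i ⁻¹ᵁ U).ι (by rw [hrange, Scheme.Opens.range_ι]; rfl)
  have hε : ε.hom ≫ (i ⁻¹ᵁ U).ι = j := IsOpenImmersion.isoOfRangeEq_hom_fac _ _ _
  have hcomp : ε.hom ≫ (i ∣_ U) = Spec.map (CommRingCat.ofHom (awayLift 𝒜 φ h)) ≫
      (Proj.basicOpenIsoSpec 𝒜 t ht hd).inv := by
    rw [← cancel_mono U.ι, Category.assoc, morphismRestrict_ι, reassoc_of% hε, hj, Category.assoc,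
      Proj.basicOpenIsoSpec_inv_ι]
    rfl
  have : IsClosedImmersion (Spec.map (CommRingCat.ofHom (awayLift 𝒜 φ h))) :=
    IsClosedImmersion.spec_of_surjective _ hsurj
  rw [(Iso.eq_inv_comp ε).2 hcomp]
  infer_instance

end ProjMorphism

/-! ### Projective embeddings of toric varieties -/

section Projective

attribute [local instance] MvPolynomial.gradedAlgebra

section Monomial

theorem aeval_mul_of_isHomogeneous {T B R : Type*} [CommSemiring B] [CommSemiring R] [Algebra B R]
    (r : T → R) (u : R) {a : MvPolynomial T B} {e : ℕ} (ha : a.IsHomogeneous e) :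
    MvPolynomial.aeval (fun j => u * r j) a = u ^ e * MvPolynomial.aeval r a := by
  rw [MvPolynomial.aeval_def, MvPolynomial.aeval_def, MvPolynomial.eval₂_eq, MvPolynomial.eval₂_eq,
    Finset.mul_sum]
  refine Finset.sum_congr rfl fun d hd => ?_
  have hdeg : ∑ i ∈ d.support, d i = e := by
    rw [← ha (MvPolynomial.mem_support_iff.1 hd), Finsupp.weight_apply, Finsupp.sum]
    simp
  simp only [mul_pow, Finset.prod_mul_distrib]
  rw [Finset.prod_pow_eq_pow_sum, hdeg]
  ring

variable {n : ℕ} {T : Type} {q : T → Fin n → ℤ} {k k' : T} {σ τ : PointedCone ℝ (Fin n → ℝ)}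

/-- The map `y_j ↦ χ^{q_j - q_k}` from a polynomial ring to the coordinate ring of a chart: the
monomials `χ^{q_j}` as homogeneous coordinates, normalized by the `k`-th of them. -/
def monomialMap (q : T → Fin n → ℤ) (k : T) (σ : PointedCone ℝ (Fin n → ℝ))
    (h : ∀ j, q j - q k ∈ dualMonoid σ) : MvPolynomial T ℂ →ₐ[ℂ] coordRing σ :=
  MvPolynomial.aeval fun j => AddMonoidAlgebra.single ⟨q j - q k, h j⟩ 1

theorem monomialMap_X (h : ∀ j, q j - q k ∈ dualMonoid σ) (j : T) :
    monomialMap q k σ h (MvPolynomial.X j) = AddMonoidAlgebra.single ⟨q j - q k, h j⟩ 1 := by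
  simp [monomialMap]

theorem monomialMap_X_self (h : ∀ j, q j - q k ∈ dualMonoid σ) :
    (monomialMap q k σ h : MvPolynomial T ℂ →+* coordRing σ) (MvPolynomial.X k) = 1 := by
  rw [RingHom.coe_coe, monomialMap_X, AddMonoidAlgebra.one_def]
  congr 1
  exact Subtype.ext (sub_self _)

theorem coordRingMap_comp_monomialMap (hle : τ ≤ σ) (h : ∀ j, q j - q k ∈ dualMonoid σ) :
    (coordRingMap hle).comp (monomialMap q k σ h : MvPolynomial T ℂ →+* coordRing σ) =
      (monomialMap q k τ fun j => dualMonoid_anti hle (h j) :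
        MvPolynomial T ℂ →+* coordRing τ) := by
  refine MvPolynomial.ringHom_ext (fun c => ?_) fun j => ?_
  · simp [monomialMap, coordRingMap]
  · rw [RingHom.comp_apply, RingHom.coe_coe, monomialMap_X, coordRingMap_single, RingHom.coe_coe,
      monomialMap_X]
    rfl

theorem isUnit_single {u : Fin n → ℤ} (hu : u ∈ dualMonoid σ) (hu' : -u ∈ dualMonoid σ) :
    IsUnit (AddMonoidAlgebra.single ⟨u, hu⟩ 1 : coordRing σ) := by
  refine IsUnit.of_mul_eq_one (AddMonoidAlgebra.single ⟨-u, hu'⟩ 1) ?_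
  rw [AddMonoidAlgebra.single_mul_single, AddMonoidAlgebra.one_def, mul_one]
  congr 1
  exact Subtype.ext (add_neg_cancel u)

theorem monomialMap_scale (h : ∀ j, q j - q k ∈ dualMonoid σ) (h' : ∀ j, q j - q k' ∈ dualMonoid σ)
    {e : ℕ} {a : MvPolynomial T ℂ} (ha : a ∈ MvPolynomial.homogeneousSubmodule T ℂ e) :
    monomialMap q k' σ h' a =
      (AddMonoidAlgebra.single ⟨q k - q k', h' k⟩ 1 : coordRing σ) ^ e * monomialMap q k σ h a := by
  rw [monomialMap, monomialMap, ← aeval_mul_of_isHomogeneous _ _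
    ((MvPolynomial.mem_homogeneousSubmodule _ _).1 ha)]
  congr 2
  funext j
  rw [AddMonoidAlgebra.single_mul_single, mul_one]
  congr 1
  exact Subtype.ext (by simp)

theorem monomialMap_surjective (h : ∀ j, q j - q k ∈ dualMonoid σ)
    (hgen : dualMonoid σ ≤ AddSubmonoid.closure (Set.range fun j => q j - q k)) :
    Function.Surjective (monomialMap q k σ h) := by
  have hclosure : AddSubmonoid.closure
      (Set.range fun j => (⟨q j - q k, h j⟩ : dualMonoid σ)) = ⊤ := by
    refine AddSubmonoid.map_injective_of_injective (f := (dualMonoid σ).subtype)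
      Subtype.coe_injective ?_
    rw [AddMonoidHom.map_mclosure, ← Set.range_comp, ← AddMonoidHom.mrange_eq_map,
      AddSubmonoid.mrange_subtype]
    exact (AddSubmonoid.closure_le.2 (Set.range_subset_iff.2 h)).antisymm hgen
  intro r
  obtain ⟨a, rfl⟩ :=
    AddMonoidAlgebra.mvPolynomial_aeval_of_surjective_of_closure (R := ℂ) hclosure r
  refine ⟨MvPolynomial.rename (fun s => s.2.choose) a, ?_⟩
  rw [monomialMap, MvPolynomial.aeval_rename]
  congr 2
  funext s
  exact congrArg (fun u => (AddMonoidAlgebra.single u 1 : coordRing σ)) s.2.choose_spec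

theorem X_mem_homogeneousSubmodule {B : Type*} [CommSemiring B] (j : T) :
    (MvPolynomial.X j : MvPolynomial T B) ∈ MvPolynomial.homogeneousSubmodule T B 1 :=
  (MvPolynomial.mem_homogeneousSubmodule _ _).2 (MvPolynomial.isHomogeneous_X B j)

/-- The morphism to `Proj` given by the monomials `χ^{q_j}`, on a chart on which the quotients by
the `k`-th of them are regular. -/
def monomialMorphism (h : ∀ j, q j - q k ∈ dualMonoid σ) :
    Spec (CommRingCat.of (coordRing σ)) ⟶ Proj (MvPolynomial.homogeneousSubmodule T ℂ) :=
  specToProj _ (monomialMap q k σ h : MvPolynomial T ℂ →+* coordRing σ) (t := MvPolynomial.X k)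
    (monomialMap_X_self h ▸ isUnit_one) (X_mem_homogeneousSubmodule k) one_pos

theorem specMap_monomialMorphism (hle : τ ≤ σ) (h : ∀ j, q j - q k ∈ dualMonoid σ)
    (h' : ∀ j, q j - q k' ∈ dualMonoid τ) :
    Spec.map (CommRingCat.ofHom (coordRingMap hle)) ≫ monomialMorphism h =
      monomialMorphism h' := by
  have hτ : ∀ j, q j - q k ∈ dualMonoid τ := fun j => dualMonoid_anti hle (h j)
  have hunit : IsUnit (((coordRingMap hle).comp
      (monomialMap q k σ h : MvPolynomial T ℂ →+* coordRing σ)) (MvPolynomial.X k)) := by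
    rw [coordRingMap_comp_monomialMap hle h, monomialMap_X_self]
    exact isUnit_one
  rw [monomialMorphism, specMap_specToProj _ _ _ _ hunit]
  refine specToProj_eq_of_scale _ _ _ _ _ _ _
    (isUnit_single (h' k) (by rw [neg_sub]; exact hτ k')) fun e a ha => ?_
  rw [coordRingMap_comp_monomialMap hle h]
  exact monomialMap_scale hτ h' ha

theorem monomialMorphism_mem_basicOpen (h : ∀ j, q j - q k ∈ dualMonoid σ)
    {g : MvPolynomial T ℂ} {e : ℕ} (hg : g ∈ MvPolynomial.homogeneousSubmodule T ℂ e) (he : 0 < e)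
    (p : PrimeSpectrum (coordRing σ)) :
    monomialMorphism h p ∈ Proj.basicOpen (MvPolynomial.homogeneousSubmodule T ℂ) g ↔
      monomialMap q k σ h g ∉ p.asIdeal :=
  specToProj_mem_basicOpen _ _ _ _ _ hg he p

theorem iSup_basicOpen_X {B : Type} [CommRing B] :
    ⨆ j : T, Proj.basicOpen (MvPolynomial.homogeneousSubmodule T B) (MvPolynomial.X j) = ⊤ := by
  refine Proj.iSup_basicOpen_eq_top' _ _ (fun j => ⟨1, X_mem_homogeneousSubmodule j⟩) ?_
  rw [eq_top_iff]
  intro a _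
  induction a using MvPolynomial.induction_on with
  | C c =>
    exact Subalgebra.algebraMap_mem _ (⟨MvPolynomial.C c,
      (MvPolynomial.mem_homogeneousSubmodule _ _).2 (MvPolynomial.isHomogeneous_C T c)⟩ :
      MvPolynomial.homogeneousSubmodule T B 0)
  | add a b ha hb => exact add_mem (ha trivial) (hb trivial)
  | mul_X a j ha => exact mul_mem (ha trivial) (Algebra.subset_adjoin ⟨j, rfl⟩)

theorem iSup_basicOpen_eq_top_of_X_pow_mem {B κ : Type} [CommRing B] (b : κ → MvPolynomial T B)
    (h : ∀ j, ∃ l, MvPolynomial.X j ^ l ∈ Ideal.span (Set.range b)) :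
    ⨆ i, Proj.basicOpen (MvPolynomial.homogeneousSubmodule T B) (b i) = ⊤ := by
  rw [eq_top_iff, ← iSup_basicOpen_X]
  refine iSup_le fun j p hp => TopologicalSpace.Opens.mem_iSup.2 ?_
  by_contra! hb
  have hspan : Ideal.span (Set.range b) ≤ p.asHomogeneousIdeal.toIdeal :=
    Ideal.span_le.2 (Set.range_subset_iff.2 fun i => not_not.1 (hb i))
  obtain ⟨l, hl⟩ := h j
  exact hp (p.isPrime.mem_of_pow_mem l (hspan hl))

end Monomial

namespace Fan

variable {n : ℕ} (Δ : Fan n)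

/-- The inclusion of an affine chart into the toric variety. -/
def inclusion (σ : Δ.cones) : Spec (CommRingCat.of (coordRing σ.1)) ⟶ Δ.toricVariety :=
  colimit.ι Δ.chart σ

instance (σ : Δ.cones) : IsOpenImmersion (Δ.inclusion σ) :=
  inferInstanceAs (IsOpenImmersion (colimit.ι Δ.chart σ))

theorem chart_map_inclusion {σ τ : Δ.cones} (i : τ ⟶ σ) :
    Δ.chart.map i ≫ Δ.inclusion σ = Δ.inclusion τ := colimit.w Δ.chart i

theorem inclusion_jointly_surjective (x : Δ.toricVariety) :
    ∃ (σ : Δ.cones) (p : PrimeSpectrum (coordRing σ.1)), Δ.inclusion σ p = x :=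
  Scheme.IsLocallyDirected.ι_jointly_surjective Δ.chart x

theorem inclusion_structureMap (σ : Δ.cones) : Δ.inclusion σ ≫ Δ.structureMap =
    Spec.map (CommRingCat.ofHom (algebraMap ℂ (coordRing σ.1))) := colimit.ι_desc _ _

theorem inclusion_mem_range {σ τ : Δ.cones} (u : dualMonoid σ.1)
    (hu : ∀ z, z ∈ σ.1 ⊓ τ.1 ↔ z ∈ σ.1 ∧ pairing (u : Fin n → ℤ) z = 0)
    {p : PrimeSpectrum (coordRing σ.1)}
    (hp : (AddMonoidAlgebra.single u 1 : coordRing σ.1) ∉ p.asIdeal) :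
    Δ.inclusion σ p ∈ Set.range (Δ.inclusion τ) := by
  let ρ : Δ.cones := ⟨_, Δ.face_mem σ σ.2 _ ⟨u, u.2, hu⟩⟩
  let i : ρ ⟶ σ := homOfLE (show σ.1 ⊓ τ.1 ≤ σ.1 from inf_le_left)
  let k : ρ ⟶ τ := homOfLE (show σ.1 ⊓ τ.1 ≤ τ.1 from inf_le_right)
  obtain ⟨p, rfl⟩ : p ∈ Set.range (Δ.chart.map i) := by
    rw [Δ.range_chart_map i u hu]
    exact hp
  refine ⟨Δ.chart.map k p, ?_⟩
  change (Δ.chart.map k ≫ Δ.inclusion _) p = (Δ.chart.map i ≫ Δ.inclusion _) p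
  rw [Δ.chart_map_inclusion, Δ.chart_map_inclusion]

end Fan

namespace UnimodularSystem

variable {n : ℕ} {V ι : Type*} [DecidableEq V] (S : UnimodularSystem n V ι)

theorem dualMonoid_cone_facet (f : ι) :
    dualMonoid (S.cone (S.facet f)) = AddSubmonoid.closure (S.dual f '' S.facet f) := by
  refine le_antisymm (fun u hu => ?_) (AddSubmonoid.closure_le.2 ?_)
  · have hnat : ∀ x ∈ S.facet f, ∃ a : ℕ, pairing u (S.rvec x) = a := by
      intro x hx
      have h0 := hu _ (S.rvec_mem_cone hx)
      rw [rvec, pairing_toReal] at h0 ⊢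
      obtain ⟨a, ha⟩ := Int.eq_ofNat_of_zero_le (by exact_mod_cast h0 : (0 : ℤ) ≤ _)
      exact ⟨a, by rw [ha]; rfl⟩
    choose! a ha using hnat
    have hsum : u = ∑ x ∈ S.facet f, a x • S.dual f x := by
      refine pairing_injective (funext fun z => ?_)
      rw [S.pairing_eq_sum f, pairing_sum_left]
      refine Finset.sum_congr rfl fun x hx => ?_
      rw [← natCast_zsmul, pairing_smul_left, ha x hx, mul_comm]
      push_cast
      rfl
    rw [hsum]
    exact sum_mem fun x hx => nsmul_mem (AddSubmonoid.subset_closure (Set.mem_image_of_mem _ hx)) _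
  · rintro _ ⟨x, hx, rfl⟩ z hz
    exact S.mem_cone_facet_iff.1 hz x hx

end UnimodularSystem

namespace AmpleSystem

variable {n : ℕ} {V ι : Type*} [DecidableEq V] (S : AmpleSystem n V ι)

/-- The lattice points `cartier f` and their neighbours `cartier f + dual f x`: the exponents of the
sections that embed the toric variety. The neighbours are there because the differences
`cartier g - cartier f` alone need not generate the dual monoid of the cone of `f`. -/
def point : (Σ f, Option {x // x ∈ S.facet f}) → Fin n → ℤ
  | ⟨f, none⟩ => S.cartier f
  | ⟨f, some x⟩ => S.cartier f + S.dual f x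

theorem exists_smul_point (j) : ∃ (l : ℕ) (f g : ι),
    (l + 1) • S.point j = l • S.cartier f + S.cartier g := by
  obtain ⟨f, _ | ⟨x, hx⟩⟩ := j
  · exact ⟨0, f, f, by simp [point]⟩
  · obtain ⟨g, l, hg⟩ := S.exists_cartier_sub_eq hx
    refine ⟨l, f, g, ?_⟩
    rw [eq_add_of_sub_eq hg, point]
    module

theorem neg_coeff_le_point (j) (x : V) :
    -(S.coeff x : ℝ) ≤ pairing (S.point j) (S.rvec x) := by
  obtain ⟨l, f, g, h⟩ := S.exists_smul_point j
  have hpair := congrArg (fun u => pairing u (S.rvec x)) h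
  simp only [← natCast_zsmul, pairing_smul_left, pairing_add_left] at hpair
  push_cast at hpair
  refine le_of_mul_le_mul_left ?_ (by positivity : (0 : ℝ) < l + 1)
  rw [hpair]
  linarith [mul_le_mul_of_nonneg_left (S.neg_coeff_le f x) l.cast_nonneg, S.neg_coeff_le g x]

theorem point_sub_cartier_mem {σ : PointedCone ℝ (Fin n → ℝ)} {f : ι}
    (hσ : σ ≤ S.cone (S.facet f)) (j) : S.point j - S.cartier f ∈ dualMonoid σ := fun z hz =>
  S.pairing_nonneg_of_mem_cone (fun x hx => by
    rw [pairing_sub_left, S.pairing_cartier hx]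
    linarith [S.neg_coeff_le_point j x]) (hσ hz)

theorem mem_cone_inf_cone_facet_iff {s : Finset V} {g : ι} (hs : s ⊆ S.facet g) (f : ι)
    (z : Fin n → ℝ) : z ∈ S.cone s ⊓ S.cone (S.facet f) ↔
      z ∈ S.cone s ∧ pairing (S.cartier f - S.cartier g) z = 0 := by
  rw [Submodule.mem_inf]
  refine and_congr_right fun hz => ⟨fun hzf => ?_, fun h0 => ?_⟩
  · rw [pairing_sub_left, sub_eq_zero]
    exact (S.pairing_cartier_le hzf g).antisymm (S.pairing_cartier_le (S.cone_mono hs hz) f)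
  · have hnonneg : ∀ x ∈ s, 0 ≤ pairing (S.cartier f - S.cartier g) (S.rvec x) := fun x hx =>
      S.point_sub_cartier_mem (S.cone_mono hs) ⟨f, none⟩ _ (S.rvec_mem_cone hx)
    classical
    have hz' := (S.mem_cone_face_iff (t := s.filter fun x =>
      pairing (S.cartier f - S.cartier g) (S.rvec x) = 0) hs hnonneg (by simp) z).2 ⟨hz, h0⟩
    refine S.cone_mono (fun x hx => S.mem_facet_of_le ?_) hz'
    obtain ⟨hxs, hx0⟩ := Finset.mem_filter.1 hx
    rw [pairing_sub_left, S.pairing_cartier (hs hxs), sub_eq_zero] at hx0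
    exact hx0.le

/-- The fan consists of the cones spanned by the faces of the system. -/
def Spans (Δ : Fan n) : Prop := ∀ σ, σ ∈ Δ.cones ↔ ∃ s, S.IsFace s ∧ σ = S.cone s

variable {S} {Δ : Fan n}

theorem Spans.exists_le (hΔ : S.Spans Δ) (σ : Δ.cones) : ∃ f, σ.1 ≤ S.cone (S.facet f) := by
  obtain ⟨s, ⟨f, hf⟩, hs⟩ := (hΔ σ).1 σ.2
  exact ⟨f, hs ▸ S.cone_mono hf⟩

theorem Spans.cone_facet_mem (hΔ : S.Spans Δ) (f : ι) : S.cone (S.facet f) ∈ Δ.cones :=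
  (hΔ _).2 ⟨_, ⟨f, subset_rfl⟩, rfl⟩

section Embedding

variable {T : Type} (e : T ≃ Σ f, Option {x // x ∈ S.facet f})

/-- The homogeneous coordinate that does not vanish on the chart of the facet `f`. -/
def chartIndex (f : ι) : T := e.symm ⟨f, none⟩

theorem point_chartIndex (f : ι) : S.point (e (chartIndex e f)) = S.cartier f := by
  rw [chartIndex, e.apply_symm_apply]
  rfl

theorem point_sub_mem {σ : PointedCone ℝ (Fin n → ℝ)} {f : ι} (hσ : σ ≤ S.cone (S.facet f))
    (j : T) : S.point (e j) - S.point (e (chartIndex e f)) ∈ dualMonoid σ := by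
  rw [point_chartIndex]
  exact S.point_sub_cartier_mem hσ (e j)

/-- The homogeneous coordinates on a chart, normalized by that of a facet `f`. -/
def chartMap {σ : PointedCone ℝ (Fin n → ℝ)} {f : ι} (hσ : σ ≤ S.cone (S.facet f)) :
    MvPolynomial T ℂ →ₐ[ℂ] coordRing σ :=
  monomialMap (fun j => S.point (e j)) (chartIndex e f) σ (point_sub_mem e hσ)

/-- The projective morphism on a chart. -/
def chartMorphism {σ : PointedCone ℝ (Fin n → ℝ)} {f : ι} (hσ : σ ≤ S.cone (S.facet f)) :
    Spec (CommRingCat.of (coordRing σ)) ⟶ Proj (MvPolynomial.homogeneousSubmodule T ℂ) :=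
  monomialMorphism (q := fun j => S.point (e j)) (point_sub_mem e hσ)

theorem specMap_chartMorphism {σ τ : PointedCone ℝ (Fin n → ℝ)} (h : τ ≤ σ) {f g : ι}
    (hσ : σ ≤ S.cone (S.facet f)) (hτ : τ ≤ S.cone (S.facet g)) :
    Spec.map (CommRingCat.ofHom (coordRingMap h)) ≫ chartMorphism e hσ = chartMorphism e hτ :=
  specMap_monomialMorphism h _ _

theorem chartMorphism_congr {σ : PointedCone ℝ (Fin n → ℝ)} {f g : ι}
    (hσ : σ ≤ S.cone (S.facet f)) (hσ' : σ ≤ S.cone (S.facet g)) :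
    chartMorphism e hσ = chartMorphism e hσ' := by
  rw [← specMap_chartMorphism e le_rfl hσ hσ', coordRingMap_refl]
  have : Spec.map (CommRingCat.ofHom (RingHom.id (coordRing σ))) = 𝟙 _ := Spec.map_id _
  rw [this, Category.id_comp]

theorem chartMap_surjective (f : ι) :
    Function.Surjective (chartMap e (le_refl (S.cone (S.facet f)))) := by
  refine monomialMap_surjective _ ?_
  rw [S.dualMonoid_cone_facet, AddSubmonoid.closure_le]
  rintro _ ⟨x, hx, rfl⟩
  refine AddSubmonoid.subset_closure ⟨e.symm ⟨f, some ⟨x, hx⟩⟩, ?_⟩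
  simp only [point_chartIndex, e.apply_symm_apply]
  exact add_sub_cancel_left _ _

/-- The morphism from the toric variety to projective space given by the points of the system. -/
def embedding (hΔ : S.Spans Δ) :
    Δ.toricVariety ⟶ Proj (MvPolynomial.homogeneousSubmodule T ℂ) :=
  colimit.desc Δ.chart
    { pt := Proj (MvPolynomial.homogeneousSubmodule T ℂ)
      ι :=
        { app := fun σ => chartMorphism e (hΔ.exists_le σ).choose_spec
          naturality := fun τ _ i =>
            (specMap_chartMorphism e (leOfHom i) _ (hΔ.exists_le τ).choose_spec).trans
              (Category.comp_id _).symm } }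

theorem inclusion_embedding (hΔ : S.Spans Δ) (σ : Δ.cones) {f : ι}
    (hσ : σ.1 ≤ S.cone (S.facet f)) : Δ.inclusion σ ≫ embedding e hΔ = chartMorphism e hσ :=
  (colimit.ι_desc _ _).trans (chartMorphism_congr e (hΔ.exists_le σ).choose_spec hσ)

theorem embedding_mem_basicOpen (hΔ : S.Spans Δ) (σ : Δ.cones) {f : ι}
    (hσ : σ.1 ≤ S.cone (S.facet f)) {g : MvPolynomial T ℂ} {d : ℕ}
    (hg : g ∈ MvPolynomial.homogeneousSubmodule T ℂ d) (hd : 0 < d)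
    (p : PrimeSpectrum (coordRing σ.1)) :
    embedding e hΔ (Δ.inclusion σ p) ∈
      Proj.basicOpen (MvPolynomial.homogeneousSubmodule T ℂ) g ↔ chartMap e hσ g ∉ p.asIdeal := by
  have : embedding e hΔ (Δ.inclusion σ p) = chartMorphism e hσ p := by
    rw [← inclusion_embedding e hΔ σ hσ]
    rfl
  rw [this]
  exact monomialMorphism_mem_basicOpen _ hg hd p

theorem range_inclusion (hΔ : S.Spans Δ) (f : ι) :
    Set.range (Δ.inclusion ⟨_, hΔ.cone_facet_mem f⟩) = embedding e hΔ ⁻¹'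
      (Proj.basicOpen (MvPolynomial.homogeneousSubmodule T ℂ)
        (MvPolynomial.X (chartIndex e f)) : Set _) := by
  apply subset_antisymm
  · rintro _ ⟨p, rfl⟩
    refine (embedding_mem_basicOpen e hΔ ⟨_, hΔ.cone_facet_mem f⟩ (f := f) le_rfl
      (X_mem_homogeneousSubmodule _) one_pos p).2 fun hp => ?_
    exact p.2.one_notMem (monomialMap_X_self (point_sub_mem e (f := f) le_rfl) ▸ hp)
  · intro x hx
    obtain ⟨σ, p, rfl⟩ := Δ.inclusion_jointly_surjective x
    obtain ⟨s, ⟨g, hg⟩, hs⟩ := (hΔ σ).1 σ.2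
    have hσ : σ.1 ≤ S.cone (S.facet g) := hs ▸ S.cone_mono hg
    have hp := (embedding_mem_basicOpen e hΔ σ hσ (X_mem_homogeneousSubmodule _) one_pos p).1 hx
    rw [chartMap, monomialMap_X] at hp
    refine Δ.inclusion_mem_range (τ := ⟨_, hΔ.cone_facet_mem f⟩) _ (fun z => ?_) hp
    simp only [point_chartIndex, hs]
    exact S.mem_cone_inf_cone_facet_iff hg f z

theorem exists_homogeneous_relation (j : T) :
    ∃ (l : ℕ) (f g : ι), ∃ b ∈ MvPolynomial.homogeneousSubmodule T ℂ (l + 1),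
      MvPolynomial.X j ^ (l + 1) = b +
        MvPolynomial.X (chartIndex e f) ^ l * MvPolynomial.X (chartIndex e g) ∧
      ∀ (σ : PointedCone ℝ (Fin n → ℝ)) (f' : ι) (hσ : σ ≤ S.cone (S.facet f')),
        chartMap e hσ b = 0 := by
  obtain ⟨l, f, g, hrel⟩ := S.exists_smul_point (e j)
  refine ⟨l, f, g, MvPolynomial.X j ^ (l + 1) -
    MvPolynomial.X (chartIndex e f) ^ l * MvPolynomial.X (chartIndex e g), sub_mem ?_ ?_,
    (sub_add_cancel _ _).symm, fun σ f' hσ => ?_⟩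
  · simpa using SetLike.pow_mem_graded (l + 1) (X_mem_homogeneousSubmodule (B := ℂ) j)
  · simpa using SetLike.mul_mem_graded (SetLike.pow_mem_graded l
      (X_mem_homogeneousSubmodule (B := ℂ) (chartIndex e f)))
      (X_mem_homogeneousSubmodule (chartIndex e g))
  · simp only [chartMap, map_sub, map_mul, map_pow, monomialMap_X, AddMonoidAlgebra.single_pow,
      AddMonoidAlgebra.single_mul_single, one_pow, mul_one]
    rw [sub_eq_zero]
    congr 1
    refine Subtype.ext ?_
    simp only [AddSubmonoidClass.coe_nsmul, AddSubmonoid.coe_add, point_chartIndex, smul_sub, hrel]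
    module

/-- Over `D₊` of the coordinate of a facet the embedding is the closed immersion of an affine chart;
over `D₊` of the relations its source is empty. Together these open sets cover `Proj`. -/
theorem isClosedImmersion_embedding (hΔ : S.Spans Δ) : IsClosedImmersion (embedding e hΔ) := by
  choose l f g b hb hX hzero using exists_homogeneous_relation e
  let c : T ⊕ T → MvPolynomial T ℂ := Sum.elim b fun j => MvPolynomial.X (chartIndex e (g j))
  refine IsZariskiLocalAtTarget.of_iSup_eq_top
    (fun i => Proj.basicOpen (MvPolynomial.homogeneousSubmodule T ℂ) (c i))
    (iSup_basicOpen_eq_top_of_X_pow_mem c fun j => ⟨l j + 1, ?_⟩) ?_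
  · rw [hX]
    exact add_mem (Ideal.subset_span ⟨.inl j, rfl⟩)
      (Ideal.mul_mem_left _ _ (Ideal.subset_span ⟨.inr j, rfl⟩))
  rintro (j | j)
  · have : IsEmpty (embedding e hΔ ⁻¹ᵁ Proj.basicOpen _ (b j)) := by
      refine ⟨fun ⟨x, hx⟩ => ?_⟩
      obtain ⟨σ, p, rfl⟩ := Δ.inclusion_jointly_surjective x
      obtain ⟨f', hσ⟩ := hΔ.exists_le σ
      refine (embedding_mem_basicOpen e hΔ σ hσ (hb j) (Nat.succ_pos _) p).1 hx ?_
      rw [hzero]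
      exact zero_mem _
    change IsClosedImmersion (embedding e hΔ ∣_ Proj.basicOpen _ (b j))
    infer_instance
  · exact isClosedImmersion_restrict_basicOpen _ _ _ _ _ one_pos
      (Δ.inclusion ⟨_, hΔ.cone_facet_mem (g j)⟩)
      (inclusion_embedding e hΔ ⟨_, hΔ.cone_facet_mem (g j)⟩ (f := g j) le_rfl)
      (range_inclusion e hΔ (g j))
      (awayLift_surjective _ (chartMap_surjective e (g j)) (X_mem_homogeneousSubmodule _) _
        (monomialMap_X_self _))

end Embedding

theorem chartMorphism_projectiveSpaceMap {N : ℕ}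
    (e : Fin (N + 1) ≃ Σ f, Option {x // x ∈ S.facet f}) {σ : PointedCone ℝ (Fin n → ℝ)} {f : ι}
    (hσ : σ ≤ S.cone (S.facet f)) : chartMorphism e hσ ≫ projectiveSpaceMap N =
      Spec.map (CommRingCat.ofHom (algebraMap ℂ (coordRing σ))) := by
  refine (specToProj_toSpecZero _ _ _ _ _ _).trans ?_
  congr 2
  exact RingHom.ext fun c => (chartMap e hσ).commutes c

theorem Spans.isProjective [Finite ι] [Nonempty ι] (hΔ : S.Spans Δ) :
    IsProjective Δ.structureMap := by
  have : Nonempty (Σ f, Option {x // x ∈ S.facet f}) := ⟨⟨Classical.arbitrary ι, none⟩⟩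
  obtain ⟨N, hN⟩ := Nat.exists_eq_succ_of_ne_zero
    (Nat.card_pos (α := Σ f, Option {x // x ∈ S.facet f})).ne'
  let e : Fin (N + 1) ≃ Σ f, Option {x // x ∈ S.facet f} := (Finite.equivFinOfCardEq hN).symm
  refine ⟨N, embedding e hΔ, isClosedImmersion_embedding e hΔ, colimit.hom_ext fun σ => ?_⟩
  obtain ⟨f, hσ⟩ := hΔ.exists_le σ
  change Δ.inclusion σ ≫ embedding e hΔ ≫ projectiveSpaceMap N = Δ.inclusion σ ≫ Δ.structureMap
  rw [Δ.inclusion_structureMap, ← chartMorphism_projectiveSpaceMap e hσ,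
    ← inclusion_embedding e hΔ σ hσ]
  exact (Category.assoc _ _ _).symm

end AmpleSystem

end Projective

/-! ### The polytope of an ample system -/

section Exposed

variable {E V : Type*} [AddCommGroup E] [Module ℝ E] {q : V → E} {M : ℝ}

theorem le_of_mem_convexHull_range {l : E →ₗ[ℝ] ℝ} (hM : ∀ x, l (q x) ≤ M) {z : E}
    (hz : z ∈ convexHull ℝ (Set.range q)) : l z ≤ M :=
  convexHull_min (Set.range_subset_iff.2 hM) (convex_halfSpace_le l.isLinear M) hz

theorem eq_of_mem_convexHull_image {l : E →ₗ[ℝ] ℝ} {s : Set V} (hs : ∀ x ∈ s, l (q x) = M) {z : E}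
    (hz : z ∈ convexHull ℝ (q '' s)) : l z = M :=
  convexHull_min (t := {z | l z = M}) (Set.image_subset_iff.2 hs)
    (convex_hyperplane l.isLinear M) hz

theorem mem_convexHull_of_eq {l : E →ₗ[ℝ] ℝ} (hM : ∀ x, l (q x) ≤ M) {z : E}
    (hz : z ∈ convexHull ℝ (Set.range q)) (hlz : l z = M) :
    z ∈ convexHull ℝ (q '' {x | l (q x) = M}) := by
  suffices h : z ∈ {z | l z ≤ M ∧ (l z = M → z ∈ convexHull ℝ (q '' {x | l (q x) = M}))} from
    h.2 hlz
  refine convexHull_min ?_ ?_ hz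
  · rintro _ ⟨x, rfl⟩
    exact ⟨hM x, fun h => subset_convexHull ℝ _ ⟨x, h, rfl⟩⟩
  rintro y ⟨hy, hy'⟩ z ⟨hz, hz'⟩ a b ha hb hab
  have hmap : l (a • y + b • z) = M - (a * (M - l y) + b * (M - l z)) := by
    rw [map_add, map_smul, map_smul, smul_eq_mul, smul_eq_mul]
    linear_combination M * hab
  have hya : 0 ≤ a * (M - l y) := mul_nonneg ha (sub_nonneg.2 hy)
  have hzb : 0 ≤ b * (M - l z) := mul_nonneg hb (sub_nonneg.2 hz)
  refine ⟨by linarith, fun h => ?_⟩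
  rcases mul_eq_zero.1 (by linarith : a * (M - l y) = 0) with rfl | hy0
  · obtain rfl : b = 1 := by linarith
    simpa using hz' (by linarith)
  rcases mul_eq_zero.1 (by linarith : b * (M - l z) = 0) with rfl | hz0
  · obtain rfl : a = 1 := by linarith
    simpa using hy' (by linarith)
  exact convex_convexHull ℝ _ (hy' (by linarith)) (hz' (by linarith)) ha hb hab

theorem toExposed_convexHull_range [TopologicalSpace E] {l : E →L[ℝ] ℝ}
    (hM : ∀ x, l (q x) ≤ M) {z₀ : E} (hz₀ : z₀ ∈ convexHull ℝ (Set.range q)) (h₀ : l z₀ = M) :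
    l.toExposed (convexHull ℝ (Set.range q)) = convexHull ℝ (q '' {x | l (q x) = M}) := by
  have hmax {z : E} (hz : z ∈ convexHull ℝ (Set.range q)) : l z ≤ M :=
    le_of_mem_convexHull_range (l := (l : E →ₗ[ℝ] ℝ)) hM hz
  refine Set.ext fun z => ⟨fun ⟨hz, hle⟩ => ?_, fun hz => ⟨?_, fun y hy => ?_⟩⟩
  · exact mem_convexHull_of_eq (l := (l : E →ₗ[ℝ] ℝ)) hM hz
      ((hmax hz).antisymm (h₀ ▸ hle z₀ hz₀))
  · exact convexHull_mono (Set.image_subset_range _ _) hz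
  · have hz' : l z = M := eq_of_mem_convexHull_image (l := (l : E →ₗ[ℝ] ℝ)) (fun _ h => h) hz
    exact hz' ▸ hmax hy

end Exposed

namespace AmpleSystem

variable {n : ℕ} {V ι : Type*} [DecidableEq V] (S : AmpleSystem n V ι)

section Polytope

variable [Fintype ι]

/-- The average of the characters of the facets. -/
def avg : (Fin n → ℝ) →L[ℝ] ℝ := (Fintype.card ι : ℝ)⁻¹ • ∑ f, pairingCLM (S.cartier f)

/-- The coefficient of `D_x` after a change of the divisor by a linear function that makes all
coefficients positive. -/
def height (x : V) : ℝ := S.coeff x + S.avg (S.rvec x)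

/-- The vertices of the polytope of the system. -/
def vertex (x : V) : Fin n → ℝ := (S.height x)⁻¹ • S.rvec x

/-- The linear functional that is `1` on the facet `f` of the polytope. -/
def facetFunctional (f : ι) : (Fin n → ℝ) →L[ℝ] ℝ := S.avg - pairingCLM (S.cartier f)

/-- The polytope of the system, polar to the moment polytope of the ample divisor. -/
def polytope : Set (Fin n → ℝ) := convexHull ℝ (Set.range S.vertex)

theorem vertex_mem_polytope (x : V) : S.vertex x ∈ S.polytope := subset_convexHull ℝ _ ⟨x, rfl⟩

variable [Nonempty ι]

theorem height_pos (x : V) : 0 < S.height x := by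
  have hcard : (0 : ℝ) < Fintype.card ι := by exact_mod_cast Fintype.card_pos
  have hsum : S.height x =
      (Fintype.card ι : ℝ)⁻¹ * ∑ f, (pairing (S.cartier f) (S.rvec x) + S.coeff x) := by
    simp only [height, avg, _root_.smul_apply, _root_.sum_apply, pairingCLM_apply,
      Finset.sum_add_distrib, Finset.sum_const, Finset.card_univ, nsmul_eq_mul, smul_eq_mul]
    field_simp
    ring
  obtain ⟨f, -, hf⟩ := S.exists_facet_of_notMem (f := Classical.arbitrary ι)
    (Finset.empty_subset _) (Finset.notMem_empty x)
  rw [hsum]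
  refine mul_pos (inv_pos.2 hcard) (Finset.sum_pos' (fun g _ => S.cartier_nonneg g x)
    ⟨f, Finset.mem_univ f, (S.cartier_nonneg f x).lt_of_ne' ?_⟩)
  exact fun h => hf ((S.cartier_eq_zero_iff f x).1 h)

theorem height_smul_vertex (x : V) : S.height x • S.vertex x = S.rvec x :=
  smul_inv_smul₀ (S.height_pos x).ne' _

theorem facetFunctional_vertex (f : ι) (x : V) : S.facetFunctional f (S.vertex x) =
    1 - (S.height x)⁻¹ * (pairing (S.cartier f) (S.rvec x) + S.coeff x) := by
  have havg : S.avg (S.rvec x) = S.height x - S.coeff x := by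
    rw [height]
    ring
  have := (S.height_pos x).ne'
  rw [vertex, map_smul, smul_eq_mul, facetFunctional, _root_.sub_apply, pairingCLM_apply, havg]
  field_simp
  ring

theorem facetFunctional_vertex_le (f : ι) (x : V) : S.facetFunctional f (S.vertex x) ≤ 1 := by
  rw [S.facetFunctional_vertex]
  exact sub_le_self _ (mul_nonneg (inv_pos.2 (S.height_pos x)).le (S.cartier_nonneg f x))

theorem facetFunctional_vertex_eq_one_iff (f : ι) (x : V) :
    S.facetFunctional f (S.vertex x) = 1 ↔ x ∈ S.facet f := by
  rw [S.facetFunctional_vertex, sub_eq_self, mul_eq_zero, ← S.cartier_eq_zero_iff f x]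
  exact or_iff_right (inv_pos.2 (S.height_pos x)).ne'

theorem exists_eq_sum_vertex (z : Fin n → ℝ) : ∃ (f : ι) (a : V → ℝ),
    (∀ x ∈ S.facet f, 0 ≤ a x) ∧ z = ∑ x ∈ S.facet f, a x • S.vertex x := by
  obtain ⟨f, hf⟩ := S.exists_mem_cone_facet z
  refine ⟨f, fun x => pairing (S.dual f x) z * S.height x, fun x hx =>
    mul_nonneg (S.mem_cone_facet_iff.1 hf x hx) (S.height_pos x).le, ?_⟩
  conv_lhs => rw [← S.sum_dual_rvec f z]
  exact Finset.sum_congr rfl fun x _ => by rw [mul_smul, S.height_smul_vertex]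

theorem exists_eq_facetFunctional_smul [Nonempty V] (z : Fin n → ℝ) :
    ∃ f, 0 ≤ S.facetFunctional f z ∧ ∃ p ∈ S.polytope, z = S.facetFunctional f z • p := by
  obtain ⟨f, a, ha, rfl⟩ := S.exists_eq_sum_vertex z
  have hsum : S.facetFunctional f (∑ x ∈ S.facet f, a x • S.vertex x) = ∑ x ∈ S.facet f, a x := by
    rw [map_sum]
    exact Finset.sum_congr rfl fun x hx => by
      rw [map_smul, (S.facetFunctional_vertex_eq_one_iff f x).2 hx, smul_eq_mul, mul_one]
  have hnonneg : 0 ≤ ∑ x ∈ S.facet f, a x := Finset.sum_nonneg ha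
  refine ⟨f, hsum.symm ▸ hnonneg, ?_⟩
  rw [hsum]
  rcases hnonneg.eq_or_lt with h0 | hpos
  · have ha0 := (Finset.sum_eq_zero_iff_of_nonneg ha).1 h0.symm
    refine ⟨_, S.vertex_mem_polytope (Classical.arbitrary V), ?_⟩
    rw [← h0, zero_smul]
    exact Finset.sum_eq_zero fun x hx => by rw [ha0 x hx, zero_smul]
  · exact ⟨(S.facet f).centerMass a S.vertex, (convex_convexHull ℝ _).centerMass_mem ha hpos
      fun x _ => S.vertex_mem_polytope x, (smul_inv_smul₀ hpos.ne' _).symm⟩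

theorem zero_mem_polytope [Nonempty V] : (0 : Fin n → ℝ) ∈ S.polytope := by
  let x := Classical.arbitrary V
  obtain ⟨f, hnonneg, p, hp, hx⟩ := S.exists_eq_facetFunctional_smul (-S.vertex x)
  set a := S.facetFunctional f (-S.vertex x)
  have hcomb : (1 + a)⁻¹ • S.vertex x + (a / (1 + a)) • p = 0 := by
    rw [div_eq_inv_mul, mul_smul, ← hx, smul_neg, add_neg_cancel]
  exact hcomb ▸ convex_convexHull ℝ _ (S.vertex_mem_polytope x) hp (by positivity) (by positivity)
    (by field_simp)

theorem mem_polytope_of_facetFunctional_le [Nonempty V] {z : Fin n → ℝ}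
    (hz : ∀ f, S.facetFunctional f z ≤ 1) : z ∈ S.polytope := by
  obtain ⟨f, hnonneg, p, hp, hzp⟩ := S.exists_eq_facetFunctional_smul z
  rw [hzp]
  exact (convex_convexHull ℝ _).smul_mem_of_zero_mem S.zero_mem_polytope hp ⟨hnonneg, hz f⟩

theorem zero_mem_intrinsicInterior [Nonempty V] :
    (0 : Fin n → ℝ) ∈ intrinsicInterior ℝ S.polytope := by
  refine interior_subset_intrinsicInterior (mem_interior.2
    ⟨⋂ f, {z | S.facetFunctional f z < 1}, fun z hz => ?_, ?_, by simp⟩)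
  · exact S.mem_polytope_of_facetFunctional_le fun f => (Set.mem_iInter.1 hz f).le
  · exact isOpen_iInter_of_finite fun f =>
      isOpen_lt (S.facetFunctional f).continuous continuous_const

/-- The sum of the functionals of the facets that contain a face attains its maximum on the polytope
exactly on that face. -/
theorem exists_functional {s : Finset V} (hs : S.IsFace s) : ∃ (l : (Fin n → ℝ) →L[ℝ] ℝ) (M : ℝ),
    0 < M ∧ (∀ x, l (S.vertex x) ≤ M) ∧ ∀ x, l (S.vertex x) = M ↔ x ∈ s := by
  classical
  obtain ⟨f, hf⟩ := hs
  let G : Finset ι := {g | s ⊆ S.facet g}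
  have hM : ∑ _ ∈ G, (1 : ℝ) = G.card := by simp
  refine ⟨∑ g ∈ G, S.facetFunctional g, G.card, ?_, fun x => ?_, fun x => ?_⟩
  · exact_mod_cast Finset.card_pos.2 ⟨f, by simpa [G]⟩
  · rw [_root_.sum_apply, ← hM]
    exact Finset.sum_le_sum fun g _ => S.facetFunctional_vertex_le g x
  · rw [_root_.sum_apply, ← hM,
      Finset.sum_eq_sum_iff_of_le fun g _ => S.facetFunctional_vertex_le g x]
    simp only [facetFunctional_vertex_eq_one_iff, G, Finset.mem_filter_univ]
    refine ⟨fun h => ?_, fun hx g hg => hg hx⟩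
    by_contra hx
    obtain ⟨g, hg, hxg⟩ := S.exists_facet_of_notMem hf hx
    exact hxg (h g hg)

theorem vertex_mem_convexHull_iff {s : Finset V} (x : V) :
    S.vertex x ∈ convexHull ℝ (S.vertex '' s) ↔ x ∈ s := by
  refine ⟨fun h => ?_, fun h => subset_convexHull ℝ _ ⟨x, h, rfl⟩⟩
  obtain ⟨f, hf⟩ := S.exists_mem_facet x
  obtain ⟨l, M, -, hle, hl⟩ := S.exists_functional (s := {x}) ⟨f, by simpa using hf⟩
  by_contra hx
  have hlt : convexHull ℝ (S.vertex '' s) ⊆ {z | l z < M} := by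
    refine convexHull_min ?_ (convex_halfSpace_lt l.toLinearMap.isLinear M)
    rintro _ ⟨y, hy, rfl⟩
    refine (hle y).lt_of_ne fun h => hx ?_
    rwa [← Finset.mem_singleton.1 ((hl y).1 h)]
  exact (hlt h).ne ((hl x).2 (Finset.mem_singleton_self x))

theorem vertex_injective : Function.Injective S.vertex := fun x y h => by
  refine Finset.mem_singleton.1 ((S.vertex_mem_convexHull_iff (s := {y}) x).1 ?_)
  rw [h, vertex_mem_convexHull_iff]
  exact Finset.mem_singleton_self y

theorem isProperFace_convexHull [Nonempty V] {s : Finset V} (hs : S.IsFace s) :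
    IsProperFace S.polytope (convexHull ℝ (S.vertex '' s)) := by
  obtain ⟨l, M, hM, hle, hl⟩ := S.exists_functional hs
  have hlM {z : Fin n → ℝ} (hz : z ∈ convexHull ℝ (S.vertex '' s)) : l z = M :=
    eq_of_mem_convexHull_image (l := l.toLinearMap) (fun x hx => (hl x).2 hx) hz
  refine ⟨fun ⟨z₀, hz₀⟩ => ⟨l, ?_⟩, fun h => ?_⟩
  · have hs : {x | l (S.vertex x) = M} = s := Set.ext hl
    rw [← hs, ← toExposed_convexHull_range hle
      (convexHull_mono (Set.image_subset_range _ _) hz₀) (hlM hz₀)]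
    rfl
  · have h0 := hlM (h ▸ S.zero_mem_polytope)
    rw [map_zero] at h0
    exact hM.ne h0

theorem eq_zero_of_vertex_nonpos {l : (Fin n → ℝ) →ₗ[ℝ] ℝ} (hl : ∀ x, l (S.vertex x) ≤ 0) :
    l = 0 := by
  have hle (z : Fin n → ℝ) : l z ≤ 0 := by
    obtain ⟨f, a, ha, rfl⟩ := S.exists_eq_sum_vertex z
    rw [map_sum]
    refine Finset.sum_nonpos fun x hx => ?_
    rw [map_smul]
    exact mul_nonpos_of_nonneg_of_nonpos (ha x hx) (hl x)
  refine LinearMap.ext fun z => (hle z).antisymm ?_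
  simpa using hle (-z)

theorem isFace_of_vertex_tight {s : Finset V} {l : (Fin n → ℝ) →ₗ[ℝ] ℝ}
    (hl : ∀ x, l (S.vertex x) ≤ 1) (hs : ∀ x ∈ s, l (S.vertex x) = 1) : S.IsFace s := by
  have hrvec (x : V) : (S.avg - l : (Fin n → ℝ) →ₗ[ℝ] ℝ) (S.rvec x) =
      -S.coeff x + S.height x * (1 - l (S.vertex x)) := by
    have hlx : l (S.rvec x) = S.height x * l (S.vertex x) := by
      rw [← S.height_smul_vertex x, map_smul, smul_eq_mul]
    rw [LinearMap.sub_apply, hlx, height, ContinuousLinearMap.coe_coe]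
    ring
  refine S.isFace_of_tight (l := S.avg - l) (fun x => ?_) fun x hx => ?_
  · rw [hrvec]
    exact le_add_of_nonneg_right (mul_nonneg (S.height_pos x).le (sub_nonneg.2 (hl x)))
  · rw [hrvec, hs x hx, sub_self, mul_zero, add_zero]

theorem exists_eq_convexHull [Finite V] {F : Set (Fin n → ℝ)} (hF : IsProperFace S.polytope F) :
    ∃ s, S.IsFace s ∧ F = convexHull ℝ (S.vertex '' s) := by
  classical
  cases nonempty_fintype V
  rcases F.eq_empty_or_nonempty with rfl | hne
  · exact ⟨∅, ⟨Classical.arbitrary ι, by simp⟩, by simp⟩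
  obtain ⟨l, hl⟩ := hF.1 hne
  obtain ⟨z₀, hz₀⟩ := hne
  obtain ⟨hz₀, hmax⟩ := hl ▸ hz₀
  have hle (x : V) : l (S.vertex x) ≤ l z₀ := hmax _ (S.vertex_mem_polytope x)
  have hpos : 0 < l z₀ := by
    by_contra! hneg
    have hzero : (l : (Fin n → ℝ) →ₗ[ℝ] ℝ) = 0 :=
      S.eq_zero_of_vertex_nonpos fun x => (hle x).trans hneg
    have hl0 (z : Fin n → ℝ) : l z = 0 := LinearMap.congr_fun hzero z
    exact hF.2 (by simp [hl, hl0])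
  let s : Finset V := {x | l (S.vertex x) = l z₀}
  refine ⟨s, S.isFace_of_vertex_tight (l := (l z₀)⁻¹ • (l : (Fin n → ℝ) →ₗ[ℝ] ℝ)) (fun x => ?_)
    (fun x hx => ?_), ?_⟩
  · rw [LinearMap.smul_apply, smul_eq_mul, inv_mul_le_one₀ hpos]
    exact hle x
  · rw [LinearMap.smul_apply, smul_eq_mul, inv_mul_eq_one₀ hpos.ne']
    exact (Finset.mem_filter_univ x).1 hx |>.symm
  · rw [hl, Finset.coe_filter_univ, ← toExposed_convexHull_range hle hz₀ rfl]
    rfl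

theorem linearIndependent_vertex {f : ι} {s : Finset V} (hs : s ⊆ S.facet f) :
    LinearIndependent ℝ fun x : s => S.vertex x := by
  have hrvec : LinearIndependent ℝ fun x : s => S.rvec x :=
    (S.linearIndepOn_rvec f).mono (by exact_mod_cast hs)
  exact hrvec.units_smul fun x => Units.mk0 _ (inv_pos.2 (S.height_pos x)).ne'

theorem isSimplicialPolytope [Finite V] : IsSimplicialPolytope S.polytope := by
  classical
  cases nonempty_fintype V
  refine ⟨⟨Finset.univ.image S.vertex, by simp [polytope]⟩, fun F hF => ?_⟩
  obtain ⟨s, ⟨f, hs⟩, rfl⟩ := S.exists_eq_convexHull hF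
  refine ⟨s.image S.vertex, ?_, by rw [Finset.coe_image]⟩
  have hrange : (Set.range fun x : s => S.vertex x) = ↑(s.image S.vertex) := by
    ext z
    simp
  have hindep := (S.linearIndependent_vertex hs).affineIndependent.range
  rwa [hrange] at hindep

theorem hull_convexHull_vertex (s : Finset V) :
    PointedCone.hull ℝ (convexHull ℝ (S.vertex '' s)) = S.cone s := by
  apply le_antisymm
  · refine Submodule.span_le.2 (convexHull_min ?_ (PointedCone.convex (S.cone s)))
    rintro _ ⟨x, hx, rfl⟩
    exact PointedCone.smul_mem _ (inv_pos.2 (S.height_pos x)).le (S.rvec_mem_cone hx)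
  · refine Submodule.span_le.2 ?_
    rintro _ ⟨x, hx, rfl⟩
    rw [← S.height_smul_vertex x]
    exact PointedCone.smul_mem _ (S.height_pos x).le
      (PointedCone.subset_hull (subset_convexHull ℝ _ (Set.mem_image_of_mem _ hx)))

end Polytope

variable {S}

theorem Spans.isStronglyPolytopal [Finite V] [Nonempty V] [Finite ι] [Nonempty ι] {Δ : Fan n}
    (hΔ : S.Spans Δ) : Δ.IsStronglyPolytopal := by
  cases nonempty_fintype ι
  refine ⟨S.polytope, S.isSimplicialPolytope, S.zero_mem_intrinsicInterior, Set.ext fun σ => ?_⟩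
  rw [hΔ σ]
  constructor
  · rintro ⟨s, hs, rfl⟩
    exact ⟨_, S.isProperFace_convexHull hs, (S.hull_convexHull_vertex s).symm⟩
  · rintro ⟨F, hF, rfl⟩
    obtain ⟨s, hs, rfl⟩ := S.exists_eq_convexHull hF
    exact ⟨s, hs, S.hull_convexHull_vertex s⟩

theorem isPolytopal [Finite V] [Nonempty V] [Finite ι] [Nonempty ι]
    {K : AbstractSimplicialComplex V}
    (hK : ∀ s : Finset V, s.Nonempty → (s ∈ K.faces ↔ S.IsFace s)) : IsPolytopal K := by
  cases nonempty_fintype ι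
  have hext (x : V) : S.vertex x ∈ S.polytope.extremePoints ℝ := by
    obtain ⟨f, hf⟩ := S.exists_mem_facet x
    have h := (S.isProperFace_convexHull (s := {x}) ⟨f, by simpa using hf⟩).1.isExtreme
    rw [Finset.coe_singleton, Set.image_singleton, convexHull_singleton] at h
    exact isExtreme_singleton.1 h
  refine ⟨n, S.polytope, S.isSimplicialPolytope, Equiv.ofBijective
    (fun x => ⟨S.vertex x, hext x⟩) ⟨fun x y h => ?_, fun ⟨z, hz⟩ => ?_⟩, fun s hs => ?_⟩
  · exact S.vertex_injective (congrArg Subtype.val h)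
  · obtain ⟨x, rfl⟩ := extremePoints_convexHull_subset hz
    exact ⟨x, rfl⟩
  · rw [hK s hs]
    refine ⟨fun h => ⟨_, S.isProperFace_convexHull h,
      fun x => (S.vertex_mem_convexHull_iff x).symm⟩, fun ⟨F, hF, h⟩ => ?_⟩
    obtain ⟨t, ht, rfl⟩ := S.exists_eq_convexHull hF
    obtain rfl : s = t := Finset.ext fun x => (h x).trans (S.vertex_mem_convexHull_iff x)
    exact ht

end AmpleSystem

/-! ### The fan of an ample system -/

theorem toReal_injective {n : ℕ} : Function.Injective (toReal (n := n)) :=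
  Int.cast_injective.comp_left

theorem toReal_sum_smul {n : ℕ} {V : Type*} (s : Finset V) (a : V → ℤ) (v : V → Fin n → ℤ) :
    toReal (∑ x ∈ s, a x • v x) = ∑ x ∈ s, (a x : ℝ) • toReal (v x) := by
  funext i
  simp [toReal, Finset.sum_apply]

namespace UnimodularSystem

variable {n : ℕ} {V ι : Type*} [DecidableEq V] (S : UnimodularSystem n V ι)

theorem linearIndependent_vec (f : ι) : LinearIndependent ℤ fun x : S.facet f => S.vec x := by
  let toRealHom : (Fin n → ℤ) →ₗ[ℤ] Fin n → ℝ :=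
    (Int.castAddHom ℝ).toIntLinearMap.compLeft (Fin n)
  exact .of_comp toRealHom ((S.linearIndepOn_rvec f).restrict_scalars' ℤ)

theorem top_le_span_vec (f : ι) :
    ⊤ ≤ Submodule.span ℤ (Set.range fun x : S.facet f => S.vec x) := by
  intro z _
  have hz : z = ∑ x ∈ S.facet f, (∑ i, S.dual f x i * z i) • S.vec x := by
    apply toReal_injective
    rw [toReal_sum_smul]
    conv_lhs => rw [← S.sum_dual f (toReal z)]
    exact Finset.sum_congr rfl fun x _ => by rw [pairing_toReal]
  rw [hz]
  exact Submodule.sum_mem _ fun x hx =>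
    Submodule.smul_mem _ _ (Submodule.subset_span ⟨⟨x, hx⟩, rfl⟩)

/-- The lattice basis given by a facet. -/
def basis (f : ι) : Module.Basis (S.facet f) ℤ (Fin n → ℤ) :=
  Module.Basis.mk (S.linearIndependent_vec f) (S.top_le_span_vec f)

theorem exists_basis {f : ι} {s : Finset V} (hs : s ⊆ S.facet f) :
    ∃ (b : Module.Basis (Fin n) ℤ (Fin n → ℤ)) (t : Set (Fin n)),
      S.cone s = PointedCone.hull ℝ ((fun i => toReal (b i)) '' t) := by
  have hcard : Fintype.card (S.facet f) = n := by
    rw [← Module.finrank_eq_card_basis (S.basis f), Module.finrank_fin_fun]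
  let e := Fintype.equivFinOfCardEq hcard
  refine ⟨(S.basis f).reindex e, {i | (e.symm i : V) ∈ s}, ?_⟩
  rw [cone]
  congr 1
  ext z
  constructor
  · rintro ⟨x, hx, rfl⟩
    exact ⟨e ⟨x, hs hx⟩, by simpa using hx, by simp [basis, rvec]⟩
  · rintro ⟨i, hi, rfl⟩
    exact ⟨e.symm i, hi, by simp [basis, rvec]⟩

theorem eq_zero_of_mem_cone_of_neg_mem_cone {f : ι} {s : Finset V} (hs : s ⊆ S.facet f)
    {z : Fin n → ℝ} (hz : z ∈ S.cone s) (hz' : -z ∈ S.cone s) : z = 0 := by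
  rw [← S.sum_dual_rvec f z]
  refine Finset.sum_eq_zero fun x hx => ?_
  have hneg := ((S.mem_cone_iff hs).1 hz' x hx).1
  rw [pairing_neg_right, neg_nonneg] at hneg
  rw [hneg.antisymm ((S.mem_cone_iff hs).1 hz x hx).1, zero_smul]

theorem eq_of_rvec_mem_span_singleton {f : ι} {x y : V} (hx : x ∈ S.facet f) (hy : y ∈ S.facet f)
    {v : Fin n → ℝ} (hxv : S.rvec x ∈ Submodule.span ℝ {v})
    (hyv : S.rvec y ∈ Submodule.span ℝ {v}) : x = y := by
  obtain ⟨a, ha⟩ := Submodule.mem_span_singleton.1 hxv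
  obtain ⟨b, hb⟩ := Submodule.mem_span_singleton.1 hyv
  have hxx := S.pairing_dual_rvec hx hx
  have hyx := S.pairing_dual_rvec hx hy
  rw [← ha, pairing_smul_right, if_pos rfl] at hxx
  by_contra hne
  rw [← hb, pairing_smul_right, if_neg hne,
    mul_eq_zero_iff_right (right_ne_zero_of_mul_eq_one hxx)] at hyx
  exact S.rvec_ne_zero hy (by rw [← hb, hyx, zero_smul])

theorem cone_singleton (x : V) : S.cone {x} = PointedCone.hull ℝ {S.rvec x} := by
  rw [cone, Finset.coe_singleton, Set.image_singleton]

theorem exists_eq_singleton_of_cone_eq_hull {f : ι} {s : Finset V} (hs : s ⊆ S.facet f)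
    {v : Fin n → ℝ} (hv : v ≠ 0) (h : S.cone s = PointedCone.hull ℝ {v}) : ∃ x, s = {x} := by
  have hspan : ∀ x ∈ s, S.rvec x ∈ Submodule.span ℝ {v} := fun x hx => by
    have hmem := S.rvec_mem_cone hx
    rw [h] at hmem
    exact PointedCone.hull_le_span ℝ _ hmem
  obtain ⟨x, hx⟩ : s.Nonempty := by
    rw [Finset.nonempty_iff_ne_empty]
    rintro rfl
    have hmem : v ∈ S.cone ∅ := h ▸ PointedCone.subset_hull rfl
    exact hv (by simpa [cone] using hmem)
  exact ⟨x, Finset.eq_singleton_iff_unique_mem.2 ⟨hx, fun y hy =>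
    S.eq_of_rvec_mem_span_singleton (hs hy) (hs hx) (hspan y hy) (hspan x hx)⟩⟩

end UnimodularSystem

namespace AmpleSystem

variable {n : ℕ} {V ι : Type*} [DecidableEq V] (S : AmpleSystem n V ι)

theorem cone_singleton_le_iff {f : ι} {t : Finset V} (ht : t ⊆ S.facet f) (x : V) :
    S.cone {x} ≤ S.cone t ↔ x ∈ t :=
  ⟨fun h => S.subset_of_cone_le ht h (Finset.mem_singleton_self x),
    fun h => S.cone_mono (Finset.singleton_subset_iff.2 h)⟩

/-- The cone of `t` is cut out of that of `s ⊆ facet f` by the sum of the differences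
`cartier g - cartier f` over the facets `g ⊇ t`. -/
theorem isConeFace_inf_cone [Finite ι] {s t : Finset V} (hs : S.IsFace s) (ht : S.IsFace t) :
    IsConeFace (S.cone s ⊓ S.cone t) (S.cone s) := by
  classical
  cases nonempty_fintype ι
  obtain ⟨f, hs⟩ := hs
  obtain ⟨_, ht⟩ := ht
  let G : Finset ι := {g | t ⊆ S.facet g}
  let u : Fin n → ℤ := ∑ g ∈ G, (S.cartier g - S.cartier f)
  have hu (z) : pairing u z = ∑ g ∈ G, (pairing (S.cartier g) z - pairing (S.cartier f) z) := by
    simp only [u, pairing_sum_left, pairing_sub_left]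
  have hterm {z} (hz : z ∈ S.cone (S.facet f)) :
      ∀ g ∈ G, 0 ≤ pairing (S.cartier g) z - pairing (S.cartier f) z :=
    fun g _ => sub_nonneg.2 (S.pairing_cartier_le hz g)
  have hnonneg : ∀ z ∈ S.cone s, 0 ≤ pairing u z := fun z hz =>
    hu z ▸ Finset.sum_nonneg (hterm (S.cone_mono hs hz))
  refine ⟨u, hnonneg, fun z => ?_⟩
  rw [Submodule.mem_inf]
  refine and_congr_right fun hzs => ⟨fun hzt => ?_, fun h0 => ?_⟩
  · refine le_antisymm ?_ (hnonneg z hzs)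
    rw [hu]
    exact Finset.sum_nonpos fun g hg => sub_nonpos.2
      (S.pairing_cartier_le (S.cone_mono ((Finset.mem_filter_univ g).1 hg) hzt) f)
  · have hz := (S.mem_cone_face_iff (t := {x ∈ s | pairing u (S.rvec x) = 0}) hs
      (fun x hx => hnonneg _ (S.rvec_mem_cone hx)) (by simp) z).2 ⟨hzs, h0⟩
    refine S.cone_mono (fun x hx => ?_) hz
    obtain ⟨hxs, hx0⟩ := Finset.mem_filter.1 hx
    rw [hu, Finset.sum_eq_zero_iff_of_nonneg (hterm (S.rvec_mem_cone (hs hxs)))] at hx0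
    by_contra hxt
    obtain ⟨g, hg, hxg⟩ := S.exists_facet_of_notMem ht hxt
    have hxeq := hx0 g ((Finset.mem_filter_univ g).2 hg)
    rw [S.pairing_cartier (hs hxs), sub_eq_zero] at hxeq
    exact hxg (S.mem_facet_of_le hxeq.le)

variable [Finite V] [Finite ι]

/-- The fan whose cones are spanned by the faces of an ample system. -/
def fan : Fan n where
  cones := {σ | ∃ s, S.IsFace s ∧ σ = S.cone s}
  finite := by
    refine (Set.finite_range S.cone).subset ?_
    rintro _ ⟨s, -, rfl⟩
    exact ⟨s, rfl⟩
  rational := by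
    classical
    rintro _ ⟨s, -, rfl⟩
    refine ⟨s.image S.vec, ?_⟩
    rw [Finset.coe_image, Set.image_image]
    rfl
  stronglyConvex := by
    rintro _ ⟨s, ⟨f, hs⟩, rfl⟩ z hz hz'
    exact S.eq_zero_of_mem_cone_of_neg_mem_cone hs hz hz'
  face_mem := by
    classical
    rintro _ ⟨s, ⟨f, hs⟩, rfl⟩ τ ⟨u, hu, hτ⟩
    refine ⟨{x ∈ s | pairing u (S.rvec x) = 0}, ⟨f, (Finset.filter_subset _ _).trans hs⟩, ?_⟩
    ext z
    rw [hτ]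
    exact (S.mem_cone_face_iff hs (fun x hx => hu _ (S.rvec_mem_cone hx)) (by simp) z).symm
  inf_isFace := by
    rintro _ ⟨s, hs, rfl⟩ _ ⟨t, ht, rfl⟩
    exact S.isConeFace_inf_cone hs ht

theorem spans_fan : S.Spans S.fan := fun _ => Iff.rfl

theorem isComplete_fan [Nonempty ι] : S.fan.IsComplete := fun z => by
  obtain ⟨f, hf⟩ := S.exists_mem_cone_facet z
  exact ⟨_, ⟨_, ⟨f, subset_rfl⟩, rfl⟩, hf⟩

theorem isNonsingular_fan : S.fan.IsNonsingular := by
  rintro _ ⟨s, ⟨f, hs⟩, rfl⟩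
  exact S.exists_basis hs

theorem cone_singleton_mem_rays (x : V) : S.cone {x} ∈ S.fan.rays := by
  obtain ⟨f, hf⟩ := S.exists_mem_facet x
  exact ⟨⟨{x}, ⟨f, by simpa using hf⟩, rfl⟩, S.rvec x, S.rvec_ne_zero hf, S.cone_singleton x⟩

theorem isOver_fan {K : AbstractSimplicialComplex V}
    (hK : ∀ s : Finset V, s.Nonempty → (s ∈ K.faces ↔ S.IsFace s)) : S.fan.IsOver K := by
  refine ⟨Equiv.ofBijective (fun x => ⟨S.cone {x}, S.cone_singleton_mem_rays x⟩)
    ⟨fun x y h => ?_, ?_⟩, fun s hs => ?_⟩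
  · obtain ⟨f, hf⟩ := S.exists_mem_facet y
    have hle : S.cone {x} ≤ S.cone {y} := (congrArg Subtype.val h).le
    exact Finset.mem_singleton.1 ((S.cone_singleton_le_iff (by simpa using hf) x).1 hle)
  · rintro ⟨_, ⟨s, ⟨f, hs⟩, rfl⟩, v, hv, h⟩
    obtain ⟨x, rfl⟩ := S.exists_eq_singleton_of_cone_eq_hull hs hv h
    exact ⟨x, rfl⟩
  · rw [hK s hs]
    constructor
    · rintro ⟨f, hf⟩
      exact ⟨S.cone s, ⟨s, ⟨f, hf⟩, rfl⟩, fun x => (S.cone_singleton_le_iff hf x).symm⟩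
    · rintro ⟨_, ⟨t, ⟨f, ht⟩, rfl⟩, h⟩
      obtain rfl : s = t := Finset.ext fun x => (h x).trans (S.cone_singleton_le_iff ht x)
      exact ⟨f, ht⟩

end AmpleSystem

/-! ### Smooth complete fans in the plane -/

theorem cyclic_induction {n : ℕ} {P : Fin (n + 1) → Prop} (c : Fin (n + 1)) (base : P c)
    (succ : ∀ l, P l → P (l + 1)) (l : Fin (n + 1)) : P l := by
  have h (d : Fin (n + 1)) : P (c + d) := by
    induction d using Fin.induction with
    | zero => rwa [add_zero]
    | succ d ih =>
      rw [← Fin.coeSucc_eq_succ, ← add_assoc]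
      exact succ _ ih
  simpa using h (l - c)

theorem cyclic_induction_down {n : ℕ} {P : Fin (n + 1) → Prop} (c : Fin (n + 1)) (base : P c)
    (pred : ∀ l, P (l + 1) → P l) (l : Fin (n + 1)) : P l := by
  have h := cyclic_induction (P := fun l => P (-l)) (-c) (by rwa [neg_neg]) (fun l hl => by
    refine pred _ ?_
    rwa [neg_add, neg_add_cancel_right]) (-l)
  rwa [neg_neg] at h

theorem fin_add_one_add_one_ne {n : ℕ} (i : Fin (n + 3)) : i + 1 + 1 ≠ i := by
  rw [add_assoc, ne_eq, add_eq_left, Fin.ext_iff]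
  simp [Fin.val_add, Nat.mod_eq_of_lt (show 2 < n + 3 by omega)]

variable {M : ℕ} {R : Submodule ℝ (Fin (M + 3) → ℝ)}

/-- Two rows in `R` that are dual to the columns `i` and `j`: they give the coordinates of all
columns with respect to these two. -/
structure IsDualPair (R : Submodule ℝ (Fin (M + 3) → ℝ)) (i j : Fin (M + 3))
    (a b : Fin (M + 3) → ℝ) : Prop where
  fst_mem : a ∈ R
  snd_mem : b ∈ R
  fst_left : a i = 1
  fst_right : a j = 0
  snd_left : b i = 0
  snd_right : b j = 1

namespace IsDualPair

variable {i j : Fin (M + 3)} {a b : Fin (M + 3) → ℝ}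

theorem swap (h : IsDualPair R i j a b) : IsDualPair R j i b a :=
  ⟨h.snd_mem, h.fst_mem, h.snd_right, h.snd_left, h.fst_right, h.fst_left⟩

theorem snd_ne_zero (h : IsDualPair R i j a b) : b ≠ 0 := fun hb => by
  simpa [hb] using h.snd_right

theorem exists_of_mem {b : Fin (M + 3) → ℝ} (hR : ∃ a ∈ R, a i = 1) (hb : b ∈ R) (hbi : b i = 0)
    (hbj : b j = 1) : ∃ a, IsDualPair R i j a b := by
  obtain ⟨a, ha, hai⟩ := hR
  exact ⟨a - a j • b, sub_mem ha (R.smul_mem _ hb), hb, by simp [hbi, hai], by simp [hbj], hbi, hbj⟩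

end IsDualPair

/-- The integral coordinates of the ray generators with respect to the consecutive generators
`w_a, w_{a+1}`; no other generator lies in the cone spanned by these two. -/
structure IsEdgeCoords (R : Submodule ℝ (Fin (M + 3) → ℝ)) (a : Fin (M + 3))
    (p q : Fin (M + 3) → ℤ) : Prop extends
    IsDualPair R a (a + 1) (fun l => (p l : ℝ)) (fun l => (q l : ℝ)) where
  not_nonneg : ∀ i, i ≠ a → i ≠ a + 1 → ¬ (0 ≤ p i ∧ 0 ≤ q i)

/-- The space of rows of the matrix with columns the primitive ray generators `w_0, …, w_{m-1}`, in
cyclic order, of a smooth complete fan in the plane: consecutive generators form a lattice basis,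
and span a cone that contains no other generator. -/
structure IsFanRows (R : Submodule ℝ (Fin (M + 3) → ℝ)) : Prop where
  exists_coords : ∀ a, ∃ p q, IsEdgeCoords R a p q
  eq_zero : ∀ r ∈ R, ∀ a, r a = 0 → r (a + 1) = 0 → r = 0

namespace IsFanRows

variable (hR : IsFanRows R)

include hR

theorem apply_eq {a : Fin (M + 3)} {p q : Fin (M + 3) → ℤ} (h : IsEdgeCoords R a p q)
    {r : Fin (M + 3) → ℝ} (hr : r ∈ R) (i : Fin (M + 3)) : r i = r a * p i + r (a + 1) * q i := by
  have hzero := hR.eq_zero (r - r a • (fun l => (p l : ℝ)) - r (a + 1) • (fun l => (q l : ℝ)))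
    (sub_mem (sub_mem hr (R.smul_mem _ h.fst_mem)) (R.smul_mem _ h.snd_mem)) a
    (by simp [h.fst_left, h.snd_left]) (by simp [h.fst_right, h.snd_right])
  have happly := congrFun hzero i
  simp only [Pi.sub_apply, Pi.smul_apply, smul_eq_mul, Pi.zero_apply] at happly
  linarith

theorem snd_apply_eq_neg_one {a : Fin (M + 3)} {p q p' q' : Fin (M + 3) → ℤ}
    (h : IsEdgeCoords R a p q) (h' : IsEdgeCoords R (a + 1) p' q') : q' a = -1 := by
  have hp := hR.apply_eq h' h.fst_mem a
  have hq := hR.apply_eq h' h.snd_mem a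
  simp only [h.fst_left, h.fst_right, zero_mul, zero_add] at hp
  simp only [h.snd_left, h.snd_right, one_mul] at hq
  norm_cast at hp hq
  have hunit := IsUnit.of_mul_eq_one_right _ hp.symm
  refine (Int.isUnit_iff.1 hunit).resolve_left fun hone => ?_
  rw [hone, mul_one] at hp hq
  have ha := h'.not_nonneg a (by simp) (fin_add_one_add_one_ne a).symm
  have ha' := h.not_nonneg (a + 1 + 1) (fin_add_one_add_one_ne a) (by simp)
  omega

theorem det_succ {r s : Fin (M + 3) → ℝ} (hr : r ∈ R) (hs : s ∈ R) (a : Fin (M + 3)) :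
    r a * s (a + 1) - r (a + 1) * s a =
      r (a + 1) * s (a + 1 + 1) - r (a + 1 + 1) * s (a + 1) := by
  obtain ⟨p, q, h⟩ := hR.exists_coords a
  obtain ⟨p', q', h'⟩ := hR.exists_coords (a + 1)
  rw [hR.apply_eq h' hr a, hR.apply_eq h' hs a, hR.snd_apply_eq_neg_one h h']
  push_cast
  ring

theorem det_eq {r s : Fin (M + 3) → ℝ} (hr : r ∈ R) (hs : s ∈ R) (i a : Fin (M + 3)) :
    r a * s (a + 1) - r (a + 1) * s a = r i * s (i + 1) - r (i + 1) * s i :=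
  cyclic_induction (P := fun a => r a * s (a + 1) - r (a + 1) * s a =
    r i * s (i + 1) - r (i + 1) * s i) i rfl (fun l hl => by rw [← hR.det_succ hr hs, hl]) a

theorem exists_row (i : Fin (M + 3)) : ∃ a ∈ R, a i = 1 := by
  obtain ⟨p, q, h⟩ := hR.exists_coords i
  exact ⟨_, h.fst_mem, h.fst_left⟩

theorem exists_row_zero (i : Fin (M + 3)) : ∃ b ∈ R, b i = 0 ∧ b ≠ 0 := by
  obtain ⟨p, q, h⟩ := hR.exists_coords i
  exact ⟨_, h.snd_mem, h.snd_left, h.snd_ne_zero⟩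

theorem succ_ne_zero {b : Fin (M + 3) → ℝ} (hb : b ∈ R) {i : Fin (M + 3)} (hbi : b i = 0)
    (hb0 : b ≠ 0) : b (i + 1) ≠ 0 := fun h => hb0 (hR.eq_zero b hb i hbi h)

section Frame

variable {a b : Fin (M + 3) → ℝ} (ha : a ∈ R) (hb : b ∈ R) {i : Fin (M + 3)} (hai : a i = 1)
  (hbi : b i = 0)

include ha hb hai hbi

theorem det_frame (l : Fin (M + 3)) : a l * b (l + 1) - a (l + 1) * b l = b (i + 1) := by
  rw [hR.det_eq ha hb i l, hai, hbi]
  ring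

/-- The two quotients are the coordinates of `w_i` with respect to `w_l, w_{l+1}`. -/
theorem not_nonneg_frame (hb0 : b (i + 1) ≠ 0) {l : Fin (M + 3)} (hl : i ≠ l) (hl' : i ≠ l + 1) :
    ¬ (0 ≤ b (l + 1) / b (i + 1) ∧ 0 ≤ -b l / b (i + 1)) := by
  obtain ⟨p, q, h⟩ := hR.exists_coords l
  have hai' := hR.apply_eq h ha i
  have hbi' := hR.apply_eq h hb i
  have hdet := hR.det_frame ha hb hai hbi l
  rw [hai] at hai'
  rw [hbi] at hbi'
  have hp : (p i : ℝ) = b (l + 1) / b (i + 1) := by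
    rw [eq_div_iff hb0, ← hdet]
    linear_combination (-b (l + 1)) * hai' + a (l + 1) * hbi'
  have hq : (q i : ℝ) = -b l / b (i + 1) := by
    rw [eq_div_iff hb0, ← hdet]
    linear_combination (b l) * hai' - a l * hbi'
  rw [← hp, ← hq]
  exact_mod_cast h.not_nonneg i hl hl'

/-- A generator on the line of `w_i` other than `w_i` is opposite to it. -/
theorem neg_of_eq_zero (hb0 : b ≠ 0) {l : Fin (M + 3)} (hl : l ≠ i) (hbl : b l = 0) :
    a l < 0 := by
  have hsucc := hR.succ_ne_zero hb hbi hb0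
  obtain ⟨p, q, h⟩ := hR.exists_coords i
  have hq := hR.apply_eq h hb l
  rw [hbi, zero_mul, zero_add, hbl, eq_comm, mul_eq_zero, or_iff_right hsucc] at hq
  have hal := hR.apply_eq h ha l
  rw [hai, hq, mul_zero, add_zero, one_mul] at hal
  have hnot := h.not_nonneg l hl (fun hl' => hsucc (hl' ▸ hbl))
  have hp : p l < 0 := not_le.1 fun hp => hnot ⟨hp, by exact_mod_cast hq.ge⟩
  rw [hal]
  exact_mod_cast hp

/-- If the line of `w_i` carries another generator `w_j`, then no cone of the fan crosses it: else
that cone would contain one of the two opposite vectors `w_i`, `w_j`. -/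
theorem mul_succ_nonneg (hb0 : b ≠ 0) {j : Fin (M + 3)} (hj : j ≠ i) (hbj : b j = 0)
    (l : Fin (M + 3)) : 0 ≤ b l * b (l + 1) := by
  by_contra! hcross
  have hbl : b l ≠ 0 := left_ne_zero_of_mul hcross.ne
  have hbl' : b (l + 1) ≠ 0 := right_ne_zero_of_mul hcross.ne
  have hi0 := hR.succ_ne_zero hb hbi hb0
  have hj0 := hR.succ_ne_zero hb hbj hb0
  have haj := hR.neg_of_eq_zero ha hb hai hbi hb0 hj hbj
  have hnot_i := hR.not_nonneg_frame ha hb hai hbi hi0 (l := l) (fun h => hbl (h ▸ hbi))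
    (fun h => hbl' (h ▸ hbi))
  have hnot_j := hR.not_nonneg_frame (a := (a j)⁻¹ • a) (R.smul_mem _ ha) hb (by simp [haj.ne]) hbj
    hj0 (l := l) (fun h => hbl (h ▸ hbj)) (fun h => hbl' (h ▸ hbj))
  have hopp : b (i + 1) * b (j + 1) < 0 := by
    rw [← hR.det_frame ha hb hai hbi j, hbj, mul_zero, sub_zero, mul_assoc]
    exact mul_neg_of_neg_of_pos haj (mul_self_pos.2 hj0)
  simp only [div_nonneg_iff, neg_nonneg, neg_nonpos] at hnot_i hnot_j
  rcases mul_neg_iff.1 hcross with ⟨hl, hl'⟩ | ⟨hl, hl'⟩ <;>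
    rcases mul_neg_iff.1 hopp with ⟨hi, hj⟩ | ⟨hi, hj⟩
  · exact hnot_j ⟨Or.inr ⟨hl'.le, hj.le⟩, Or.inr ⟨hl.le, hj.le⟩⟩
  · exact hnot_i ⟨Or.inr ⟨hl'.le, hi.le⟩, Or.inr ⟨hl.le, hi.le⟩⟩
  · exact hnot_i ⟨Or.inl ⟨hl'.le, hi.le⟩, Or.inl ⟨hl.le, hi.le⟩⟩
  · exact hnot_j ⟨Or.inl ⟨hl'.le, hj.le⟩, Or.inl ⟨hl.le, hj.le⟩⟩

variable (hD : 0 < b (i + 1))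

include hD

theorem pos_of_succ_pos {l : Fin (M + 3)} (hl : l ≠ i) (h : 0 < b (l + 1)) : 0 < b l := by
  by_contra! hneg
  refine hR.not_nonneg_frame ha hb hai hbi hD.ne' hl.symm (fun hl' => ?_)
    ⟨div_nonneg h.le hD.le, div_nonneg (neg_nonneg.2 hneg) hD.le⟩
  exact h.ne' (hl' ▸ hbi)

theorem succ_neg_of_neg {l : Fin (M + 3)} (hl : l + 1 ≠ i) (h : b l < 0) : b (l + 1) < 0 := by
  by_contra! hnonneg
  refine hR.not_nonneg_frame ha hb hai hbi hD.ne' (fun hl' => ?_) hl.symm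
    ⟨div_nonneg hnonneg hD.le, div_nonneg (neg_nonneg.2 h.le) hD.le⟩
  exact h.ne (hl' ▸ hbi)

theorem pred_neg : b (i - 1) < 0 := by
  have hdet := hR.det_frame ha hb hai hbi (i - 1)
  rw [sub_add_cancel, hbi, hai] at hdet
  linarith

theorem exists_pos_succ_neg (hne : ∀ l, l ≠ i → b l ≠ 0) : ∃ l, 0 < b l ∧ b (l + 1) < 0 := by
  by_contra! hno
  have hpos : ∀ l, 0 < b l := cyclic_induction (i + 1) hD fun l hl => by
    refine lt_of_le_of_ne (hno l hl) (hne _ fun hli => ?_).symm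
    rw [eq_sub_of_add_eq hli] at hl
    exact (hR.pred_neg ha hb hai hbi hD).not_gt hl
  exact (hpos i).ne' hbi

end Frame

section Shear

variable {R' : Submodule ℝ (Fin (M + 3) → ℝ)} (hR' : IsFanRows R') {a a' b : Fin (M + 3) → ℝ}
  (ha : a ∈ R) (hb : b ∈ R) (ha' : a' ∈ R') (hb' : b ∈ R') {i : Fin (M + 3)} (hai : a i = 1)
  (hai' : a' i = 1) (hbi : b i = 0)

include hR' ha hb ha' hb' hai hai' hbi

theorem sub_mul_succ (l : Fin (M + 3)) :
    (a' l - a l) * b (l + 1) = (a' (l + 1) - a (l + 1)) * b l := by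
  linear_combination hR'.det_frame ha' hb' hai' hbi l - hR.det_frame ha hb hai hbi l

theorem eq_of_eq_zero (hb0 : b ≠ 0) {l : Fin (M + 3)} (hl : b l = 0) : a' l = a l := by
  have hprop := hR.sub_mul_succ hR' ha hb ha' hb' hai hai' hbi l
  rw [hl, mul_zero] at hprop
  exact sub_eq_zero.1 ((mul_eq_zero.1 hprop).resolve_right (hR.succ_ne_zero hb hl hb0))

theorem exists_slope_pos (hD : 0 < b (i + 1)) : ∃ x, ∀ l, 0 < b l → a' l - a l = x * b l := by
  refine ⟨(a' (i + 1) - a (i + 1)) / b (i + 1), cyclic_induction (i + 1)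
    (fun _ => (div_mul_cancel₀ _ hD.ne').symm) fun l ih hl => ?_⟩
  by_cases hli : l = i
  · rw [hli]
    exact (div_mul_cancel₀ _ hD.ne').symm
  · have hpos := hR.pos_of_succ_pos ha hb hai hbi hD hli hl
    have hprop := hR.sub_mul_succ hR' ha hb ha' hb' hai hai' hbi l
    rw [ih hpos] at hprop
    exact mul_right_cancel₀ hpos.ne' (by linear_combination -hprop)

theorem exists_slope_neg (hD : 0 < b (i + 1)) : ∃ y, ∀ l, b l < 0 → a' l - a l = y * b l := by
  have hpred := hR.pred_neg ha hb hai hbi hD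
  refine ⟨(a' (i - 1) - a (i - 1)) / b (i - 1), cyclic_induction_down (i - 1)
    (fun _ => (div_mul_cancel₀ _ hpred.ne).symm) fun l ih hl => ?_⟩
  by_cases hli : l + 1 = i
  · rw [eq_sub_of_add_eq hli]
    exact (div_mul_cancel₀ _ hpred.ne).symm
  · have hneg := hR.succ_neg_of_neg ha hb hai hbi hD hli hl
    have hprop := hR.sub_mul_succ hR' ha hb ha' hb' hai hai' hbi l
    rw [ih hneg] at hprop
    exact mul_right_cancel₀ hneg.ne (by linear_combination hprop)

theorem exists_shear_of_pos (hD : 0 < b (i + 1)) :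
    ∃ e d : ℝ, (∀ l, a' l = a l + e * b l + d * |b l|) ∧ ((∀ l, l ≠ i → b l ≠ 0) → d = 0) := by
  obtain ⟨x, hx⟩ := hR.exists_slope_pos hR' ha hb ha' hb' hai hai' hbi hD
  obtain ⟨y, hy⟩ := hR.exists_slope_neg hR' ha hb ha' hb' hai hai' hbi hD
  have hb0 : b ≠ 0 := fun h => by simp [h] at hD
  refine ⟨(x + y) / 2, (x - y) / 2, fun l => ?_, fun hne => ?_⟩
  · rcases lt_trichotomy (b l) 0 with h | h | h
    · rw [abs_of_neg h]
      linear_combination hy l h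
    · rw [h, abs_zero, hR.eq_of_eq_zero hR' ha hb ha' hb' hai hai' hbi hb0 h]
      ring
    · rw [abs_of_pos h]
      linear_combination hx l h
  · obtain ⟨l, hpos, hneg⟩ := hR.exists_pos_succ_neg ha hb hai hbi hD hne
    have hprop := hR.sub_mul_succ hR' ha hb ha' hb' hai hai' hbi l
    rw [hx l hpos, hy _ hneg] at hprop
    have hxy : (x - y) * (b l * b (l + 1)) = 0 := by linear_combination hprop
    rw [(mul_eq_zero.1 hxy).resolve_right (mul_neg_of_pos_of_neg hpos hneg).ne, zero_div]

/-- Two smooth fans with the same projection `b` along a common generator `w_i` differ by shears of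
the two half planes bounded by the line of `w_i`; a cone crossing this line forces the two shears to
agree. -/
theorem exists_shear (hb0 : b ≠ 0) :
    ∃ e d : ℝ, (∀ l, a' l = a l + e * b l + d * |b l|) ∧ ((∀ l, l ≠ i → b l ≠ 0) → d = 0) := by
  rcases (hR.succ_ne_zero hb hbi hb0).lt_or_gt with h | h
  · obtain ⟨e, d, hshear, hd⟩ := hR.exists_shear_of_pos hR' ha (neg_mem hb) ha' (neg_mem hb') hai
      hai' (b := -b) (by simp [hbi]) (by simpa using h)
    refine ⟨-e, d, fun l => ?_, fun hne => hd fun l hl => by simpa using hne l hl⟩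
    rw [hshear l, Pi.neg_apply, abs_neg]
    ring
  · exact hR.exists_shear_of_pos hR' ha hb ha' hb' hai hai' hbi h

end Shear

end IsFanRows

/-! ### Strictly convex functions on a planar fan -/

theorem norm_lt_of_neg {E : Type*} [NormedAddCommGroup E] [NormedSpace ℝ E]
    [StrictConvexSpace ℝ E] {x y : E} (h : LinearIndependent ℝ ![x, y]) {α : ℝ} (hα : α < 0)
    (β : ℝ) : α * ‖x‖ + β * ‖y‖ < ‖α • x + β • y‖ := by
  have hx : x ≠ 0 := h.ne_zero 0
  rcases le_or_gt β 0 with hβ | hβ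
  · exact (add_neg_of_neg_of_nonpos (mul_neg_of_neg_of_pos hα (norm_pos_iff.2 hx))
      (mul_nonpos_of_nonpos_of_nonneg hβ (norm_nonneg y))).trans_le (norm_nonneg _)
  · have hray : ¬ SameRay ℝ (α • x + β • y) (-α • x) := fun hsame => by
      obtain ⟨r, -, hr⟩ := hsame.exists_nonneg_right (smul_ne_zero (neg_ne_zero.2 hα.ne) hx)
      have hzero : (α + r * α) • x + β • y = 0 := by
        rw [add_smul, add_right_comm, hr]
        module
      exact hβ.ne' (LinearIndependent.pair_iff.1 h _ _ hzero).2
    have hlt := norm_add_lt_of_not_sameRay hray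
    rw [show α • x + β • y + -α • x = β • y by module, norm_smul, norm_smul, Real.norm_eq_abs,
      Real.norm_eq_abs, abs_of_pos hβ, abs_neg, abs_of_neg hα] at hlt
    linarith

theorem norm_lt_of_not_nonneg {E : Type*} [NormedAddCommGroup E] [NormedSpace ℝ E]
    [StrictConvexSpace ℝ E] {x y : E} (h : LinearIndependent ℝ ![x, y]) {α β : ℝ}
    (hαβ : ¬ (0 ≤ α ∧ 0 ≤ β)) : α * ‖x‖ + β * ‖y‖ < ‖α • x + β • y‖ := by
  rcases not_and_or.1 hαβ with hα | hβ
  · exact norm_lt_of_neg h (not_le.1 hα) β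
  · rw [add_comm, add_comm (α • x)]
    exact norm_lt_of_neg (LinearIndependent.pair_symm_iff.1 h) (not_le.1 hβ) α

section Wall

variable {M : ℕ} {R : Submodule ℝ (Fin (M + 3) → ℝ)}

/-- The shape of a relation that expresses the generator `w_i` in terms of `w_a` and `w_{a+1}`. -/
structure IsWall (a i : Fin (M + 3)) (f : Fin (M + 3) → ℝ) : Prop where
  ne : i ≠ a
  ne_succ : i ≠ a + 1
  apply_self : f i = 1
  eq_zero : ∀ l, l ≠ a → l ≠ a + 1 → l ≠ i → f l = 0

theorem IsWall.sum_mul {a i : Fin (M + 3)} {f : Fin (M + 3) → ℝ} (hf : IsWall a i f)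
    (s : Fin (M + 3) → ℝ) : ∑ l, s l * f l = s a * f a + s (a + 1) * f (a + 1) + s i := by
  have ha : a ∉ ({a + 1, i} : Finset (Fin (M + 3))) := by simp [hf.ne.symm]
  have ha' : a + 1 ∉ ({i} : Finset (Fin (M + 3))) := by simpa using hf.ne_succ.symm
  rw [← Finset.sum_subset (Finset.subset_univ {a, a + 1, i}), Finset.sum_insert ha,
    Finset.sum_insert ha', Finset.sum_singleton, hf.apply_self, mul_one, add_assoc]
  intro l _ hl
  simp only [Finset.mem_insert, Finset.mem_singleton, not_or] at hl
  rw [hf.eq_zero l hl.1 hl.2.1 hl.2.2, mul_zero]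

/-- The function is the Euclidean norm of the generators, in the coordinates of one cone. -/
theorem IsFanRows.exists_convex (hR : IsFanRows R) : ∃ w : Fin (M + 3) → ℝ,
    ∀ a p q, IsEdgeCoords R a p q → ∀ i, i ≠ a → i ≠ a + 1 →
      p i * w a + q i * w (a + 1) < w i := by
  obtain ⟨x, y, h₀⟩ := hR.exists_coords 0
  let W (l : Fin (M + 3)) : ℂ := ⟨x l, y l⟩
  refine ⟨fun l => ‖W l‖, fun a p q h i hia hia' => ?_⟩
  have hdet : (x a : ℝ) * y (a + 1) - x (a + 1) * y a = 1 := by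
    rw [hR.det_eq h₀.fst_mem h₀.snd_mem 0 a]
    simp only [h₀.fst_left, h₀.fst_right, h₀.snd_left, h₀.snd_right]
    ring
  have hind : LinearIndependent ℝ ![W a, W (a + 1)] := by
    refine LinearIndependent.pair_iff.2 fun s t hst => ?_
    have hre : s * x a + t * x (a + 1) = 0 := by simpa [W] using congrArg Complex.re hst
    have him : s * y a + t * y (a + 1) = 0 := by simpa [W] using congrArg Complex.im hst
    constructor
    · linear_combination y (a + 1) * hre - x (a + 1) * him - s * hdet
    · linear_combination x a * him - y a * hre - t * hdet
  have hWi : (p i : ℝ) • W a + (q i : ℝ) • W (a + 1) = W i := by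
    refine Complex.ext ?_ ?_
    · simpa [W, mul_comm] using (hR.apply_eq h h₀.fst_mem i).symm
    · simpa [W, mul_comm] using (hR.apply_eq h h₀.snd_mem i).symm
  simpa only [hWi] using norm_lt_of_not_nonneg hind
    (show ¬ (0 ≤ (p i : ℝ) ∧ 0 ≤ (q i : ℝ)) by exact_mod_cast h.not_nonneg i hia hia')

theorem IsFanRows.exists_sum_pos (hR : IsFanRows R) : ∃ w : Fin (M + 3) → ℝ,
    ∀ (f : Fin (M + 3) → ℝ) (a i : Fin (M + 3)), IsWall a i f →
      (∀ r ∈ R, ∑ l, r l * f l = 0) → 0 < ∑ l, w l * f l := by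
  obtain ⟨w, hw⟩ := hR.exists_convex
  refine ⟨w, fun f a i hwall hf => ?_⟩
  obtain ⟨p, q, h⟩ := hR.exists_coords a
  have hp := hf _ h.fst_mem
  have hq := hf _ h.snd_mem
  have hlt := hw a p q h i hwall.ne hwall.ne_succ
  rw [hwall.sum_mul] at hp hq ⊢
  simp only [h.fst_left, h.fst_right, h.snd_left, h.snd_right] at hp hq
  linear_combination hlt - w a * hp - w (a + 1) * hq

end Wall

theorem exists_forall_pos_add_mul {Ω : Type*} [Finite Ω] (A H : Ω → ℝ) (hH : ∀ ω, 0 ≤ H ω)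
    (hA : ∀ ω, H ω = 0 → 0 < A ω) : ∃ N : ℝ, ∀ ω, 0 < A ω + N * H ω := by
  cases nonempty_fintype Ω
  refine ⟨∑ ω, |A ω| / H ω + 1, fun ω => ?_⟩
  rcases (hH ω).eq_or_lt with h | h
  · rw [← h, mul_zero, add_zero]
    exact hA ω h.symm
  · have hle : |A ω| / H ω ≤ ∑ ω, |A ω| / H ω :=
      Finset.single_le_sum (f := fun ω => |A ω| / H ω)
        (fun ω _ => div_nonneg (abs_nonneg _) (hH ω)) (Finset.mem_univ ω)
    rw [div_le_iff₀ h] at hle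
    linarith [neg_abs_le (A ω)]

/-! ### Compatible families of planar fans -/

/-- A family of smooth planar fans indexed by the transversals `k` of a family of sets `κ i`, such
that changing `k` at `i` does not change the projection along the `i`-th ray. -/
structure FanFamily {M : ℕ} (κ : Fin (M + 3) → Type*) where
  rows : (∀ i, κ i) → Submodule ℝ (Fin (M + 3) → ℝ)
  isFanRows : ∀ k, IsFanRows (rows k)
  mem_update : ∀ k i y, ∀ r ∈ rows k, r i = 0 → r ∈ rows (Function.update k i y)

namespace FanFamily

variable {M : ℕ} {κ : Fin (M + 3) → Type*} (Φ : FanFamily κ)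

/-- A relation restricts, on every transversal, to a linear relation between the ray generators. -/
def IsRelation (ρ : (Σ i, κ i) → ℝ) : Prop :=
  ∀ k, ∀ r ∈ Φ.rows k, ∑ l, r l * ρ ⟨l, k l⟩ = 0

/-- All relations agree on the copies of the vertex `i`. -/
def IsTrivialAt (i : Fin (M + 3)) : Prop :=
  ∀ ρ, Φ.IsRelation ρ → ∀ y y' : κ i, ρ ⟨i, y⟩ = ρ ⟨i, y'⟩

variable {Φ}

theorem sum_mul_update (r : Fin (M + 3) → ℝ) (ρ : (Σ i, κ i) → ℝ) (k : ∀ i, κ i)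
    (i : Fin (M + 3)) (y : κ i) : ∑ l, r l * ρ ⟨l, Function.update k i y l⟩ =
      ∑ l, r l * ρ ⟨l, k l⟩ + r i * (ρ ⟨i, y⟩ - ρ ⟨i, k i⟩) := by
  rw [← sub_eq_iff_eq_add', ← Finset.sum_sub_distrib, Finset.sum_eq_single i]
  · rw [Function.update_self, mul_sub]
  · intro l _ hl
    rw [Function.update_of_ne hl, sub_self]
  · simp

theorem exists_shear {k : ∀ i, κ i} {i : Fin (M + 3)} {y : κ i} {a a' b : Fin (M + 3) → ℝ}
    (ha : a ∈ Φ.rows k) (hb : b ∈ Φ.rows k) (ha' : a' ∈ Φ.rows (Function.update k i y))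
    (hai : a i = 1) (hai' : a' i = 1) (hbi : b i = 0) (hb0 : b ≠ 0) :
    ∃ e d : ℝ, (∀ l, a' l = a l + e * b l + d * |b l|) ∧ ((∀ l, l ≠ i → b l ≠ 0) → d = 0) ∧
      ∀ ρ, Φ.IsRelation ρ → ρ ⟨i, y⟩ - ρ ⟨i, k i⟩ = -d * ∑ l, |b l| * ρ ⟨l, k l⟩ := by
  obtain ⟨e, d, hshear, hd⟩ := (Φ.isFanRows k).exists_shear (Φ.isFanRows _) ha hb ha'
    (Φ.mem_update k i y b hb hbi) hai hai' hbi hb0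
  refine ⟨e, d, hshear, hd, fun ρ hρ => ?_⟩
  have hsum : ∑ l, a' l * ρ ⟨l, k l⟩ = ∑ l, a l * ρ ⟨l, k l⟩ + e * ∑ l, b l * ρ ⟨l, k l⟩ +
      d * ∑ l, |b l| * ρ ⟨l, k l⟩ := by
    simp only [hshear, Finset.mul_sum, ← Finset.sum_add_distrib]
    exact Finset.sum_congr rfl fun l _ => by ring
  have hupdate := hρ _ a' ha'
  rw [sum_mul_update, hai', hsum, hρ k a ha, hρ k b hb] at hupdate
  linear_combination hupdate

theorem exists_relation_ne {i : Fin (M + 3)} (h : ¬ Φ.IsTrivialAt i) (z : κ i) :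
    ∃ ρ, Φ.IsRelation ρ ∧ ∃ y, ρ ⟨i, y⟩ ≠ ρ ⟨i, z⟩ := by
  unfold IsTrivialAt at h
  push Not at h
  obtain ⟨ρ, hρ, y, y', hne⟩ := h
  refine ⟨ρ, hρ, ?_⟩
  by_contra! hall
  exact hne ((hall y).trans (hall y').symm)

theorem exists_ne_of_not_isTrivialAt {j : Fin (M + 3)} (hj : ¬ Φ.IsTrivialAt j) {k : ∀ i, κ i}
    {b : Fin (M + 3) → ℝ} (hb : b ∈ Φ.rows k) (hbj : b j = 0) (hb0 : b ≠ 0) :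
    ∃ j', j' ≠ j ∧ b j' = 0 := by
  by_contra! hne
  obtain ⟨ρ, hρ, y, hy⟩ := exists_relation_ne hj (k j)
  obtain ⟨r, hr, hrj⟩ := (Φ.isFanRows k).exists_row j
  obtain ⟨r', hr', hrj'⟩ := (Φ.isFanRows (Function.update k j y)).exists_row j
  obtain ⟨_, d, -, hd, h⟩ := exists_shear hr hb hr' hrj hrj' hbj hb0
  refine hy (sub_eq_zero.1 ?_)
  rw [h ρ hρ, hd hne, neg_zero, zero_mul]

/-- A nontrivial vertex `i` lies on a line with an opposite generator `w_l`, and the fans `k` and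
`Function.update k i y` differ by a shear of a half plane bounded by this line. -/
theorem exists_half_shear {k : ∀ i, κ i} {i j : Fin (M + 3)} {y : κ i}
    {a a' b b' : Fin (M + 3) → ℝ} (h : IsDualPair (Φ.rows k) i j a b)
    (h' : IsDualPair (Φ.rows (Function.update k i y)) i j a' b') {ρ : (Σ i, κ i) → ℝ}
    (hρ : Φ.IsRelation ρ) (hne : ρ ⟨i, y⟩ ≠ ρ ⟨i, k i⟩) :
    ∃ d ≠ 0, (∀ l, a' l = a l + d * (|b l| - b l)) ∧ ∃ l, b l = 0 ∧ a l < 0 := by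
  obtain ⟨e, d, hshear, hd, hsum⟩ := exists_shear h.fst_mem h.snd_mem h'.fst_mem h.fst_left
    h'.fst_left h.snd_left h.snd_ne_zero
  have hd0 : d ≠ 0 := by
    rintro rfl
    exact hne (sub_eq_zero.1 (by rw [hsum ρ hρ, neg_zero, zero_mul]))
  have he : e = -d := by
    have hj := hshear j
    rw [h.fst_right, h'.fst_right, h.snd_right, abs_one] at hj
    linarith
  refine ⟨d, hd0, fun l => ?_, ?_⟩
  · rw [hshear, he]
    ring
  · obtain ⟨l, hl, hbl⟩ : ∃ l, l ≠ i ∧ b l = 0 := by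
      by_contra! hall
      exact hd0 (hd hall)
    exact ⟨l, hbl, (Φ.isFanRows k).neg_of_eq_zero h.fst_mem h.snd_mem h.fst_left h.snd_left
      h.snd_ne_zero hl hbl⟩

/-- Half shears along two different lines do not commute. -/
theorem false_of_half_shears {L : Type*} {a a' b b' : L → ℝ} {d₁ d₂ d₃ : ℝ} (hd₁ : d₁ ≠ 0)
    (hd₂ : d₂ ≠ 0) (hd₃ : d₃ ≠ 0) (h₁ : ∀ l, a' l = a l + d₁ * (|b l| - b l))
    (h₂ : ∀ l, b' l = b l + d₂ * (|a l| - a l)) (h₃ : ∀ l, b' l = b l + d₃ * (|a' l| - a' l))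
    (ha : ∃ l, a l = 0 ∧ b l < 0) (ha' : ∃ l, a' l = 0 ∧ b l < 0) : False := by
  have hnonneg {d : ℝ} (hd : d ≠ 0) {x y : ℝ} (h : y = y + d * (|x| - x)) : 0 ≤ x :=
    abs_eq_self.1 (sub_eq_zero.1 ((mul_eq_zero.1 (left_eq_add.1 h)).resolve_left hd))
  have hd₁_pos : 0 < d₁ := by
    obtain ⟨l, hal, hbl⟩ := ha
    have hbl' : b' l = b l := by rw [h₂, hal, abs_zero, sub_zero, mul_zero, add_zero]
    have hal' : 0 ≤ a' l := hnonneg hd₃ (hbl' ▸ h₃ l)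
    rw [h₁, hal, zero_add, abs_of_neg hbl] at hal'
    exact (nonneg_of_mul_nonneg_left hal' (by linarith)).lt_of_ne' hd₁
  obtain ⟨l, hal', hbl⟩ := ha'
  have hbl' : b' l = b l := by rw [h₃, hal', abs_zero, sub_zero, mul_zero, add_zero]
  have hal : 0 ≤ a l := hnonneg hd₂ (hbl' ▸ h₂ l)
  have hshear := h₁ l
  rw [hal', abs_of_neg hbl] at hshear
  have hpos : 0 < d₁ * (-b l - b l) := mul_pos hd₁_pos (by linarith)
  linarith

/-- Two vertices that are not on a common line through the origin are not both nontrivial. -/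
theorem isTrivialAt_of_ne_zero {k : ∀ i, κ i} {i j : Fin (M + 3)} (hi : ¬ Φ.IsTrivialAt i)
    {b : Fin (M + 3) → ℝ} (hb : b ∈ Φ.rows k) (hbi : b i = 0) (hbj : b j ≠ 0) :
    Φ.IsTrivialAt j := by
  by_contra hj
  wlog hb1 : b j = 1 generalizing b
  · exact this (b := (b j)⁻¹ • b) (Submodule.smul_mem _ _ hb) (by simp [hbi]) (by simp [hbj])
      (by simp [hbj])
  have hij : i ≠ j := fun h => hbj (h ▸ hbi)
  obtain ⟨ρ, hρ, y, hy⟩ := exists_relation_ne hi (k i)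
  obtain ⟨ρ', hρ', y', hy'⟩ := exists_relation_ne hj (k j)
  obtain ⟨a, hab⟩ := IsDualPair.exists_of_mem ((Φ.isFanRows k).exists_row i) hb hbi hb1
  obtain ⟨a', ha'b⟩ := IsDualPair.exists_of_mem ((Φ.isFanRows _).exists_row i)
    (Φ.mem_update k i y b hb hbi) hbi hb1
  obtain ⟨b', hb'a⟩ := IsDualPair.exists_of_mem ((Φ.isFanRows _).exists_row j)
    (Φ.mem_update k j y' a hab.fst_mem hab.fst_right) hab.fst_right hab.fst_left
  have hb'a' : IsDualPair (Φ.rows (Function.update (Function.update k i y) j y')) j i b' a' := by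
    refine ⟨?_, Φ.mem_update _ j y' a' ha'b.fst_mem ha'b.fst_right, hb'a.fst_left, hb'a.fst_right,
      ha'b.fst_right, ha'b.fst_left⟩
    rw [Function.update_comm hij]
    exact Φ.mem_update _ i y b' hb'a.fst_mem hb'a.fst_right
  obtain ⟨d₁, hd₁, h₁, -⟩ := exists_half_shear hab ha'b hρ hy
  obtain ⟨d₂, hd₂, h₂, hneg⟩ := exists_half_shear hab.swap hb'a hρ' hy'
  obtain ⟨d₃, hd₃, h₃, hneg'⟩ := exists_half_shear ha'b.swap hb'a' hρ'
    (by rwa [Function.update_of_ne hij.symm])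
  exact false_of_half_shears hd₁ hd₂ hd₃ h₁ h₂ h₃ hneg hneg'

variable (Φ) in
/-- A relation whose restriction to the transversal `k` is the relation of a wall. -/
def IsWallRelation (ρ : (Σ i, κ i) → ℝ) (k : ∀ i, κ i) : Prop :=
  Φ.IsRelation ρ ∧ ∃ a i, IsWall a i fun l => ρ ⟨l, k l⟩

section Opposite

variable {k₀ k : ∀ i, κ i} {ρ : (Σ i, κ i) → ℝ} {j : Fin (M + 3)} (hj : ¬ Φ.IsTrivialAt j)
  {b : Fin (M + 3) → ℝ} (hb : b ∈ Φ.rows k₀) (hbj : b j = 0)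

include hj hb hbj

theorem apply_eq_of_ne_zero (hρ : Φ.IsRelation ρ) {l : Fin (M + 3)} (hbl : b l ≠ 0) :
    ρ ⟨l, k₀ l⟩ = ρ ⟨l, k l⟩ :=
  isTrivialAt_of_ne_zero hj hb hbj hbl ρ hρ _ _

/-- No cone crosses the line of `w_j`, so `|b|` is linear on each cone. -/
theorem sum_abs_mul_nonneg (hρ : Φ.IsWallRelation ρ k) (hb0 : b ≠ 0) :
    0 ≤ ∑ l, |b l| * ρ ⟨l, k₀ l⟩ := by
  obtain ⟨hρ, a, i, hwall⟩ := hρ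
  have hsum (s : Fin (M + 3) → ℝ) (hs : ∀ l, b l = 0 → s l = 0) :
      ∑ l, s l * ρ ⟨l, k₀ l⟩ = s a * ρ ⟨a, k a⟩ + s (a + 1) * ρ ⟨a + 1, k (a + 1)⟩ + s i := by
    rw [← hwall.sum_mul s]
    refine Finset.sum_congr rfl fun l _ => ?_
    by_cases hbl : b l = 0
    · rw [hs l hbl, zero_mul, zero_mul]
    · rw [apply_eq_of_ne_zero (k := k) hj hb hbj hρ hbl]
  obtain ⟨j', hjj', hbj'⟩ := exists_ne_of_not_isTrivialAt hj hb hbj hb0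
  obtain ⟨r, hr, hrj⟩ := (Φ.isFanRows k₀).exists_row j
  have hsame := (Φ.isFanRows k₀).mul_succ_nonneg hr hb hrj hbj hb0 hjj' hbj' a
  have hlin := hρ k₀ b hb
  rw [hsum b fun _ h => h] at hlin
  rw [hsum (fun l => |b l|) fun l h => by rw [h, abs_zero]]
  rcases mul_nonneg_iff.1 hsame with ⟨ha, ha'⟩ | ⟨ha, ha'⟩
  · rw [abs_of_nonneg ha, abs_of_nonneg ha']
    linarith [le_abs_self (b i)]
  · rw [abs_of_nonpos ha, abs_of_nonpos ha']
    linarith [neg_abs_le (b i)]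

theorem apply_eq_of_sum_abs_mul_eq_zero (hρ : Φ.IsRelation ρ) (hb0 : b ≠ 0)
    (h0 : ∑ l, |b l| * ρ ⟨l, k₀ l⟩ = 0) (l : Fin (M + 3)) : ρ ⟨l, k₀ l⟩ = ρ ⟨l, k l⟩ := by
  by_cases hbl : b l = 0
  · obtain ⟨r, hr, hrl⟩ := (Φ.isFanRows k₀).exists_row l
    obtain ⟨r', hr', hrl'⟩ := (Φ.isFanRows (Function.update k₀ l (k l))).exists_row l
    obtain ⟨_, _, -, -, hdiff⟩ := exists_shear hr hb hr' hrl hrl' hbl hb0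
    exact (sub_eq_zero.1 (by rw [hdiff ρ hρ, h0, mul_zero])).symm
  · exact apply_eq_of_ne_zero hj hb hbj hρ hbl

end Opposite

/-- A common strictly convex function for all the fans of the family: a strictly convex function
for one of them, plus a large multiple of the distance to the line carrying the nontrivial
vertices. -/
theorem exists_support {Ω : Type*} [Finite Ω] (ρ : Ω → (Σ i, κ i) → ℝ) (k : Ω → ∀ i, κ i)
    (hρ : ∀ ω, Φ.IsWallRelation (ρ ω) (k ω)) (k₀ : ∀ i, κ i) :
    ∃ C : Fin (M + 3) → ℝ, ∀ ω, 0 < ∑ l, C l * ρ ω ⟨l, k₀ l⟩ := by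
  obtain ⟨w, hw⟩ := (Φ.isFanRows k₀).exists_sum_pos
  have hconst (ω) (h : ∀ l, ρ ω ⟨l, k₀ l⟩ = ρ ω ⟨l, k ω l⟩) : 0 < ∑ l, w l * ρ ω ⟨l, k₀ l⟩ := by
    obtain ⟨hrel, a, i, hwall⟩ := hρ ω
    exact hw (fun l => ρ ω ⟨l, k₀ l⟩) a i (by simpa only [h] using hwall) (hrel k₀)
  by_cases hall : ∀ j, Φ.IsTrivialAt j
  · exact ⟨w, fun ω => hconst ω fun l => hall l _ (hρ ω).1 _ _⟩
  push Not at hall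
  obtain ⟨j, hj⟩ := hall
  obtain ⟨b, hb, hbj, hb0⟩ := (Φ.isFanRows k₀).exists_row_zero j
  obtain ⟨N, hN⟩ := exists_forall_pos_add_mul (fun ω => ∑ l, w l * ρ ω ⟨l, k₀ l⟩)
    (fun ω => ∑ l, |b l| * ρ ω ⟨l, k₀ l⟩) (fun ω => sum_abs_mul_nonneg hj hb hbj (hρ ω) hb0)
    fun ω hω => hconst ω (apply_eq_of_sum_abs_mul_eq_zero hj hb hbj (hρ ω).1 hb0 hω)
  refine ⟨fun l => w l + N * |b l|, fun ω => (hN ω).trans_eq ?_⟩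
  rw [Finset.mul_sum, ← Finset.sum_add_distrib]
  exact Finset.sum_congr rfl fun l _ => by ring

end FanFamily

/-! ### Iterated wedges of polygons -/

theorem exists_int_forall_sum_pos {Ω V : Type*} [Finite Ω] [Fintype V] (ρ : Ω → V → ℝ)
    (c : V → ℝ) (hc : ∀ ω, 0 < ∑ y, c y * ρ ω y) :
    ∃ c' : V → ℤ, ∀ ω, 0 < ∑ y, (c' y : ℝ) * ρ ω y := by
  obtain ⟨N, hN⟩ := exists_forall_pos_add_mul (fun ω => -∑ y, |ρ ω y|) (fun ω => ∑ y, c y * ρ ω y)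
    (fun ω => (hc ω).le) (fun ω h => absurd h (hc ω).ne')
  refine ⟨fun y => round (N * c y), fun ω => (hN ω).trans_le ?_⟩
  rw [Finset.mul_sum, ← Finset.sum_neg_distrib, ← Finset.sum_add_distrib]
  refine Finset.sum_le_sum fun y _ => ?_
  have hround : |(N * c y - round (N * c y)) * ρ ω y| ≤ 1 * |ρ ω y| := by
    rw [abs_mul]
    exact mul_le_mul_of_nonneg_right ((abs_sub_round _).trans (by norm_num)) (abs_nonneg _)
  linarith [le_abs_self ((N * c y - round (N * c y)) * ρ ω y)]

theorem mem_polygon_iff {M : ℕ} {t : Finset (Fin (M + 3))} (ht : t.Nonempty) :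
    t ∈ (polygon (M + 3)).faces ↔ ∃ a, t ⊆ {a, a + 1} := by
  change t.Nonempty ∧ (∃ i, t ⊆ {i, finRotate (M + 3) i}) ↔ _
  simp only [finRotate_apply, ht, true_and]

theorem exists_edge_avoiding {M : ℕ} (a i : Fin (M + 3)) :
    ∃ b, i ≠ b ∧ i ≠ b + 1 ∧ ∀ j, j ≠ i → j = a ∨ j = a + 1 → j = b ∨ j = b + 1 := by
  by_cases hia : i = a
  · refine ⟨i + 1, by simp, (fin_add_one_add_one_ne i).symm, fun j hj hja => Or.inl ?_⟩
    rw [hia] at hj ⊢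
    exact hja.resolve_left hj
  by_cases hia' : i = a + 1
  · have hne := fin_add_one_add_one_ne (a - 1)
    rw [sub_add_cancel] at hne
    refine ⟨a - 1, by rwa [hia'], by simpa using hia, fun j hj hja => Or.inr ?_⟩
    rw [sub_add_cancel]
    exact hja.resolve_right (hia' ▸ hj)
  · exact ⟨a, hia, hia', fun j _ hja => hja⟩

section Facets

variable {M : ℕ} {κ : Fin (M + 3) → Type*} [∀ i, Fintype (κ i)] [∀ i, DecidableEq (κ i)]

/-- The facet of the iterated wedge of the polygon that belongs to the edge `{a, a + 1}` and the
transversal `k`, where `f = (a, k)`: all the copies of the two ends of the edge, and all copies but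
`k i` of every other vertex `i`. -/
def wedgeFacet (f : Fin (M + 3) × ∀ i, κ i) : Finset (Σ i, κ i) :=
  {x | x.1 = f.1 ∨ x.1 = f.1 + 1 ∨ x.2 ≠ f.2 x.1}

variable {f : Fin (M + 3) × ∀ i, κ i} {x : Σ i, κ i}

theorem mem_wedgeFacet : x ∈ wedgeFacet f ↔ x.1 = f.1 ∨ x.1 = f.1 + 1 ∨ x.2 ≠ f.2 x.1 :=
  Finset.mem_filter_univ x

theorem notMem_wedgeFacet :
    x ∉ wedgeFacet f ↔ x.1 ≠ f.1 ∧ x.1 ≠ f.1 + 1 ∧ x = ⟨x.1, f.2 x.1⟩ := by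
  rw [mem_wedgeFacet]
  push Not
  refine and_congr_right fun _ => and_congr_right fun _ => ⟨fun h => ?_, fun h => ?_⟩
  · rw [← h]
  · obtain ⟨i, l⟩ := x
    simpa using h

theorem exists_adj_wedgeFacet (f : Fin (M + 3) × ∀ i, κ i) (x : Σ i, κ i) :
    ∃ g, wedgeFacet f \ {x} ⊆ wedgeFacet g ∧ x ∉ wedgeFacet g := by
  obtain ⟨⟨a, k⟩, i, l⟩ := f, x
  obtain ⟨b, hb, hb', hedge⟩ := exists_edge_avoiding a i
  refine ⟨(b, Function.update k i l), ?_, by simp [mem_wedgeFacet, hb, hb']⟩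
  rintro ⟨j, y⟩ hy
  simp only [Finset.mem_sdiff, mem_wedgeFacet, Finset.mem_singleton] at hy ⊢
  obtain ⟨hmem, hne⟩ := hy
  by_cases hj : j = i
  · subst hj
    rw [Function.update_self]
    exact Or.inr (Or.inr fun h => hne (by rw [h]))
  · rw [Function.update_of_ne hj]
    have := hedge j hj
    tauto

theorem exists_mem_wedgeFacet [∀ i, Nonempty (κ i)] (x : Σ i, κ i) : ∃ f, x ∈ wedgeFacet f :=
  ⟨(x.1, fun _ => Classical.arbitrary _), mem_wedgeFacet.2 (Or.inl rfl)⟩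

theorem subset_wedgeFacet_of_forall {s : Finset (Σ i, κ i)} {a : Fin (M + 3)} {k : ∀ i, κ i}
    (hk : ∀ i, i = a ∨ i = a + 1 ∨ ⟨i, k i⟩ ∉ s) : s ⊆ wedgeFacet (a, k) := by
  rintro ⟨i, l⟩ hl
  refine mem_wedgeFacet.2 ((hk i).imp_right (Or.imp_right ?_))
  intro (hki : ⟨i, k i⟩ ∉ s) (hlk : l = k i)
  exact hki (hlk ▸ hl)

theorem mem_multiWedge_polygon_iff {J : Fin (M + 3) → ℕ+} {s : Finset (Σ i, Fin (J i))}
    (hs : s.Nonempty) :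
    s ∈ (multiWedge (polygon (M + 3)) J).faces ↔ ∃ f, s ⊆ wedgeFacet f := by
  constructor
  · rintro ⟨-, hfull⟩
    let T : Finset (Fin (M + 3)) := {i | ∀ l, ⟨i, l⟩ ∈ s}
    have hT (i) : i ∈ T ↔ ∀ l, ⟨i, l⟩ ∈ s := Finset.mem_filter_univ i
    obtain ⟨a, ha⟩ : ∃ a, T ⊆ {a, a + 1} := by
      rcases T.eq_empty_or_nonempty with hempty | hne
      · exact ⟨0, by simp [hempty]⟩
      · exact (mem_polygon_iff hne).1 (hfull T hne fun w hw => (hT w.1).1 hw w.2)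
    have hk (i) : ∃ l : Fin (J i), i = a ∨ i = a + 1 ∨ ⟨i, l⟩ ∉ s := by
      by_cases hi : i ∈ T
      · refine ⟨⟨0, (J i).pos⟩, ?_⟩
        have hia := ha hi
        simp only [Finset.mem_insert, Finset.mem_singleton] at hia
        tauto
      · rw [hT, not_forall] at hi
        exact hi.imp fun l hl => Or.inr (Or.inr hl)
    choose k hk using hk
    exact ⟨(a, k), subset_wedgeFacet_of_forall hk⟩
  · rintro ⟨⟨a, k⟩, hsub⟩
    refine ⟨hs, fun t ht hts => (mem_polygon_iff ht).2 ⟨a, fun i hi => ?_⟩⟩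
    simpa using mem_wedgeFacet.1 (hsub (hts ⟨i, k i⟩ hi))

end Facets

namespace UnimodularSystem

section FacetRelation

variable {n : ℕ} {V ι : Type*} [DecidableEq V] (S : UnimodularSystem n V ι)

/-- The coefficients of the linear relation that expresses the vector `x` in the basis `facet f`. -/
def facetRelation (f : ι) (x y : V) : ℝ :=
  (if y = x then 1 else 0) - if y ∈ S.facet f then pairing (S.dual f y) (S.rvec x) else 0

theorem sum_facetRelation_smul [Fintype V] (f : ι) (x : V) :
    ∑ y, S.facetRelation f x y • S.rvec y = 0 := by
  simp only [facetRelation, sub_smul, Finset.sum_sub_distrib, ite_smul, one_smul, zero_smul,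
    Finset.sum_ite_eq', Finset.mem_univ, if_true, Finset.sum_ite_mem, Finset.univ_inter]
  rw [S.sum_dual_rvec, sub_self]

theorem facetRelation_of_mem {f : ι} {x : V} (hx : x ∈ S.facet f) (y : V) :
    S.facetRelation f x y = 0 := by
  rw [facetRelation, sub_eq_zero]
  split_ifs with hyx hy hy
  · rw [S.pairing_dual_rvec hy hx, if_pos hyx]
  · exact absurd (hyx ▸ hx) hy
  · rw [S.pairing_dual_rvec hy hx, if_neg hyx]
  · rfl

/-- The character that takes the values `-c y` at the vectors of `facet f`: the Cartier data, at
the maximal cone `f`, of the divisor with coefficients `c`. -/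
def cartierOfCoeff (c : V → ℤ) (f : ι) : Fin n → ℤ := -∑ y ∈ S.facet f, c y • S.dual f y

theorem pairing_cartierOfCoeff_add [Fintype V] (c : V → ℤ) (f : ι) (x : V) :
    pairing (S.cartierOfCoeff c f) (S.rvec x) + c x = ∑ y, c y * S.facetRelation f x y := by
  rw [cartierOfCoeff, pairing_neg_left, pairing_sum_left]
  simp only [facetRelation, mul_sub, Finset.sum_sub_distrib, mul_ite, mul_one, mul_zero,
    Finset.sum_ite_eq', Finset.mem_univ, if_true, Finset.sum_ite_mem, Finset.univ_inter,
    pairing_smul_left]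
  ring

end FacetRelation

variable {n M : ℕ} {κ : Fin (M + 3) → Type*} [∀ i, DecidableEq (κ i)]
  (S : UnimodularSystem n (Σ i, κ i) (Fin (M + 3) × ∀ i, κ i))

/-- The linear forms that vanish on the vectors off the transversal `k`, evaluated on the vectors
of the transversal: the rows of the fan obtained by projecting along the vectors off `k`. -/
def transversalRows (k : ∀ i, κ i) : Submodule ℝ (Fin (M + 3) → ℝ) where
  carrier := {r | ∃ l : (Fin n → ℝ) →ₗ[ℝ] ℝ, ∀ x : Σ i, κ i,
    l (S.rvec x) = if x.2 = k x.1 then r x.1 else 0}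
  zero_mem' := ⟨0, fun x => by simp⟩
  add_mem' := by
    rintro r r' ⟨l, hl⟩ ⟨l', hl'⟩
    refine ⟨l + l', fun x => ?_⟩
    rw [LinearMap.add_apply, hl, hl']
    split_ifs <;> simp
  smul_mem' := by
    rintro c r ⟨l, hl⟩
    refine ⟨c • l, fun x => ?_⟩
    rw [LinearMap.smul_apply, hl]
    split_ifs <;> simp

theorem mem_transversalRows_update {k : ∀ i, κ i} {i : Fin (M + 3)} {r : Fin (M + 3) → ℝ}
    (hr : r ∈ S.transversalRows k) (hri : r i = 0) (y : κ i) :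
    r ∈ S.transversalRows (Function.update k i y) := by
  obtain ⟨l, hl⟩ := hr
  refine ⟨l, fun ⟨j, z⟩ => ?_⟩
  rw [hl]
  by_cases hj : j = i
  · subst hj
    simp [hri]
  · simp [hj]

/-- The coefficients of the vectors of the transversal `f.2` at the vector `⟨i, f.2 i⟩` of the
facet `f`. -/
def transversalCoord (f : Fin (M + 3) × ∀ i, κ i) (i j : Fin (M + 3)) : ℤ :=
  ∑ t, S.dual f ⟨i, f.2 i⟩ t * S.vec ⟨j, f.2 j⟩ t

theorem transversalCoord_eq (f : Fin (M + 3) × ∀ i, κ i) (i j : Fin (M + 3)) :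
    (S.transversalCoord f i j : ℝ) = pairing (S.dual f ⟨i, f.2 i⟩) (S.rvec ⟨j, f.2 j⟩) :=
  (pairing_toReal _ _).symm

variable [∀ i, Fintype (κ i)]

/-- The facets are those of the iterated wedge of a polygon, and no other vector of the system lies
in the cone of a facet after projection along the copies off the transversal. -/
structure IsWedge : Prop where
  facet_eq : ∀ f, S.facet f = wedgeFacet f
  not_nonneg : ∀ f, ∀ x ∉ wedgeFacet f, ¬ (0 ≤ pairing (S.dual f ⟨f.1, f.2 f.1⟩) (S.rvec x) ∧
    0 ≤ pairing (S.dual f ⟨f.1 + 1, f.2 (f.1 + 1)⟩) (S.rvec x))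

namespace IsWedge

variable {S} (hS : S.IsWedge)

include hS

theorem mem_facet_iff {f : Fin (M + 3) × ∀ i, κ i} {x : Σ i, κ i} :
    x ∈ S.facet f ↔ x.1 = f.1 ∨ x.1 = f.1 + 1 ∨ x.2 ≠ f.2 x.1 := by
  rw [hS.facet_eq, mem_wedgeFacet]

theorem transversalCoord_mem {f : Fin (M + 3) × ∀ i, κ i} {i : Fin (M + 3)}
    (hi : i = f.1 ∨ i = f.1 + 1) :
    (fun j => (S.transversalCoord f i j : ℝ)) ∈ S.transversalRows f.2 := by
  refine ⟨(pairingCLM (S.dual f ⟨i, f.2 i⟩)).toLinearMap, fun ⟨j, y⟩ => ?_⟩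
  change pairing _ _ = ite (y = f.2 j) _ _
  split_ifs with hy
  · rw [hy]
    exact (S.transversalCoord_eq f i j).symm
  · rw [S.pairing_dual_rvec (hS.mem_facet_iff.2 (by tauto))
      (hS.mem_facet_iff.2 (Or.inr (Or.inr hy))), if_neg]
    rintro ⟨⟩
    exact hy rfl

theorem transversalCoord_apply {f : Fin (M + 3) × ∀ i, κ i} {i j : Fin (M + 3)}
    (hi : i = f.1 ∨ i = f.1 + 1) (hj : j = f.1 ∨ j = f.1 + 1) :
    (S.transversalCoord f i j : ℝ) = if i = j then 1 else 0 := by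
  rw [transversalCoord_eq, S.pairing_dual_rvec (hS.mem_facet_iff.2 (by tauto))
    (hS.mem_facet_iff.2 (by tauto))]
  refine if_congr ⟨congrArg Sigma.fst, ?_⟩ rfl rfl
  rintro rfl
  rfl

theorem isEdgeCoords_transversalCoord (f : Fin (M + 3) × ∀ i, κ i) :
    IsEdgeCoords (S.transversalRows f.2) f.1 (S.transversalCoord f f.1)
      (S.transversalCoord f (f.1 + 1)) where
  fst_mem := hS.transversalCoord_mem (Or.inl rfl)
  snd_mem := hS.transversalCoord_mem (Or.inr rfl)
  fst_left := (hS.transversalCoord_apply (Or.inl rfl) (Or.inl rfl)).trans (if_pos rfl)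
  fst_right := (hS.transversalCoord_apply (Or.inl rfl) (Or.inr rfl)).trans (if_neg (by simp))
  snd_left := (hS.transversalCoord_apply (Or.inr rfl) (Or.inl rfl)).trans (if_neg (by simp))
  snd_right := (hS.transversalCoord_apply (Or.inr rfl) (Or.inr rfl)).trans (if_pos rfl)
  not_nonneg i hi hi' h := by
    refine hS.not_nonneg f ⟨i, f.2 i⟩ (notMem_wedgeFacet.2 ⟨hi, hi', rfl⟩) ⟨?_, ?_⟩
    · rw [← transversalCoord_eq]
      exact_mod_cast h.1
    · rw [← transversalCoord_eq]
      exact_mod_cast h.2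

theorem eq_zero_of_mem_transversalRows {k : ∀ i, κ i} {r : Fin (M + 3) → ℝ}
    (hr : r ∈ S.transversalRows k) {a : Fin (M + 3)} (ha : r a = 0) (ha' : r (a + 1) = 0) :
    r = 0 := by
  obtain ⟨l, hl⟩ := hr
  have hzero : l = 0 := LinearMap.ext fun z => by
    rw [← S.sum_dual_rvec (a, k) z, map_sum, LinearMap.zero_apply]
    refine Finset.sum_eq_zero fun x hx => ?_
    rw [map_smul, hl]
    split_ifs with hxk
    · rcases hS.mem_facet_iff.1 hx with hx | hx | hx
      · rw [hx, ha, smul_zero]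
      · rw [hx, ha', smul_zero]
      · exact absurd hxk hx
    · rw [smul_zero]
  funext j
  simpa [hzero] using (hl ⟨j, k j⟩).symm

/-- The planar fans obtained by projecting along the vectors off a transversal. -/
def fanFamily : FanFamily κ where
  rows := S.transversalRows
  isFanRows k := ⟨fun a => ⟨_, _, hS.isEdgeCoords_transversalCoord (a, k)⟩,
    fun _ hr _ => hS.eq_zero_of_mem_transversalRows hr⟩
  mem_update _ _ y _ hr hri := S.mem_transversalRows_update hr hri y

theorem isRelation {ρ : (Σ i, κ i) → ℝ} (hρ : ∑ y, ρ y • S.rvec y = 0) :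
    hS.fanFamily.IsRelation ρ := by
  rintro k r ⟨l, hl⟩
  have hl0 := congrArg l hρ
  rw [map_sum, map_zero, Fintype.sum_sigma] at hl0
  rw [← hl0]
  refine Finset.sum_congr rfl fun i _ => ?_
  rw [Finset.sum_eq_single (k i)]
  · rw [map_smul, hl]
    simp [mul_comm]
  · intro y _ hy
    rw [map_smul, hl, if_neg hy, smul_zero]
  · simp

theorem isWallRelation_facetRelation {f : Fin (M + 3) × ∀ i, κ i} {x : Σ i, κ i}
    (hx : x ∉ S.facet f) : hS.fanFamily.IsWallRelation (S.facetRelation f x) f.2 := by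
  have hx' := hx
  rw [hS.facet_eq, notMem_wedgeFacet] at hx'
  obtain ⟨hne, hne', hxf⟩ := hx'
  refine ⟨hS.isRelation (S.sum_facetRelation_smul f x), f.1, x.1, hne, hne', ?_,
    fun l hl hl' hlx => ?_⟩
  · rw [← hxf, facetRelation, if_pos rfl, if_neg hx, sub_zero]
  · have hlf : ⟨l, f.2 l⟩ ∉ S.facet f := by
      rw [hS.facet_eq]
      exact notMem_wedgeFacet.2 ⟨hl, hl', rfl⟩
    rw [facetRelation, if_neg fun h => hlx (congrArg Sigma.fst h), if_neg hlf, sub_zero]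

variable [∀ i, Nonempty (κ i)]

theorem exists_coeff : ∃ c : (Σ i, κ i) → ℤ,
    ∀ f, ∀ x ∉ S.facet f, 0 < ∑ y, c y * S.facetRelation f x y := by
  let Ω := {ω : (Fin (M + 3) × ∀ i, κ i) × Σ i, κ i // ω.2 ∉ S.facet ω.1}
  let ρ (ω : Ω) := S.facetRelation ω.1.1 ω.1.2
  let k₀ (i : Fin (M + 3)) : κ i := Classical.arbitrary _
  obtain ⟨C, hC⟩ := FanFamily.exists_support ρ (fun ω => ω.1.1.2)
    (fun ω => hS.isWallRelation_facetRelation ω.2) k₀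
  obtain ⟨c, hc⟩ := exists_int_forall_sum_pos ρ (fun y => if y.2 = k₀ y.1 then C y.1 else 0)
    (fun ω => by
      rw [Fintype.sum_sigma]
      simpa only [ite_mul, zero_mul, Finset.sum_ite_eq', Finset.mem_univ, if_true] using hC ω)
  exact ⟨c, fun f x hx => hc ⟨(f, x), hx⟩⟩

/-- The ample system given by an ample divisor on a unimodular system over the iterated wedge of a
polygon. -/
def ampleSystem : AmpleSystem n (Σ i, κ i) (Fin (M + 3) × ∀ i, κ i) where
  toUnimodularSystem := S
  cartier := S.cartierOfCoeff hS.exists_coeff.choose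
  coeff := hS.exists_coeff.choose
  cartier_nonneg f x := by
    refine le_of_le_of_eq ?_ (S.pairing_cartierOfCoeff_add _ f x).symm
    by_cases hx : x ∈ S.facet f
    · simp [S.facetRelation_of_mem hx]
    · exact (hS.exists_coeff.choose_spec f x hx).le
  cartier_eq_zero_iff f x := by
    refine (Eq.congr_left (S.pairing_cartierOfCoeff_add _ f x)).trans ⟨fun h => ?_, fun hx => ?_⟩
    · by_contra hx
      exact (hS.exists_coeff.choose_spec f x hx).ne' h
    · simp [S.facetRelation_of_mem hx]
  exists_adj f x _ := by
    simpa only [hS.facet_eq] using exists_adj_wedgeFacet f x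
  exists_mem_facet x := by
    simpa only [hS.facet_eq] using exists_mem_wedgeFacet x

theorem ampleSystem_toUnimodularSystem : hS.ampleSystem.toUnimodularSystem = S := rfl

theorem isFace_iff (s : Finset (Σ i, κ i)) :
    hS.ampleSystem.IsFace s ↔ ∃ f, s ⊆ wedgeFacet f :=
  exists_congr fun f => by rw [ampleSystem_toUnimodularSystem, hS.facet_eq]

end IsWedge

end UnimodularSystem

/-! ### The unimodular system of a toric manifold -/

section

variable {n : ℕ}

theorem pairing_coord (b : Module.Basis (Fin n) ℤ (Fin n → ℤ)) (i : Fin n) (z : Fin n → ℤ) :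
    pairing (fun t => b.coord i (Pi.single t 1)) (toReal z) = b.coord i z := by
  rw [pairing_toReal]
  conv_rhs => rw [pi_eq_sum_univ' z, map_sum]
  simp only [map_smul, smul_eq_mul, mul_comm]

theorem sum_pairing_smul_of_forall_toReal {ι : Type*} {s : Finset ι} {d v : ι → Fin n → ℤ}
    (h : ∀ z, ∑ x ∈ s, pairing (d x) (toReal z) • toReal (v x) = toReal z) (z : Fin n → ℝ) :
    ∑ x ∈ s, pairing (d x) z • toReal (v x) = z := by
  have hid : ∑ x ∈ s, (pairingCLM (d x)).toLinearMap.smulRight (toReal (v x)) =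
      LinearMap.id := by
    refine (Pi.basisFun ℝ (Fin n)).ext fun t => ?_
    have hsingle : Pi.single t 1 = toReal (Pi.single t 1) := by
      funext j
      by_cases hj : j = t <;> simp [toReal, hj]
    rw [Pi.basisFun_apply, hsingle, LinearMap.sum_apply]
    exact h _
  simpa [pairingCLM_apply] using LinearMap.congr_fun hid z

/-- The unimodular system of a single lattice basis. -/
def UnimodularSystem.ofBasis (b : Module.Basis (Fin n) ℤ (Fin n → ℤ)) :
    UnimodularSystem n (Fin n) Unit where
  vec := b
  facet _ := Finset.univ
  dual _ i t := b.coord i (Pi.single t 1)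
  pairing_dual _ i _ j _ := by
    rw [pairing_coord, b.coord_apply, b.repr_self, Finsupp.single_apply]
    simp only [eq_comm, Int.cast_ite, Int.cast_one, Int.cast_zero]
  sum_dual _ := sum_pairing_smul_of_forall_toReal fun z => by
    simp only [pairing_coord]
    rw [← toReal_sum_smul]
    simp only [b.coord_apply, b.sum_repr]

open UnimodularSystem

section OfBasis

variable {b : Module.Basis (Fin n) ℤ (Fin n → ℤ)}

theorem pairing_dual_ofBasis (i j : Fin n) :
    pairing ((ofBasis b).dual () i) (toReal (b j)) = if i = j then 1 else 0 :=
  (ofBasis b).pairing_dual_rvec (f := ()) (Finset.mem_univ i) (Finset.mem_univ j)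

theorem mem_ofBasis_cone_iff {s : Finset (Fin n)} {z : Fin n → ℝ} :
    z ∈ (ofBasis b).cone s ↔ ∀ i, 0 ≤ pairing ((ofBasis b).dual () i) z ∧
      (i ∉ s → pairing ((ofBasis b).dual () i) z = 0) :=
  ((ofBasis b).mem_cone_iff (f := ()) (Finset.subset_univ s)).trans
    (forall_congr' fun i => imp_iff_right (Finset.mem_univ i))

theorem isClosed_ofBasis_cone (s : Finset (Fin n)) :
    IsClosed ((ofBasis b).cone s : Set (Fin n → ℝ)) := by
  have hcont (i) : Continuous (pairing ((ofBasis b).dual () i)) := (pairingCLM _).continuous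
  have heq : ((ofBasis b).cone s : Set (Fin n → ℝ)) =
      ⋂ i, {z | 0 ≤ pairing ((ofBasis b).dual () i) z} ∩
        {z | i ∉ s → pairing ((ofBasis b).dual () i) z = 0} := by
    ext z
    rw [SetLike.mem_coe, mem_ofBasis_cone_iff, Set.mem_iInter]
    rfl
  rw [heq]
  refine isClosed_iInter fun i => (isClosed_le continuous_const (hcont i)).inter ?_
  by_cases hi : i ∈ s
  · simp [hi]
  · simpa [hi] using isClosed_eq (hcont i) continuous_const

theorem isConeFace_ofBasis_cone {s t : Finset (Fin n)} (hts : t ⊆ s) :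
    IsConeFace ((ofBasis b).cone t) ((ofBasis b).cone s) := by
  have hu (i) : pairing (∑ j ∈ s \ t, (ofBasis b).dual () j) ((ofBasis b).rvec i) =
      if i ∈ s \ t then 1 else 0 := by
    rw [pairing_sum_left]
    exact (Finset.sum_congr rfl fun j _ => pairing_dual_ofBasis j i).trans
      (Finset.sum_ite_eq' (s \ t) i fun _ => 1)
  have hnonneg (i) : 0 ≤ pairing (∑ j ∈ s \ t, (ofBasis b).dual () j) ((ofBasis b).rvec i) := by
    rw [hu]
    split_ifs <;> norm_num
  refine ⟨∑ j ∈ s \ t, (ofBasis b).dual () j,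
    fun z hz => (ofBasis b).pairing_nonneg_of_mem_cone (fun i _ => hnonneg i) hz,
    (ofBasis b).mem_cone_face_iff (f := ()) (Finset.subset_univ s) (fun i _ => hnonneg i)
      fun i => ?_⟩
  rw [hu]
  have := @hts i
  simp only [Finset.mem_sdiff, ite_eq_right_iff, one_ne_zero, imp_false]
  tauto

end OfBasis

/-- A lattice vector on which some character takes the value `1`, that is, one that is not a proper
multiple of another lattice vector. -/
def IsPrimitive (v : Fin n → ℤ) : Prop := ∃ u, pairing u (toReal v) = 1

theorem isPrimitive_basis (b : Module.Basis (Fin n) ℤ (Fin n → ℤ)) (i : Fin n) :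
    IsPrimitive (b i) := ⟨_, (pairing_dual_ofBasis i i).trans (if_pos rfl)⟩

namespace IsPrimitive

variable {v w : Fin n → ℤ}

theorem toReal_ne_zero (hv : IsPrimitive v) : toReal v ≠ 0 := fun h => by
  obtain ⟨u, hu⟩ := hv
  rw [h, pairing_zero_right] at hu
  exact zero_ne_one hu

theorem exists_eq_smul (hv : IsPrimitive v) (hw : toReal w ∈ PointedCone.hull ℝ {toReal v}) :
    ∃ a : ℤ, 0 ≤ a ∧ w = a • v := by
  obtain ⟨u, hu⟩ := hv
  obtain ⟨t, ht⟩ := Submodule.mem_span_singleton.1 hw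
  change (t : ℝ) • toReal v = _ at ht
  have hut : (t : ℝ) = ((∑ i, u i * w i : ℤ) : ℝ) := by
    rw [← pairing_toReal, ← ht, pairing_smul_right, hu, mul_one]
  refine ⟨∑ i, u i * w i, ?_, toReal_injective ?_⟩
  · have hnonneg := t.2
    rw [hut] at hnonneg
    exact_mod_cast hnonneg
  · rw [← ht, hut]
    funext l
    simp [toReal]

theorem eq_of_hull_eq (hv : IsPrimitive v) (hw : IsPrimitive w)
    (h : PointedCone.hull ℝ {toReal v} = PointedCone.hull ℝ {toReal w}) : v = w := by
  obtain ⟨a, ha, hva⟩ := hw.exists_eq_smul (by rw [← h]; exact PointedCone.subset_hull rfl)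
  obtain ⟨a', -, hwa⟩ := hv.exists_eq_smul (by rw [h]; exact PointedCone.subset_hull rfl)
  have hv0 : v ≠ 0 := fun h0 => hv.toReal_ne_zero (by
    rw [h0]
    exact funext fun _ => Int.cast_zero)
  have hmul : a * a' = 1 := by
    refine smul_left_injective ℤ hv0 ?_
    change (a * a') • v = (1 : ℤ) • v
    rw [mul_smul, ← hwa, ← hva, one_smul]
  rw [hva, Int.eq_one_of_mul_eq_one_right ha hmul, one_smul]

end IsPrimitive

theorem hull_singleton_eq {v w : Fin n → ℝ} (hw : w ∈ PointedCone.hull ℝ {v}) (hw0 : w ≠ 0) :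
    PointedCone.hull ℝ {w} = PointedCone.hull ℝ {v} := by
  refine le_antisymm (Submodule.span_le.2 (by simpa using hw)) (Submodule.span_le.2 ?_)
  obtain ⟨t, rfl⟩ := Submodule.mem_span_singleton.1 hw
  change (t : ℝ) • v ≠ 0 at hw0
  have hinv : (t : ℝ)⁻¹ • ((t : ℝ) • v) = v := by
    rw [smul_smul, inv_mul_cancel₀ (left_ne_zero_of_smul hw0), one_smul]
  have hmem := PointedCone.smul_mem _ (inv_nonneg.2 t.2)
    (PointedCone.subset_hull (R := ℝ) (Set.mem_singleton ((t : ℝ) • v)))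
  rw [hinv] at hmem
  simpa using hmem

/-- The vectors `vec x` are the primitive generators of the rays of the fan. -/
structure Fan.IsLabelling (Δ : Fan n) {V : Type*} (vec : V → Fin n → ℤ) : Prop where
  isPrimitive : ∀ x, IsPrimitive (vec x)
  hull_mem : ∀ x, PointedCone.hull ℝ {toReal (vec x)} ∈ Δ.cones
  exists_of_mem_rays : ∀ ρ ∈ Δ.rays, ∃ x, ρ = PointedCone.hull ℝ {toReal (vec x)}
  injective : Function.Injective vec

variable {Δ : Fan n} {V : Type*}

namespace Fan

theorem cone_mem_of_subset {b : Module.Basis (Fin n) ℤ (Fin n → ℤ)} {s t : Finset (Fin n)}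
    (hs : (ofBasis b).cone s ∈ Δ.cones) (hts : t ⊆ s) : (ofBasis b).cone t ∈ Δ.cones :=
  Δ.face_mem _ hs _ (isConeFace_ofBasis_cone hts)

theorem exists_hull_eq_of_mem_cone {b : Module.Basis (Fin n) ℤ (Fin n → ℤ)}
    {s : Finset (Fin n)} (hs : (ofBasis b).cone s ∈ Δ.cones) {v : Fin n → ℝ} (hv0 : v ≠ 0)
    (hv : PointedCone.hull ℝ {v} ∈ Δ.cones) (hvs : v ∈ (ofBasis b).cone s) :
    ∃ i ∈ s, PointedCone.hull ℝ {toReal (b i)} = PointedCone.hull ℝ {v} := by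
  obtain ⟨u, hu, hinf⟩ := Δ.inf_isFace _ hs _ hv
  have hcoord := mem_ofBasis_cone_iff.1 hvs
  have hsum := ((hinf _).1 ⟨hvs, PointedCone.subset_hull rfl⟩).2
  rw [(ofBasis b).pairing_eq_sum (), Finset.sum_eq_zero_iff_of_nonneg] at hsum
  · obtain ⟨i, hi⟩ : ∃ i, pairing ((ofBasis b).dual () i) v ≠ 0 := by
      by_contra! h
      refine hv0 ?_
      rw [← (ofBasis b).sum_dual_rvec () v]
      exact Finset.sum_eq_zero fun i _ => by rw [h i, zero_smul]
    have his : i ∈ s := not_not.1 fun h => hi ((hcoord i).2 h)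
    refine ⟨i, his, hull_singleton_eq ?_ (isPrimitive_basis b i).toReal_ne_zero⟩
    exact ((hinf _).2 ⟨(ofBasis b).rvec_mem_cone his,
      (mul_eq_zero.1 (hsum i (Finset.mem_univ i))).resolve_left hi⟩).2
  · intro i _
    by_cases his : i ∈ s
    · exact mul_nonneg (hcoord i).1 (hu _ ((ofBasis b).rvec_mem_cone his))
    · rw [(hcoord i).2 his, zero_mul]

namespace IsNonsingular

theorem exists_finset (hΔ : Δ.IsNonsingular) {σ} (hσ : σ ∈ Δ.cones) :
    ∃ (b : Module.Basis (Fin n) ℤ (Fin n → ℤ)) (s : Finset (Fin n)), σ = (ofBasis b).cone s := by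
  classical
  obtain ⟨b, s, rfl⟩ := hΔ σ hσ
  refine ⟨b, s.toFinset, ?_⟩
  rw [cone, Set.coe_toFinset]
  rfl

theorem isClosed (hΔ : Δ.IsNonsingular) {σ} (hσ : σ ∈ Δ.cones) :
    IsClosed (σ : Set (Fin n → ℝ)) := by
  obtain ⟨b, s, rfl⟩ := hΔ.exists_finset hσ
  exact isClosed_ofBasis_cone s

theorem exists_isPrimitive (hΔ : Δ.IsNonsingular) {ρ} (hρ : ρ ∈ Δ.rays) :
    ∃ v, IsPrimitive v ∧ ρ = PointedCone.hull ℝ {toReal v} := by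
  obtain ⟨hρ, v, hv, rfl⟩ := hρ
  obtain ⟨b, s, hs⟩ := hΔ.exists_finset hρ
  obtain ⟨i, rfl⟩ := (ofBasis b).exists_eq_singleton_of_cone_eq_hull (f := ())
    (Finset.subset_univ s) hv hs.symm
  exact ⟨b i, isPrimitive_basis b i, hs.trans ((ofBasis b).cone_singleton i)⟩

theorem exists_labelling (hΔ : Δ.IsNonsingular) (e : V ≃ Δ.rays) :
    ∃ vec : V → Fin n → ℤ, Δ.IsLabelling vec ∧
      ∀ x, (e x).1 = PointedCone.hull ℝ {toReal (vec x)} := by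
  choose vec hprim hvec using fun x => hΔ.exists_isPrimitive (e x).2
  refine ⟨vec, ⟨hprim, fun x => ?_, fun ρ hρ => ⟨e.symm ⟨ρ, hρ⟩, ?_⟩, fun x y hxy => ?_⟩, hvec⟩
  · rw [← hvec]
    exact (e x).2.1
  · rw [← hvec, e.apply_symm_apply]
  · exact e.injective (Subtype.ext (by rw [hvec, hvec, hxy]))

end IsNonsingular

/-- Infinitely many of the points `z + w / (N + 1)` lie in the same cone. -/
theorem IsComplete.exists_mem_add_smul_mem (hc : Δ.IsComplete) (hns : Δ.IsNonsingular)
    (z w : Fin n → ℝ) : ∃ σ ∈ Δ.cones, z ∈ σ ∧ ∃ ε : ℝ, 0 < ε ∧ z + ε • w ∈ σ := by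
  have : Finite Δ.cones := Δ.finite
  choose τ hτ hmem using fun N : ℕ => hc (z + (1 / ((N : ℝ) + 1)) • w)
  obtain ⟨⟨σ, hσ⟩, hfiber⟩ := Finite.exists_infinite_fiber fun N => (⟨τ N, hτ N⟩ : Δ.cones)
  have hinf : {N : ℕ | z + (1 / ((N : ℝ) + 1)) • w ∈ σ}.Infinite := by
    refine (Set.infinite_coe_iff.1 hfiber).mono fun N hN => ?_
    have hNσ : τ N = σ := congrArg Subtype.val hN
    exact hNσ ▸ hmem N
  have hlim : Filter.Tendsto (fun N : ℕ => z + (1 / ((N : ℝ) + 1)) • w) Filter.atTop (nhds z) := by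
    simpa using ((tendsto_one_div_add_atTop_nhds_zero_nat (𝕜 := ℝ)).smul_const w).const_add z
  obtain ⟨N, hN⟩ := hinf.nonempty
  exact ⟨σ, hσ, (hns.isClosed hσ).mem_of_frequently_of_tendsto
    (Nat.frequently_atTop_iff_infinite.2 hinf) hlim, _, by positivity, hN⟩

theorem cone_le_of_sum_mem {b : Module.Basis (Fin n) ℤ (Fin n → ℤ)} {s : Finset (Fin n)}
    (hs : (ofBasis b).cone s ∈ Δ.cones) {σ} (hσ : σ ∈ Δ.cones)
    (hmem : ∑ i ∈ s, (ofBasis b).rvec i ∈ σ) : (ofBasis b).cone s ≤ σ := by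
  obtain ⟨u, hu, hinf⟩ := Δ.inf_isFace _ hs σ hσ
  have hsum := ((hinf _).1
    ⟨Submodule.sum_mem _ fun i hi => (ofBasis b).rvec_mem_cone hi, hmem⟩).2
  rw [pairing_sum_right,
    Finset.sum_eq_zero_iff_of_nonneg fun i hi => hu _ ((ofBasis b).rvec_mem_cone hi)] at hsum
  refine Submodule.span_le.2 ?_
  rintro _ ⟨i, hi, rfl⟩
  exact ((hinf _).2 ⟨(ofBasis b).rvec_mem_cone hi, hsum i hi⟩).2

theorem IsComplete.eq_univ_of_maximal (hc : Δ.IsComplete) (hns : Δ.IsNonsingular)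
    {b : Module.Basis (Fin n) ℤ (Fin n → ℤ)} {s : Finset (Fin n)}
    (hs : (ofBasis b).cone s ∈ Δ.cones)
    (hmax : ∀ τ ∈ Δ.cones, (ofBasis b).cone s ≤ τ → τ ≤ (ofBasis b).cone s) :
    s = Finset.univ := by
  refine Finset.eq_univ_iff_forall.2 fun i => not_not.1 fun hi => ?_
  obtain ⟨σ, hσ, hzσ, ε, hε, hεσ⟩ := hc.exists_mem_add_smul_mem hns
    (∑ i ∈ s, (ofBasis b).rvec i) ((ofBasis b).rvec i)
  have hcoord := (mem_ofBasis_cone_iff.1 (hmax σ hσ (cone_le_of_sum_mem hs hσ hzσ) hεσ) i).2 hi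
  have hz := (mem_ofBasis_cone_iff.1
    (Submodule.sum_mem _ fun j hj => (ofBasis b).rvec_mem_cone hj) i).2 hi
  have hdual : pairing ((ofBasis b).dual () i) ((ofBasis b).rvec i) = 1 :=
    (pairing_dual_ofBasis i i).trans (if_pos rfl)
  rw [pairing_add_right, hz, pairing_smul_right, hdual, mul_one, zero_add] at hcoord
  exact hε.ne' hcoord

theorem IsComplete.exists_eq_cone_univ (hc : Δ.IsComplete) (hns : Δ.IsNonsingular) {σ}
    (hσ : σ ∈ Δ.cones) (hmax : ∀ τ ∈ Δ.cones, σ ≤ τ → τ ≤ σ) :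
    ∃ b : Module.Basis (Fin n) ℤ (Fin n → ℤ), σ = (ofBasis b).cone Finset.univ := by
  obtain ⟨b, s, rfl⟩ := hns.exists_finset hσ
  exact ⟨b, by rw [hc.eq_univ_of_maximal hns hσ hmax]⟩

theorem IsComplete.bot_mem (hc : Δ.IsComplete) (hns : Δ.IsNonsingular) : ⊥ ∈ Δ.cones := by
  obtain ⟨σ, hσ, -⟩ := hc 0
  obtain ⟨b, s, rfl⟩ := hns.exists_finset hσ
  have hempty := cone_mem_of_subset hσ (Finset.empty_subset s)
  rwa [UnimodularSystem.cone, Finset.coe_empty, Set.image_empty, PointedCone.hull,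
    Submodule.span_empty] at hempty

namespace IsLabelling

variable {vec : V → Fin n → ℤ}

theorem exists_vec_eq (hv : Δ.IsLabelling vec) {b : Module.Basis (Fin n) ℤ (Fin n → ℤ)}
    {s : Finset (Fin n)} (hs : (ofBasis b).cone s ∈ Δ.cones) {i : Fin n} (hi : i ∈ s) :
    ∃ x, vec x = b i := by
  have hmem := cone_mem_of_subset hs (Finset.singleton_subset_iff.2 hi)
  rw [cone_singleton] at hmem
  obtain ⟨x, hx⟩ :=
    hv.exists_of_mem_rays _ ⟨hmem, _, (isPrimitive_basis b i).toReal_ne_zero, rfl⟩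
  exact ⟨x, ((isPrimitive_basis b i).eq_of_hull_eq (hv.isPrimitive x) hx).symm⟩

theorem exists_eq_vec (hv : Δ.IsLabelling vec) {b : Module.Basis (Fin n) ℤ (Fin n → ℤ)}
    {s : Finset (Fin n)} (hs : (ofBasis b).cone s ∈ Δ.cones) {x : V}
    (hx : toReal (vec x) ∈ (ofBasis b).cone s) : ∃ i ∈ s, b i = vec x := by
  obtain ⟨i, his, hi⟩ :=
    exists_hull_eq_of_mem_cone hs (hv.isPrimitive x).toReal_ne_zero (hv.hull_mem x) hx
  exact ⟨i, his, (isPrimitive_basis b i).eq_of_hull_eq (hv.isPrimitive x) hi⟩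

theorem eq_hull (hv : Δ.IsLabelling vec) (hns : Δ.IsNonsingular) {σ} (hσ : σ ∈ Δ.cones) :
    σ = PointedCone.hull ℝ ((fun x => toReal (vec x)) '' {x | toReal (vec x) ∈ σ}) := by
  refine le_antisymm ?_ (Submodule.span_le.2 ?_)
  · obtain ⟨b, s, rfl⟩ := hns.exists_finset hσ
    refine Submodule.span_le.2 ?_
    rintro _ ⟨i, hi, rfl⟩
    obtain ⟨x, hx⟩ := hv.exists_vec_eq hσ hi
    refine PointedCone.subset_hull ⟨x, ?_, congrArg toReal hx⟩
    rw [Set.mem_ofPred_eq, hx]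
    exact (ofBasis b).rvec_mem_cone hi
  · rintro _ ⟨x, hx, rfl⟩
    exact hx

theorem exists_dual [DecidableEq V] (hv : Δ.IsLabelling vec)
    {b : Module.Basis (Fin n) ℤ (Fin n → ℤ)} (hb : (ofBasis b).cone Finset.univ ∈ Δ.cones)
    {s : Finset V} (hs : ∀ x, x ∈ s ↔ toReal (vec x) ∈ (ofBasis b).cone Finset.univ) :
    ∃ D : V → Fin n → ℤ,
      (∀ x ∈ s, ∀ y ∈ s, pairing (D x) (toReal (vec y)) = if x = y then 1 else 0) ∧
      ∀ z, ∑ x ∈ s, pairing (D x) z • toReal (vec x) = z := by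
  choose i _ hi using fun x : s => hv.exists_eq_vec hb ((hs x).1 x.2)
  have hinj : Function.Injective i := fun x y h =>
    Subtype.ext (hv.injective (by rw [← hi, ← hi, h]))
  have hsurj : Function.Surjective i := fun j => by
    obtain ⟨x, hx⟩ := hv.exists_vec_eq hb (Finset.mem_univ j)
    have hxs : x ∈ s := by
      rw [hs, hx]
      exact (ofBasis b).rvec_mem_cone (Finset.mem_univ j)
    exact ⟨⟨x, hxs⟩, b.injective ((hi _).trans hx)⟩
  refine ⟨fun x => if h : x ∈ s then (ofBasis b).dual () (i ⟨x, h⟩) else 0,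
    fun x hx y hy => ?_, fun z => ?_⟩
  · beta_reduce
    rw [dif_pos hx, ← hi ⟨y, hy⟩, pairing_dual_ofBasis]
    simp [hinj.eq_iff]
  · conv_rhs => rw [← (ofBasis b).sum_dual_rvec () z]
    rw [← Finset.sum_attach]
    refine Fintype.sum_bijective i ⟨hinj, hsurj⟩ _ _ fun x => ?_
    beta_reduce
    rw [dif_pos x.2, ← hi x]
    rfl

theorem eq_hull_of_forall_mem_iff (hv : Δ.IsLabelling vec) (hns : Δ.IsNonsingular) {σ}
    (hσ : σ ∈ Δ.cones) {s : Finset V} (hs : ∀ x, x ∈ s ↔ toReal (vec x) ∈ σ) :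
    σ = PointedCone.hull ℝ ((fun x => toReal (vec x)) '' s) := by
  rw [show (s : Set V) = {x | toReal (vec x) ∈ σ} from Set.ext hs]
  exact hv.eq_hull hns hσ

section Facets

variable [Finite V] {ι : Type*} {F : ι → Finset V}

theorem le_of_facet_le (hv : Δ.IsLabelling vec) (hns : Δ.IsNonsingular)
    (hF : ∀ s : Finset V, s.Nonempty →
      ((∃ σ ∈ Δ.cones, ∀ x, x ∈ s ↔ toReal (vec x) ∈ σ) ↔ ∃ f, s ⊆ F f))
    {f : ι} (hne : (F f).Nonempty) (hmax : ∀ g, F f ⊆ F g → F f = F g) {σ τ}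
    (hσ : ∀ x, x ∈ F f ↔ toReal (vec x) ∈ σ) (hτ : τ ∈ Δ.cones) (hle : σ ≤ τ) : τ ≤ σ := by
  classical
  cases nonempty_fintype V
  let t : Finset V := {x | toReal (vec x) ∈ τ}
  have ht (x) : x ∈ t ↔ toReal (vec x) ∈ τ := Finset.mem_filter_univ x
  have hsub : F f ⊆ t := fun x hx => (ht x).2 (hle ((hσ x).1 hx))
  obtain ⟨g, hg⟩ := (hF t (hne.mono hsub)).1 ⟨τ, hτ, ht⟩
  rw [hv.eq_hull_of_forall_mem_iff hns hτ ht]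
  refine Submodule.span_le.2 ?_
  rintro _ ⟨x, hx, rfl⟩
  refine (hσ x).1 ?_
  rw [hmax g (hsub.trans hg)]
  exact hg hx

theorem exists_unimodularSystem [DecidableEq V] [Nonempty ι]
    (hv : Δ.IsLabelling vec) (hc : Δ.IsComplete) (hns : Δ.IsNonsingular)
    (hF : ∀ s : Finset V, s.Nonempty →
      ((∃ σ ∈ Δ.cones, ∀ x, x ∈ s ↔ toReal (vec x) ∈ σ) ↔ ∃ f, s ⊆ F f))
    (hne : ∀ f, (F f).Nonempty) (hmax : ∀ f g, F f ⊆ F g → F f = F g) :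
    ∃ S : UnimodularSystem n V ι, S.vec = vec ∧ S.facet = F ∧
      ∀ σ, σ ∈ Δ.cones ↔ ∃ s, (∃ f, s ⊆ F f) ∧ σ = S.cone s := by
  classical
  cases nonempty_fintype V
  have hdual (f) : ∃ D : V → Fin n → ℤ,
      (∀ x ∈ F f, ∀ y ∈ F f, pairing (D x) (toReal (vec y)) = if x = y then 1 else 0) ∧
      ∀ z, ∑ x ∈ F f, pairing (D x) z • toReal (vec x) = z := by
    obtain ⟨σ, hσ, hxσ⟩ := (hF (F f) (hne f)).2 ⟨f, subset_rfl⟩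
    obtain ⟨b, rfl⟩ := hc.exists_eq_cone_univ hns hσ fun τ =>
      hv.le_of_facet_le hns hF (hne f) (hmax f) hxσ
    exact hv.exists_dual hσ hxσ
  choose D hpairing hsum using hdual
  let S : UnimodularSystem n V ι := ⟨vec, F, D, hpairing, hsum⟩
  refine ⟨S, rfl, rfl, fun σ => ⟨fun hσ => ?_, ?_⟩⟩
  · let s : Finset V := {x | toReal (vec x) ∈ σ}
    have hs (x) : x ∈ s ↔ toReal (vec x) ∈ σ := Finset.mem_filter_univ x
    refine ⟨s, ?_, hv.eq_hull_of_forall_mem_iff hns hσ hs⟩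
    rcases s.eq_empty_or_nonempty with hempty | hnonempty
    · exact ⟨Classical.arbitrary ι, hempty ▸ Finset.empty_subset _⟩
    · exact (hF s hnonempty).1 ⟨σ, hσ, hs⟩
  · rintro ⟨s, hs, rfl⟩
    rcases s.eq_empty_or_nonempty with rfl | hnonempty
    · simpa [UnimodularSystem.cone] using hc.bot_mem hns
    · obtain ⟨σ, hσ, hxσ⟩ := (hF s hnonempty).2 hs
      have heq : σ = S.cone s := hv.eq_hull_of_forall_mem_iff hns hσ hxσ
      rwa [← heq]

end Facets

end IsLabelling

end Fan

end

/-! ### Toric manifolds over iterated wedges of polygons -/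

section

variable {n M : ℕ} {κ : Fin (M + 3) → Type*} [∀ i, Fintype (κ i)] [∀ i, DecidableEq (κ i)]

theorem wedgeFacet_eq_of_subset {f g : Fin (M + 3) × ∀ i, κ i}
    (h : wedgeFacet f ⊆ wedgeFacet g) : wedgeFacet f = wedgeFacet g := by
  obtain ⟨a, k⟩ := f
  obtain ⟨a', k'⟩ := g
  have hmissing (i) (hi : i ≠ a') (hi' : i ≠ a' + 1) : i ≠ a ∧ i ≠ a + 1 ∧ k' i = k i := by
    simpa only [mem_wedgeFacet, not_or, not_not] using
      mt (@h ⟨i, k' i⟩) (notMem_wedgeFacet.2 ⟨hi, hi', rfl⟩)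
  obtain rfl : a = a' := by
    by_contra hne
    obtain rfl : a = a' + 1 := by
      by_contra hne'
      exact (hmissing a hne hne').1 rfl
    exact (hmissing (a' + 1 + 1) (fin_add_one_add_one_ne a') (by simp)).2.1 rfl
  ext x
  simp only [mem_wedgeFacet]
  by_cases hx : x.1 = a
  · simp only [hx, true_or]
  by_cases hx' : x.1 = a + 1
  · simp only [hx', true_or, or_true]
  simp only [hx, hx', false_or, (hmissing x.1 hx hx').2.2]

theorem wedgeFacet_nonempty (f : Fin (M + 3) × ∀ i, κ i) : (wedgeFacet f).Nonempty :=
  ⟨⟨f.1, f.2 f.1⟩, mem_wedgeFacet.2 (Or.inl rfl)⟩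

namespace UnimodularSystem

variable {S : UnimodularSystem n (Σ i, κ i) (Fin (M + 3) × ∀ i, κ i)}

/-- The added vertices raise the coordinates off the transversal; on it, the vertices of the facet
are the two ends of the edge. -/
theorem exists_add_smul_sum_mem_cone {f : Fin (M + 3) × ∀ i, κ i}
    (hfacet : S.facet f = wedgeFacet f) {z : Fin n → ℝ}
    (hz : 0 ≤ pairing (S.dual f ⟨f.1, f.2 f.1⟩) z)
    (hz' : 0 ≤ pairing (S.dual f ⟨f.1 + 1, f.2 (f.1 + 1)⟩) z) :
    ∃ N : ℝ, 0 ≤ N ∧ z + N • ∑ y with y.2 ≠ f.2 y.1, S.rvec y ∈ S.cone (S.facet f) := by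
  refine ⟨∑ y, |pairing (S.dual f y) z|, Finset.sum_nonneg fun _ _ => abs_nonneg _,
    S.mem_cone_facet_iff.2 fun y hy => ?_⟩
  have hoff (t) (ht : t.2 ≠ f.2 t.1) : t ∈ S.facet f := by
    rw [hfacet]
    exact mem_wedgeFacet.2 (Or.inr (Or.inr ht))
  have hsum : pairing (S.dual f y) (∑ t with t.2 ≠ f.2 t.1, S.rvec t) =
      if y.2 ≠ f.2 y.1 then 1 else 0 := by
    rw [pairing_sum_right, Finset.sum_congr rfl fun t ht =>
      S.pairing_dual_rvec hy (hoff t ((Finset.mem_filter_univ t).1 ht)), Finset.sum_ite_eq]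
    simp only [Finset.mem_filter_univ]
  rw [pairing_add_right, pairing_smul_right, hsum]
  by_cases hyk : y.2 = f.2 y.1
  · rw [if_neg (not_not.2 hyk), mul_zero, add_zero]
    obtain ⟨i, j⟩ := y
    obtain rfl : j = f.2 i := hyk
    rw [hfacet, mem_wedgeFacet] at hy
    rcases hy with rfl | rfl | hy
    exacts [hz, hz', absurd rfl hy]
  · rw [if_pos hyk, mul_one]
    have hle := Finset.single_le_sum (f := fun y => |pairing (S.dual f y) z|)
      (fun _ _ => abs_nonneg _) (Finset.mem_univ y)
    linarith [neg_abs_le (pairing (S.dual f y) z)]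

/-- If `x` had nonnegative coordinates at the edge of the polygon, then the cones of the facets
`(a, k)` and `(x.1, k)` would meet outside their common face. -/
theorem isWedge_of_fan {Δ : Fan n} (hfacet : ∀ f, S.facet f = wedgeFacet f)
    (hmem : ∀ f, S.cone (wedgeFacet f) ∈ Δ.cones)
    (hcone : ∀ f x, S.rvec x ∈ S.cone (wedgeFacet f) → x ∈ wedgeFacet f) : S.IsWedge := by
  refine ⟨hfacet, ?_⟩
  rintro ⟨a, k⟩ x hx ⟨ha, ha'⟩
  obtain ⟨N, hN, hsum⟩ := exists_add_smul_sum_mem_cone (hfacet (a, k)) ha ha'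
  rw [hfacet] at hsum
  have hx_mem : S.rvec x ∈ S.cone (wedgeFacet (x.1, k)) :=
    S.rvec_mem_cone (mem_wedgeFacet.2 (Or.inl rfl))
  have hsum_mem : ∑ y with y.2 ≠ k y.1, S.rvec y ∈ S.cone (wedgeFacet (x.1, k)) :=
    Submodule.sum_mem _ fun y hy => S.rvec_mem_cone
      (mem_wedgeFacet.2 (Or.inr (Or.inr ((Finset.mem_filter_univ y).1 hy))))
  obtain ⟨u, hu, hinf⟩ := Δ.inf_isFace _ (hmem (x.1, k)) _ (hmem (a, k))
  have hzero := ((hinf _).1 ⟨add_mem hx_mem (PointedCone.smul_mem _ hN hsum_mem), hsum⟩).2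
  rw [pairing_add_right, pairing_smul_right] at hzero
  have hx_nonneg := hu _ hx_mem
  have hsum_nonneg := mul_nonneg hN (hu _ hsum_mem)
  exact hx (hcone _ x ((hinf _).2 ⟨hx_mem, by linarith⟩).2)

end UnimodularSystem

theorem Fan.IsToricManifoldOver.exists_ampleSystem {J : Fin (M + 3) → ℕ+} {Δ : Fan n}
    (hΔ : Δ.IsToricManifoldOver (multiWedge (polygon (M + 3)) J)) :
    ∃ S : AmpleSystem n (Σ i, Fin (J i)) (Fin (M + 3) × ∀ i, Fin (J i)), S.Spans Δ := by
  obtain ⟨hc, hns, e, he⟩ := hΔ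
  obtain ⟨vec, hv, hvec⟩ := hns.exists_labelling e
  have hle (x σ) : (e x : PointedCone ℝ (Fin n → ℝ)) ≤ σ ↔ toReal (vec x) ∈ σ := by
    rw [hvec]
    exact Submodule.span_singleton_le_iff_mem _ _
  have hF (s : Finset (Σ i, Fin (J i))) (hs : s.Nonempty) :
      (∃ σ ∈ Δ.cones, ∀ x, x ∈ s ↔ toReal (vec x) ∈ σ) ↔ ∃ f, s ⊆ wedgeFacet f := by
    rw [← mem_multiWedge_polygon_iff hs, he s hs]
    simp only [hle]
  obtain ⟨S, rfl, hfacet, hcones⟩ := hv.exists_unimodularSystem hc hns hF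
    wedgeFacet_nonempty fun f g => wedgeFacet_eq_of_subset
  have hW : S.IsWedge := by
    refine UnimodularSystem.isWedge_of_fan (Δ := Δ) (congrFun hfacet)
      (fun f => (hcones _).2 ⟨_, ⟨f, subset_rfl⟩, rfl⟩) fun f x hx => ?_
    obtain ⟨σ, hσ, hxσ⟩ := (hF _ (wedgeFacet_nonempty f)).2 ⟨f, subset_rfl⟩
    rw [hv.eq_hull_of_forall_mem_iff hns hσ hxσ] at hxσ
    exact (hxσ x).2 hx
  refine ⟨hW.ampleSystem, fun σ => ?_⟩
  rw [hcones]
  exact exists_congr fun s => and_congr_left' (hW.isFace_iff s).symm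

end

/-! ### A toric manifold over every iterated wedge of a polygon -/

/-- A one-sided inverse of a square matrix is two-sided. -/
theorem sum_pairing_smul_of_biorthogonal {n : ℕ} {V : Type*} [DecidableEq V] {s : Finset V}
    {d v : V → Fin n → ℤ} (hcard : s.card = n)
    (h : ∀ x ∈ s, ∀ y ∈ s, pairing (d x) (toReal (v y)) = if x = y then 1 else 0)
    (z : Fin n → ℝ) : ∑ x ∈ s, pairing (d x) z • toReal (v x) = z := by
  let D : Matrix s (Fin n) ℝ := .of fun x => toReal (d x)
  let W : Matrix (Fin n) s ℝ := .of fun j x => toReal (v x) j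
  have hDW : D * W = 1 := by
    ext x y
    refine (h x x.2 y y.2).trans ?_
    simp only [Matrix.one_apply, Subtype.coe_inj]
  have hWD : W * D = 1 := (Matrix.mul_eq_one_comm_of_card_eq _ _ _ (by simpa using hcard)).1 hDW
  conv_rhs => rw [← Matrix.one_mulVec z, ← hWD, ← Matrix.mulVec_mulVec]
  funext j
  rw [← Finset.sum_coe_sort, Finset.sum_apply]
  exact Finset.sum_congr rfl fun x _ => mul_comm _ _

/-- A unimodular system from integral matrices with an arbitrary index set of coordinates. -/
def UnimodularSystem.ofMatrix {V ι B : Type*} [DecidableEq V] [Fintype B] (vec : V → B → ℤ)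
    (facet : ι → Finset V) (dual : ι → V → B → ℤ)
    (h : ∀ f, ∀ x ∈ facet f, ∀ y ∈ facet f, dual f x ⬝ᵥ vec y = if x = y then 1 else 0)
    (hcard : ∀ f, (facet f).card = Fintype.card B) :
    UnimodularSystem (Fintype.card B) V ι :=
  have hpairing (f) (x) (hx : x ∈ facet f) (y) (hy : y ∈ facet f) :
      pairing (dual f x ∘ (Fintype.equivFin B).symm)
        (toReal (vec y ∘ (Fintype.equivFin B).symm)) = if x = y then 1 else 0 := by
    rw [pairing_toReal, ← Int.cast_one, ← Int.cast_zero, ← Int.cast_ite, ← h f x hx y hy]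
    exact congrArg _ (Equiv.sum_comp (Fintype.equivFin B).symm fun b => dual f x b * vec y b)
  { vec := fun x => vec x ∘ (Fintype.equivFin B).symm
    facet := facet
    dual := fun f x => dual f x ∘ (Fintype.equivFin B).symm
    pairing_dual := hpairing
    sum_dual := fun f => sum_pairing_smul_of_biorthogonal (hcard f) (hpairing f) }

section Plane

/-- The determinant of two vectors of the plane. -/
def cross (v w : Fin 2 → ℤ) : ℤ := v 0 * w 1 - v 1 * w 0

variable {M : ℕ} (w : Fin (M + 3) → Fin 2 → ℤ)

/-- Consecutive rays form a positively oriented lattice basis. -/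
def IsUnimodularCycle : Prop := ∀ a, cross (w a) (w (a + 1)) = 1

/-- The dual basis of the rays `w a` and `w (a + 1)`, extended by zero to the other indices. -/
def planeDual (a j : Fin (M + 3)) : Fin 2 → ℤ :=
  if j = a then ![w (a + 1) 1, -w (a + 1) 0]
  else if j = a + 1 then ![-w a 1, w a 0] else 0

theorem planeDual_self_dotProduct (a : Fin (M + 3)) (z : Fin 2 → ℤ) :
    planeDual w a a ⬝ᵥ z = cross z (w (a + 1)) := by
  rw [planeDual, if_pos rfl, Matrix.vec2_dotProduct, cross]
  simp only [Matrix.cons_val_zero, Matrix.cons_val_one]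
  ring

theorem planeDual_add_one_dotProduct (a : Fin (M + 3)) (z : Fin 2 → ℤ) :
    planeDual w a (a + 1) ⬝ᵥ z = cross (w a) z := by
  rw [planeDual, if_neg (by simp), if_pos rfl, Matrix.vec2_dotProduct, cross]
  simp only [Matrix.cons_val_zero, Matrix.cons_val_one]
  ring

variable {w}

theorem IsUnimodularCycle.planeDual_dotProduct (hw : IsUnimodularCycle w) {a i : Fin (M + 3)}
    (hi : i = a ∨ i = a + 1) (j : Fin (M + 3)) :
    planeDual w a j ⬝ᵥ w i = if j = i then 1 else 0 := by
  have hself (v : Fin 2 → ℤ) : cross v v = 0 := by rw [cross, mul_comm, sub_self]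
  by_cases hja : j = a
  · rw [hja, planeDual_self_dotProduct]
    rcases hi with rfl | rfl
    · rw [hw, if_pos rfl]
    · rw [hself, if_neg (by simp)]
  by_cases hja' : j = a + 1
  · rw [hja', planeDual_add_one_dotProduct]
    rcases hi with rfl | rfl
    · rw [hself, if_neg (by simp)]
    · rw [hw, if_pos rfl]
  rw [planeDual, if_neg hja, if_neg hja', zero_dotProduct, if_neg]
  rintro rfl
  exact hi.elim hja hja'

end Plane

section Transversal

variable {I : Type*} [Fintype I] {κ : I → Type*} [∀ i, Fintype (κ i)]
  [∀ i, DecidableEq (κ i)]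

theorem card_off_transversal (k : ∀ i, κ i) :
    Fintype.card {x : Σ i, κ i // x.2 ≠ k x.1} + Fintype.card I = Fintype.card (Σ i, κ i) := by
  have hcard : Fintype.card {x : Σ i, κ i // x.2 = k x.1} = Fintype.card I := by
    rw [Fintype.card_subtype, Finset.card_filter, Fintype.sum_sigma]
    simp
  rw [← hcard, add_comm, ← Fintype.card_sum]
  exact Fintype.card_congr (Equiv.sumCompl _)

theorem sum_off_transversal [DecidableEq I] (k : ∀ i, κ i) (i : I) (g : (Σ i, κ i) → ℤ) :
    ∑ x : {x : Σ i, κ i // x.2 ≠ k x.1}, (if i = x.1.1 then g x else 0) + g ⟨i, k i⟩ =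
      ∑ l, g ⟨i, l⟩ := by
  rw [← Finset.sum_erase_add _ _ (Finset.mem_univ (k i)),
    ← Finset.sum_subtype {x : Σ i, κ i | x.2 ≠ k x.1} (fun x => Finset.mem_filter_univ x)
      fun x => if i = x.1 then g x else 0,
    Finset.sum_filter, Fintype.sum_sigma, Finset.sum_eq_single i]
  · simp only [if_true]
    rw [← Finset.sum_filter, Finset.filter_ne']
  · intro j _ hj
    simp only [hj.symm, if_false, ite_self, Finset.sum_const_zero]
  · simp

end Transversal

section Extension

variable {M : ℕ} {κ : Fin (M + 3) → Type*} [∀ i, Fintype (κ i)] [∀ i, DecidableEq (κ i)]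

/-- The coordinates of the canonical extension: those of the plane, and one for every added
vertex. -/
abbrev ExtIndex (k₀ : ∀ i, κ i) : Type _ := Fin 2 ⊕ {x : Σ i, κ i // x.2 ≠ k₀ x.1}

theorem card_wedgeFacet (k₀ : ∀ i, κ i) (f : Fin (M + 3) × ∀ i, κ i) :
    (wedgeFacet f).card = Fintype.card (ExtIndex k₀) := by
  have hfacet : wedgeFacet f = insert ⟨f.1, f.2 f.1⟩ (insert ⟨f.1 + 1, f.2 (f.1 + 1)⟩
      ({x | x.2 ≠ f.2 x.1} : Finset (Σ i, κ i))) := by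
    ext ⟨i, l⟩
    simp only [mem_wedgeFacet, Finset.mem_insert, Finset.mem_filter_univ]
    by_cases hl : l = f.2 i
    · subst hl
      simp only [ne_eq, not_true, or_false]
      exact or_congr ⟨by rintro rfl; rfl, congrArg Sigma.fst⟩
        ⟨by rintro rfl; rfl, congrArg Sigma.fst⟩
    · simp only [ne_eq, hl, not_false_eq_true, or_true]
  have hcard := card_off_transversal f.2
  rw [← card_off_transversal k₀, Fintype.card_subtype, add_left_inj] at hcard
  rw [hfacet, Finset.card_insert_of_notMem, Finset.card_insert_of_notMem, hcard,
    Fintype.card_sum, Fintype.card_fin, add_assoc, add_comm]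
  · simp
  · simp

variable (w : Fin (M + 3) → Fin 2 → ℤ)

/-- The rays of the canonical extension of the rays `w` in the plane. -/
def extVec (k₀ : ∀ i, κ i) (x : Σ i, κ i) : ExtIndex k₀ → ℤ
  | .inl t => if x.2 = k₀ x.1 then w x.1 t else 0
  | .inr y => (if x = y then 1 else 0) - if x.2 = k₀ x.1 ∧ x.1 = y.1.1 then 1 else 0

/-- The values of a dual vector of the canonical extension on the rays. -/
def extVal (f : Fin (M + 3) × ∀ i, κ i) (x y : Σ i, κ i) : ℤ :=
  if y ∈ wedgeFacet f then if x = y then 1 else 0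
  else planeDual w f.1 x.1 ⬝ᵥ w y.1 - if x.1 = y.1 then 1 else 0

/-- The dual vectors of the canonical extension. -/
def extDual (k₀ : ∀ i, κ i) (f : Fin (M + 3) × ∀ i, κ i) (x : Σ i, κ i) : ExtIndex k₀ → ℤ
  | .inl t => planeDual w f.1 x.1 t
  | .inr y => extVal w f x y

variable {w}

theorem sum_extVal (hw : IsUnimodularCycle w) {f : Fin (M + 3) × ∀ i, κ i} {x : Σ i, κ i}
    (hx : x ∈ wedgeFacet f) (i : Fin (M + 3)) :
    ∑ l, extVal w f x ⟨i, l⟩ = planeDual w f.1 x.1 ⬝ᵥ w i := by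
  have hsum : ∑ l, (if x = ⟨i, l⟩ then 1 else 0 : ℤ) = if x.1 = i then 1 else 0 := by
    obtain ⟨j, l₀⟩ := x
    by_cases hj : j = i
    · subst hj
      simp
    · simp [hj]
  by_cases hi : i = f.1 ∨ i = f.1 + 1
  · rw [hw.planeDual_dotProduct hi, ← hsum]
    exact Finset.sum_congr rfl fun l _ => if_pos (mem_wedgeFacet.2 (hi.imp_right Or.inl))
  · have hval (l) : extVal w f x ⟨i, l⟩ = (if x = ⟨i, l⟩ then 1 else 0) +
        if l = f.2 i then planeDual w f.1 x.1 ⬝ᵥ w i - if x.1 = i then 1 else 0 else 0 := by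
      by_cases hl : l = f.2 i
      · have hnot : (⟨i, l⟩ : Σ i, κ i) ∉ wedgeFacet f := by
          rw [mem_wedgeFacet, not_or, not_or, not_not]
          exact ⟨fun h => hi (Or.inl h), fun h => hi (Or.inr h), hl⟩
        have hne : x ≠ ⟨i, l⟩ := fun h => hnot (h ▸ hx)
        rw [extVal, if_neg hnot, if_neg hne, if_pos hl, zero_add]
      · rw [extVal, if_pos (mem_wedgeFacet.2 (Or.inr (Or.inr hl))), if_neg hl, add_zero]
    simp only [hval]
    rw [Finset.sum_add_distrib, hsum, Finset.sum_ite_eq', if_pos (Finset.mem_univ _),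
      add_sub_cancel]

theorem extDual_dotProduct_extVec (hw : IsUnimodularCycle w) (k₀ : ∀ i, κ i)
    {f : Fin (M + 3) × ∀ i, κ i} {x : Σ i, κ i} (hx : x ∈ wedgeFacet f) (y : Σ i, κ i) :
    extDual w k₀ f x ⬝ᵥ extVec w k₀ y = extVal w f x y := by
  rw [dotProduct, Fintype.sum_sum_type]
  simp only [extDual, extVec]
  by_cases hy : y.2 = k₀ y.1
  · have hoff (z : {x : Σ i, κ i // x.2 ≠ k₀ x.1}) : extVal w f x z *
        ((if y = z then 1 else 0) - if y.2 = k₀ y.1 ∧ y.1 = z.1.1 then 1 else 0) =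
        -if y.1 = z.1.1 then extVal w f x z else 0 := by
      have hne : y ≠ z := fun h => z.2 (h ▸ hy)
      rw [if_neg hne, zero_sub, mul_neg, mul_ite, mul_one, mul_zero]
      simp only [hy, true_and]
    have hsum := sum_off_transversal k₀ y.1 (extVal w f x)
    rw [sum_extVal hw hx, ← hy] at hsum
    rw [Fintype.sum_congr _ _ hoff, Finset.sum_neg_distrib]
    simp only [hy, if_true]
    change planeDual w f.1 x.1 ⬝ᵥ w y.1 + _ = _
    rw [← hsum]
    ring
  · simp only [hy, if_false, false_and, mul_zero, sub_zero, Finset.sum_const_zero, zero_add]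
    rw [Finset.sum_eq_single ⟨y, hy⟩]
    · rw [if_pos rfl, mul_one]
    · intro z _ hz
      rw [if_neg fun h => hz (Subtype.ext h.symm), mul_zero]
    · simp

/-- The canonical extension of a planar fan to the iterated wedge of a polygon. -/
def extSystem (hw : IsUnimodularCycle w) (k₀ : ∀ i, κ i) :
    UnimodularSystem (Fintype.card (ExtIndex k₀)) (Σ i, κ i) (Fin (M + 3) × ∀ i, κ i) :=
  .ofMatrix (extVec w k₀) wedgeFacet (extDual w k₀)
    (fun _ _ hx y hy => (extDual_dotProduct_extVec hw k₀ hx y).trans (if_pos hy))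
    (card_wedgeFacet k₀)

theorem pairing_extSystem (hw : IsUnimodularCycle w) (k₀ : ∀ i, κ i)
    {f : Fin (M + 3) × ∀ i, κ i} {x : Σ i, κ i} (hx : x ∈ wedgeFacet f) (y : Σ i, κ i) :
    pairing ((extSystem hw k₀).dual f x) ((extSystem hw k₀).rvec y) = extVal w f x y := by
  rw [← extDual_dotProduct_extVec hw k₀ hx y]
  refine (pairing_toReal _ _).trans (congrArg _ ?_)
  exact Equiv.sum_comp (Fintype.equivFin _).symm fun b => extDual w k₀ f x b * extVec w k₀ y b

theorem isWedge_extSystem (hw : IsUnimodularCycle w) (k₀ : ∀ i, κ i)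
    (hw' : ∀ a i, i ≠ a → i ≠ a + 1 → ¬(0 ≤ cross (w i) (w (a + 1)) ∧ 0 ≤ cross (w a) (w i))) :
    (extSystem hw k₀).IsWedge := by
  refine ⟨fun f => rfl, ?_⟩
  rintro ⟨a, k⟩ x hx ⟨hfst, hsnd⟩
  obtain ⟨hxa, hxa', -⟩ := notMem_wedgeFacet.1 hx
  rw [pairing_extSystem hw k₀ (mem_wedgeFacet.2 (by simp)), Int.cast_nonneg_iff, extVal,
    if_neg hx] at hfst hsnd
  refine hw' a x.1 hxa hxa' ⟨?_, ?_⟩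
  · rwa [if_neg hxa.symm, planeDual_self_dotProduct, sub_zero] at hfst
  · rwa [if_neg hxa'.symm, planeDual_add_one_dotProduct, sub_zero] at hsnd

end Extension

section PlaneRays

variable {M : ℕ}

/-- The rays `(1, 0), (1, 1), …, (1, M), (0, 1), (-1, -1)`. -/
def planeRays (M : ℕ) (i : Fin (M + 3)) : Fin 2 → ℤ :=
  if i.1 ≤ M then ![1, (i.1 : ℤ)] else if i.1 = M + 1 then ![0, 1] else ![-1, -1]

theorem val_add_one_eq_ite (a : Fin (M + 3)) :
    (a + 1).1 = if a.1 = M + 2 then 0 else a.1 + 1 := by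
  rw [Fin.val_add_one]
  simp only [Fin.ext_iff, Fin.val_last]

theorem isUnimodularCycle_planeRays (M : ℕ) : IsUnimodularCycle (planeRays M) := by
  intro a
  have ha := a.2
  simp only [cross, planeRays, val_add_one_eq_ite]
  split_ifs <;> simp only [Matrix.cons_val_zero, Matrix.cons_val_one] <;> omega

theorem planeRays_not_nonneg (a i : Fin (M + 3)) (hia : i ≠ a) (hia' : i ≠ a + 1) :
    ¬(0 ≤ cross (planeRays M i) (planeRays M (a + 1)) ∧
      0 ≤ cross (planeRays M a) (planeRays M i)) := by
  have ha := a.2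
  have hi := i.2
  rw [ne_eq, Fin.ext_iff] at hia hia'
  rw [val_add_one_eq_ite] at hia'
  simp only [cross, planeRays, val_add_one_eq_ite]
  split_ifs at hia' ⊢ <;> simp only [Matrix.cons_val_zero, Matrix.cons_val_one] <;> omega

end PlaneRays

theorem exists_ampleSystem_multiWedge {M : ℕ} (J : Fin (M + 3) → ℕ+) :
    ∃ (n : ℕ) (S : AmpleSystem n (Σ i, Fin (J i)) (Fin (M + 3) × ∀ i, Fin (J i))),
      ∀ s : Finset (Σ i, Fin (J i)), s.Nonempty →
        (s ∈ (multiWedge (polygon (M + 3)) J).faces ↔ S.IsFace s) := by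
  have hW := isWedge_extSystem (isUnimodularCycle_planeRays M)
    (fun i => (⟨0, (J i).pos⟩ : Fin (J i))) planeRays_not_nonneg
  exact ⟨_, hW.ampleSystem, fun s hs => by rw [hW.isFace_iff, mem_multiWedge_polygon_iff hs]⟩

end ToricWedge

end

theorem theorem1p1 (m : ℕ) (hm : 3 ≤ m) (J : Fin m → ℕ+) :
    (∀ (n : ℕ) (Δ : ToricWedge.Fan n),
      Δ.IsToricManifoldOver (ToricWedge.multiWedge (ToricWedge.polygon m) J) →
        ToricWedge.IsProjective Δ.structureMap ∧ Δ.IsStronglyPolytopal) ∧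
    ToricWedge.IsStronglyCombinatoriallyDelzant
      (ToricWedge.multiWedge (ToricWedge.polygon m) J) := by
  obtain ⟨M, rfl⟩ : ∃ M, m = M + 3 := ⟨m - 3, by omega⟩
  have : Nonempty (Fin (M + 3) × ∀ i, Fin (J i)) := ⟨(0, fun i => ⟨0, (J i).pos⟩)⟩
  have : Nonempty (Σ i, Fin (J i)) := ⟨⟨0, ⟨0, (J 0).pos⟩⟩⟩
  have hprojective (n : ℕ) (Δ : ToricWedge.Fan n)
      (hΔ : Δ.IsToricManifoldOver (ToricWedge.multiWedge (ToricWedge.polygon (M + 3)) J)) :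
      ToricWedge.IsProjective Δ.structureMap ∧ Δ.IsStronglyPolytopal := by
    obtain ⟨S, hS⟩ := hΔ.exists_ampleSystem
    exact ⟨hS.isProjective, hS.isStronglyPolytopal⟩
  obtain ⟨n, S, hS⟩ := ToricWedge.exists_ampleSystem_multiWedge J
  exact ⟨hprojective, ⟨S.isPolytopal hS, n, S.fan,
    ⟨S.isComplete_fan, S.isNonsingular_fan, S.isOver_fan hS⟩, S.spans_fan.isProjective⟩,
    fun n Δ hΔ => (hprojective n Δ hΔ).1⟩
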